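/- **Model.** A user has a type $\theta=(\theta_1,\theta_2)$ with independent Bernoulli($p$) coordinates, $0<p<1$; the user clicks on ad $i$ if and only if $\theta_i=1$. Two advertisers have independent private values per click $v_1,v_2\sim F$, where $F$ has support $[0,\overline v]$ and a density $f$ that is positive on $(0,\overline v)$, and is regular: the virtual value $\phi(v)=v-\frac{1-F(v)}{f(v)}$ is nondecreasing on $(0,\overline v)$. An auctioneer observes a stochastic process $(X_t)_{t\ge 0}$ in some $\mathbb R^n$ (the conversation), whose law may depend on $\theta$, with natural filtration $(\mathcal F_t)$ and $\mathcal F_\infty=\sigma(X_t:t\ge0)$. The conversation is *identifiable* if $\theta$ is almost surely equal to an $\mathcal F_\infty$-measurable random variable. In an auction with reserve $R\ge0$, the advertisers first submit bids $b_1,b_2\ge0$; the auctioneer, who cannot commit to a time, then chooses an $(\mathcal F_t)$-stopping time $\tau\in[0,\infty]$, which may depend on the bids. With beliefs $\mu^i_\tau=\mathbb E[\theta_i\mid\mathcal F_\tau]$, the ad of the bidder with the highest $\mu^i_\tau b_i$ among those with $b_i\ge R$ is shown (ties are split evenly). If it is clicked, the winner $i$ pays $b_i$ in a first-price auction; in a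 second-price auction he pays $\max\{R,\,\mu^{-i}_\tau b_{-i}/\mu^i_\tau\}$ if $b_{-i}\ge R$, and $R$ otherwise. An *equilibrium* consists of measurable bidding functions $\beta_1,\beta_2$ and a stopping rule $b\mapsto\tau(b)$, for which expected clicks and payments are measurable functions of the bids, such that (i) for all bids $b$ and at every time $t$, on $\{t\le\tau(b)\}$, no stopping time $\sigma\ge t$ gives a higher expected revenue conditional on $\mathcal F_t$ than $\tau(b)$, and (ii) no type $v\in[0,\overline v]$ of any bidder gains in expectation from another bid. An allocation $(x_1,x_2)$ is *optimal* at $(v,\theta)$ if it maximizes $x_1\theta_1\phi(v_1)+x_2\theta_2\phi(v_2)$ subject to $x_1,x_2\ge0$ and $x_1+x_2\le1$. The *optimal revenue* is the maximum of the expected revenue over all Bayesian incentive compatible and interim individually rational direct mechanisms with commitment, whose allocation may depend on the reports and on everything in $\mathcal F_\infty$ (transfers may depend on the entire state). The first-price auction with reserve $R$ *implements the optimal mechanism* if it has a symmetric equilibrium with strictly increasing bidding function in which $\tau(b)=\infty$ for all bids $b$, the resulting allocation is almost surely optimal for all $v_1,v_2\in(0,\overline v)$, and its expected revenue is the optimal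 revenue. **Theorem.** 1. For every $p\in(0,1)$, every identifiable conversation and every regular $F$, there is a reserve $R\ge0$ for which the first-price auction with reserve $R$ implements the optimal mechanism. Moreover, it does so for every $R\in(0,\overline v)$ with $\phi(R)=0$. In particular (by (i)) no commitment to timing is needed. 2. There is a regular distribution $F$ such that, in the Poisson bad-news model with any $p\in(0,1)$ and any rate $\lambda>0$ (coordinate $i$ of $X$ jumps from $0$ to $1$ at an independent exponential time with rate $\lambda$ if $\theta_i=0$, and never if $\theta_i=1$), no second-price auction with a reserve $R\ge0$ implements the optimal mechanism: in every equilibrium (symmetric or not) of every such auction, the allocation fails to be almost surely optimal, and the expected revenue is strictly below the expected revenue of some Bayesian incentive compatible, individually rational mechanism. -/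

import Mathlib

open MeasureTheory ProbabilityTheory Set
open scoped NNReal ENNReal

noncomputable section

namespace AdAuction

/-! ### Value distributions -/

/-- An absolutely continuous value distribution with support `[0, vbar]`: its density `f` is
positive in the interior of the support. -/
structure ValueDist where
  vbar : ℝ
  f : ℝ → ℝ
  vbar_pos : 0 < vbar
  measurable_f : Measurable f
  f_nonneg : ∀ v, 0 ≤ f v
  f_pos : ∀ v ∈ Ioo 0 vbar, 0 < f v
  f_support : ∀ v, v ∉ Icc 0 vbar → f v = 0
  lintegral_f : ∫⁻ v, ENNReal.ofReal (f v) = 1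

namespace ValueDist

/-- The law of one advertiser's value. -/
def law (D : ValueDist) : Measure ℝ := volume.withDensity fun v => ENNReal.ofReal (D.f v)

/-- The cumulative distribution function `F`. -/
def cdf (D : ValueDist) (v : ℝ) : ℝ := D.law.real (Iic v)

/-- The virtual value `φ(v) = v - (1 - F(v)) / f(v)`. -/
def virtualValue (D : ValueDist) (v : ℝ) : ℝ := v - (1 - D.cdf v) / D.f v

/-- Regularity: virtual values are nondecreasing. Only the interior of the support, where the
density is positive, is considered. -/
def Regular (D : ValueDist) : Prop := MonotoneOn D.virtualValue (Ioo 0 D.vbar)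

/-- The joint law of the two independent values. -/
def jointLaw (D : ValueDist) : Measure (Fin 2 → ℝ) := Measure.pi fun _ => D.law

end ValueDist

/-! ### Conversations, beliefs, stopping times -/

/-- A conversation on the sample space `Ω`: the user's type `θ = (θ 0, θ 1)` has independent
Bernoulli(`p`) coordinates, and `X` is the (possibly multidimensional) process that the auctioneer
observes, whose law may depend on `θ` in any way. -/
structure Conversation (Ω : Type*) [MeasurableSpace Ω] (p : ℝ) where
  P : Measure Ω
  isProb : IsProbabilityMeasure P
  θ : Fin 2 → Ω → ℝ
  measurable_θ : ∀ i, Measurable (θ i)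
  θ_zero_or_one : ∀ i ω, θ i ω = 0 ∨ θ i ω = 1
  θ_good : ∀ i, P {ω | θ i ω = 1} = ENNReal.ofReal p
  θ_indep : iIndepFun θ P
  dim : ℕ
  X : ℝ≥0 → Ω → (Fin dim → ℝ)
  measurable_X : ∀ t, Measurable (X t)

namespace Conversation

variable {Ω : Type*} [mΩ : MeasurableSpace Ω] {p : ℝ}

/-- The natural filtration of the observed process: the auctioneer's information. -/
def filtration (C : Conversation Ω p) : Filtration ℝ≥0 mΩ :=
  Filtration.natural C.X fun t => (C.measurable_X t).stronglyMeasurable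

/-- All the information that the conversation ever reveals. -/
abbrev infoLimit (C : Conversation Ω p) : MeasurableSpace Ω := ⨆ t, C.filtration t

/-- The whole path of the conversation identifies the user's type almost surely. -/
def Identifiable (C : Conversation Ω p) : Prop :=
  ∃ g : Ω → (Fin 2 → ℝ), Measurable[C.infoLimit] g ∧ ∀ᵐ ω ∂C.P, ∀ i, g ω i = C.θ i ω

/-- Stopping times with values in `[0, ∞]`. -/
def StoppingTime (C : Conversation Ω p) : Type _ :=
  {τ : Ω → WithTop ℝ≥0 // IsStoppingTime C.filtration τ}

/-- The stopping time `τ = ∞`. -/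
def never (C : Conversation Ω p) : C.StoppingTime :=
  ⟨fun _ => ⊤, fun i => by simp⟩

/-- The belief `E[θ i | F_τ]` at the stopping time `τ`; on `τ = ∞` the available information is
everything that the conversation reveals. -/
def belief (C : Conversation Ω p) (τ : C.StoppingTime) (i : Fin 2) : Ω → ℝ :=
  C.P[C.θ i | τ.2.measurableSpace]

end Conversation

/-! ### The Poisson bad-news model -/

/-- The Bernoulli law on `Bool`. -/
def bernoulliLaw (p : ℝ) : Measure Bool :=
  ENNReal.ofReal p • Measure.dirac true + ENNReal.ofReal (1 - p) • Measure.dirac false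

theorem isProb_bernoulliLaw {p : ℝ} (hp0 : 0 < p) (hp1 : p < 1) :
    IsProbabilityMeasure (bernoulliLaw p) := by
  constructor
  simp only [bernoulliLaw, Measure.add_apply, Measure.smul_apply, measure_univ, smul_eq_mul,
    mul_one]
  rw [← ENNReal.ofReal_add hp0.le (by linarith)]
  simp

/-- The sample space of the bad-news model: for each ad, its quality and an exponential clock. -/
abbrev BadNewsSpace : Type := Fin 2 → Bool × ℝ

/-- The law of independent qualities and independent clocks with rate `lam`. -/
def badNewsLaw (p lam : ℝ) : Measure BadNewsSpace :=
  Measure.pi fun _ => (bernoulliLaw p).prod (expMeasure lam)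

/-- The quality of ad `i`. -/
def badNewsType (i : Fin 2) (ω : BadNewsSpace) : ℝ := if (ω i).1 then 1 else 0

/-- Coordinate `i` jumps from `0` to `1` when the clock of ad `i` ticks, provided that the ad is
bad; it never jumps if the ad is good. Thus the arrival rate is `lam * (1 - θ i)`. -/
def badNewsProcess (t : ℝ≥0) (ω : BadNewsSpace) (i : Fin 2) : ℝ :=
  if (ω i).1 = false ∧ (ω i).2 ≤ t then 1 else 0

theorem measurable_boolIndicator : Measurable fun z : Bool × ℝ => (if z.1 then (1 : ℝ) else 0) :=
  (measurable_of_countable fun c : Bool => if c then (1 : ℝ) else 0).comp measurable_fst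

theorem badNewsType_good {p lam : ℝ} (hp0 : 0 < p) (hp1 : p < 1) (hl : 0 < lam) (i : Fin 2) :
    badNewsLaw p lam {ω | badNewsType i ω = 1} = ENNReal.ofReal p := by
  have := isProb_bernoulliLaw hp0 hp1
  have := isProbabilityMeasure_expMeasure hl
  have h : {ω : BadNewsSpace | badNewsType i ω = 1}
      = Function.eval i ⁻¹' (({true} : Set Bool) ×ˢ (univ : Set ℝ)) := by
    ext ω
    simp [badNewsType]
  rw [h, badNewsLaw]
  rw [(measurePreserving_eval
      (fun _ : Fin 2 => (bernoulliLaw p).prod (expMeasure lam)) i).measure_preimage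
    ((measurableSet_singleton true).prod MeasurableSet.univ).nullMeasurableSet]
  rw [Measure.prod_prod]
  simp [bernoulliLaw]

/-- The Poisson bad-news conversation with prior `p` and rate `lam`. -/
def badNews (p lam : ℝ) (hp0 : 0 < p) (hp1 : p < 1) (hl : 0 < lam) :
    Conversation BadNewsSpace p where
  P := badNewsLaw p lam
  isProb := by
    have := isProb_bernoulliLaw hp0 hp1
    have := isProbabilityMeasure_expMeasure hl
    unfold badNewsLaw
    infer_instance
  θ := badNewsType
  measurable_θ i := measurable_boolIndicator.comp (measurable_pi_apply i)
  θ_zero_or_one i ω := by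
    unfold badNewsType
    split_ifs <;> simp
  θ_good := badNewsType_good hp0 hp1 hl
  θ_indep := by
    have := isProb_bernoulliLaw hp0 hp1
    have := isProbabilityMeasure_expMeasure hl
    exact iIndepFun_pi (μ := fun _ : Fin 2 => (bernoulliLaw p).prod (expMeasure lam))
      (X := fun _ z => if z.1 then (1 : ℝ) else 0)
      fun _ => measurable_boolIndicator.aemeasurable
  dim := 2
  X := badNewsProcess
  measurable_X t := by
    refine measurable_pi_lambda _ fun i => Measurable.ite ?_ measurable_const measurable_const
    have h : MeasurableSet {z : Bool × ℝ | z.1 = false ∧ z.2 ≤ t} :=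
      (measurable_fst (measurableSet_singleton false)).inter (measurable_snd measurableSet_Iic)
    have hi : Measurable fun ω : BadNewsSpace => ω i := measurable_pi_apply i
    exact hi h

/-! ### The two auction formats -/

inductive Format
  | firstPrice
  | secondPrice

/-- The probability that bidder `i` wins at beliefs `m`, bids `b` and reserve `R`: among the bids
that meet the reserve, the highest quality-weighted bid wins, and ties are split evenly. -/
def share (R : ℝ) (m b : Fin 2 → ℝ) (i : Fin 2) : ℝ :=
  if b i < R then 0
  else if b i.rev < R ∨ b i.rev * m i.rev < b i * m i then 1
  else if b i.rev * m i.rev = b i * m i then 1 / 2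
  else 0

/-- The price per click that bidder `i` pays if he wins: his bid in a first-price auction; in a
second-price auction the smallest bid that meets the reserve and does not lose against the
quality-weighted bid of an eligible opponent. -/
def price (fmt : Format) (R : ℝ) (m b : Fin 2 → ℝ) (i : Fin 2) : ℝ :=
  match fmt with
  | .firstPrice => b i
  | .secondPrice => if b i.rev < R then R else max R (b i.rev * m i.rev / m i)

/-- The profile in which `i` has entry `a` and the opponent has entry `c`. -/
def profile (i : Fin 2) (a c : ℝ) : Fin 2 → ℝ := fun k => if k = i then a else c

section Game

variable {Ω : Type*} [mΩ : MeasurableSpace Ω] {p : ℝ}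

/-- The winning probabilities in state `ω` if the auction is run at `τ` with bids `b`. -/
def allocation (C : Conversation Ω p) (R : ℝ) (τ : C.StoppingTime) (b : Fin 2 → ℝ) (ω : Ω) :
    Fin 2 → ℝ :=
  share R (fun j => C.belief τ j ω) b

/-- The payment collected from bidder `i`: the price is paid only after a click (`θ i = 1`). -/
def collected (C : Conversation Ω p) (fmt : Format) (R : ℝ) (τ : C.StoppingTime)
    (b : Fin 2 → ℝ) (i : Fin 2) (ω : Ω) : ℝ :=
  C.θ i ω * allocation C R τ b ω i * price fmt R (fun j => C.belief τ j ω) b i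

/-- The auctioneer's revenue in state `ω`. -/
def revenueAt (C : Conversation Ω p) (fmt : Format) (R : ℝ) (τ : C.StoppingTime)
    (b : Fin 2 → ℝ) (ω : Ω) : ℝ :=
  ∑ i, collected C fmt R τ b i ω

/-- The stopping time `τ` is sequentially rational given the bids `b`: at every time `t` at which
the auction has not been run before, no continuation `σ` gives a higher conditional expected
revenue. In particular the auctioneer needs no commitment to follow `τ`. -/
def SequentiallyRational (C : Conversation Ω p) (fmt : Format) (R : ℝ) (b : Fin 2 → ℝ)
    (τ : C.StoppingTime) : Prop :=
  ∀ (t : ℝ≥0) (σ : C.StoppingTime), (∀ ω, (t : WithTop ℝ≥0) ≤ σ.1 ω) →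
    ∀ᵐ ω ∂C.P, (t : WithTop ℝ≥0) ≤ τ.1 ω →
      (C.P[revenueAt C fmt R σ b | C.filtration t]) ω
        ≤ (C.P[revenueAt C fmt R τ b | C.filtration t]) ω

/-- The expected number of clicks that bidder `i` gets. -/
def expClicks (C : Conversation Ω p) (R : ℝ) (τ : C.StoppingTime) (b : Fin 2 → ℝ)
    (i : Fin 2) : ℝ :=
  ∫ ω, C.θ i ω * allocation C R τ b ω i ∂C.P

/-- The expected payment of bidder `i`. -/
def expPayment (C : Conversation Ω p) (fmt : Format) (R : ℝ) (τ : C.StoppingTime)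
    (b : Fin 2 → ℝ) (i : Fin 2) : ℝ :=
  ∫ ω, collected C fmt R τ b i ω ∂C.P

/-- The expected profit of bidder `i` with value `v` who bids `a`, when the opponent bids according
to `β` and the auctioneer runs the auction at `T b` after receiving the bids `b`. -/
def interimProfit (D : ValueDist) (C : Conversation Ω p) (fmt : Format) (R : ℝ)
    (T : (Fin 2 → ℝ) → C.StoppingTime) (β : Fin 2 → ℝ → ℝ) (i : Fin 2) (v a : ℝ) : ℝ :=
  ∫ w, (v * expClicks C R (T (profile i a (β i.rev w))) (profile i a (β i.rev w)) i
    - expPayment C fmt R (T (profile i a (β i.rev w))) (profile i a (β i.rev w)) i) ∂D.law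

/-- An equilibrium of the auction with reserve `R`: bidding functions `β` for the two advertisers
and an exercise policy `T` of the auctioneer, who cannot commit. -/
structure IsEquilibrium (D : ValueDist) (C : Conversation Ω p) (fmt : Format) (R : ℝ)
    (β : Fin 2 → ℝ → ℝ) (T : (Fin 2 → ℝ) → C.StoppingTime) : Prop where
  measurable_bid : ∀ i, Measurable (β i)
  bid_nonneg : ∀ i, ∀ v ∈ Icc 0 D.vbar, 0 ≤ β i v
  /-- Expected clicks and payments depend measurably on the bids. -/
  measurable_clicks : ∀ i, Measurable fun b : Fin 2 → ℝ => expClicks C R (T b) b i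
  measurable_payment : ∀ i, Measurable fun b : Fin 2 → ℝ => expPayment C fmt R (T b) b i
  /-- The exercise policy is sequentially rational after any bids. -/
  rational : ∀ b : Fin 2 → ℝ, (∀ i, 0 ≤ b i) → SequentiallyRational C fmt R b (T b)
  /-- No type of any bidder gains from another bid. -/
  best_reply : ∀ i, ∀ v ∈ Icc 0 D.vbar, ∀ a, 0 ≤ a →
    interimProfit D C fmt R T β i v a ≤ interimProfit D C fmt R T β i v (β i v)

/-- The auctioneer's expected revenue. -/
def auctionRevenue (D : ValueDist) (C : Conversation Ω p) (fmt : Format) (R : ℝ)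
    (β : Fin 2 → ℝ → ℝ) (T : (Fin 2 → ℝ) → C.StoppingTime) : ℝ :=
  ∫ v, ∑ i, expPayment C fmt R (T fun j => β j (v j)) (fun j => β j (v j)) i ∂D.jointLaw

/-! ### The optimal mechanism -/

/-- The allocation `x` maximizes the quality-weighted virtual value
`x 0 * θ 0 * φ (v 0) + x 1 * θ 1 * φ (v 1)` subject to `0 ≤ x` and `x 0 + x 1 ≤ 1`. -/
def IsOptimalAllocation (D : ValueDist) (v θ x : Fin 2 → ℝ) : Prop :=
  (∀ i, 0 ≤ x i) ∧ ∑ i, x i ≤ 1 ∧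
    ∀ y : Fin 2 → ℝ, (∀ i, 0 ≤ y i) → ∑ i, y i ≤ 1 →
      ∑ i, y i * (θ i * D.virtualValue (v i)) ≤ ∑ i, x i * (θ i * D.virtualValue (v i))

/-- A direct mechanism with full commitment: the allocation probabilities may depend on the
reported values and on everything that the conversation ever reveals, the transfers on anything. -/
structure Mechanism (D : ValueDist) (C : Conversation Ω p) where
  x : Fin 2 → (Fin 2 → ℝ) → Ω → ℝ
  transfer : Fin 2 → (Fin 2 → ℝ) → Ω → ℝ
  measurable_x : ∀ i,
    Measurable[MeasurableSpace.prod MeasurableSpace.pi C.infoLimit] (Function.uncurry (x i))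
  measurable_transfer : ∀ i, Measurable (Function.uncurry (transfer i))
  x_nonneg : ∀ i v ω, 0 ≤ x i v ω
  x_sum_le : ∀ v ω, ∑ i, x i v ω ≤ 1
  integrable_transfer : ∀ i, Integrable (Function.uncurry (transfer i)) (D.jointLaw.prod C.P)
  integrable_interim : ∀ i, ∀ r ∈ Icc 0 D.vbar,
    Integrable (fun z : ℝ × Ω => transfer i (profile i r z.1) z.2) (D.law.prod C.P)

namespace Mechanism

variable {D : ValueDist} {C : Conversation Ω p}

/-- The expected profit of bidder `i` with value `v` who reports `r` against a truthful opponent. -/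
def interimProfit (M : Mechanism D C) (i : Fin 2) (v r : ℝ) : ℝ :=
  ∫ w, ∫ ω, (v * (C.θ i ω * M.x i (profile i r w) ω) - M.transfer i (profile i r w) ω) ∂C.P ∂D.law

/-- Bayesian incentive compatibility. -/
def IncentiveCompatible (M : Mechanism D C) : Prop :=
  ∀ i, ∀ v ∈ Icc 0 D.vbar, ∀ r ∈ Icc 0 D.vbar, M.interimProfit i v r ≤ M.interimProfit i v v

/-- Interim individual rationality. -/
def IndividuallyRational (M : Mechanism D C) : Prop :=
  ∀ i, ∀ v ∈ Icc 0 D.vbar, 0 ≤ M.interimProfit i v v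

/-- The expected revenue. -/
def revenue (M : Mechanism D C) : ℝ :=
  ∫ v, ∫ ω, ∑ i, M.transfer i v ω ∂C.P ∂D.jointLaw

end Mechanism

/-- The expected revenues attainable by an auctioneer with full commitment power. -/
def attainableRevenues (D : ValueDist) (C : Conversation Ω p) : Set ℝ :=
  {r | ∃ M : Mechanism D C, M.IncentiveCompatible ∧ M.IndividuallyRational ∧ M.revenue = r}

/-- The first-price auction with reserve `R` implements the optimal mechanism without commitment to
timing: it has a symmetric equilibrium in increasing bidding functions in which the auctioneer
never stops early, which is sequentially rational; the winner has the highest positive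
quality-weighted virtual value; and no mechanism with full commitment has a higher revenue. -/
def FirstPriceImplements (D : ValueDist) (C : Conversation Ω p) (R : ℝ) : Prop :=
  ∃ β : ℝ → ℝ, StrictMonoOn β (Icc 0 D.vbar) ∧
    IsEquilibrium D C .firstPrice R (fun _ => β) (fun _ => C.never) ∧
    (∀ v : Fin 2 → ℝ, (∀ i, v i ∈ Ioo 0 D.vbar) → ∀ᵐ ω ∂C.P,
      IsOptimalAllocation D v (fun i => C.θ i ω) (allocation C R C.never (fun i => β (v i)) ω)) ∧
    IsGreatest (attainableRevenues D C)
      (auctionRevenue D C .firstPrice R (fun _ => β) (fun _ => C.never))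

end Game

end AdAuction

end

open AdAuction

/-!
The argument rests on a revenue formula that holds for mechanisms and auctions alike. Along an
incentive compatible pair of interim allocation and transfer the utility of a value grows at the
rate of its interim clicks (`envelope`), and exchanging the order of integration turns expected
transfers into expected virtual values (`ValueDist.integral_transfer`). Hence no mechanism earns
more than `∫ optSurplus`, the expectation of the highest nonnegative quality-weighted virtual value
(`Mechanism.revenue_le`). In an equilibrium of either auction the bid zero costs nothing, which pins
down the profit of the lowest type; the revenue is then exactly the expected virtual value of the
clicks (`IsEquilibrium.auctionRevenue_eq`), and it reaches `∫ optSurplus` if and only if the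
allocation is almost surely optimal (`IsEquilibrium.auctionRevenue_eq_iff`).

*First price.* The auctioneer collects the winner's own bid on a click. In every state the best he
can get is the highest eligible bid on a good ad, which is what a sale under full information
yields; so waiting forever is sequentially rational (`sequentiallyRational_never`). Under full
information a bidder with a good ad faces a competitor with probability `p` only, and wins against
him as in a standard first-price auction: the value `v` wins with probability `1 - p + p * F v`, and
shading by the information rent over this probability is an equilibrium
(`isEquilibrium_firstPrice`). Bids increase in values, and only values with nonnegative virtual
value need to participate, so the allocation is optimal. A reserve exists because the virtual value
has mean zero and is monotone (`ValueDist.exists_sign_change`); as the density may jump, the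
virtual value may jump over zero at the reserve, and whether the reserve value itself participates
depends on its sign there.

*Second price.* In the bad-news model a stopping time is deterministic as long as there is no bad
news, and the quiet event is an atom of the information at that time, on which both beliefs agree by
symmetry (`binaryNews_badNews`). So all that matters about a stopping time is the probability `y`
that an ad has no bad news when a quiet auction is run. For bids `lo < hi` above the reserve `R` the
revenue is `p * (2 * R + y * (lo - 2 * R))`: the auctioneer waits if `lo < 2 * R` and sells at once
if `lo > 2 * R` (`quietProb_of_sequentiallyRational`). Selling early misallocates clicks, so with an
optimal allocation all types above the optimal reserve value bid at most `2 * R`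
(`bids_of_optimal`). Individual rationality of types just above that value bounds `R`. If some values
exceed twice the optimal reserve value, a high type then prefers the bid `2 * R`, which beats every
opponent and is followed by waiting (`not_optimal_secondPrice`). The triangular distribution on
`[0, 1]` has the optimal reserve value `1 / 3`, so such types exist. An equilibrium without an optimal
allocation earns strictly less than `∫ optSurplus`, which the mechanism behind the first-price
auction attains.
-/

noncomputable section

namespace AdAuction

/-! ### Virtual values and the envelope formula -/

namespace ValueDist

variable (D : ValueDist)

instance isProbabilityMeasure_law : IsProbabilityMeasure D.law := by
  constructor
  rw [law, withDensity_apply _ MeasurableSet.univ, Measure.restrict_univ, D.lintegral_f]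

theorem law_absolutelyContinuous : D.law ≪ volume := withDensity_absolutelyContinuous _ _

instance nullSingletonClass_law : NullSingletonClass D.law :=
  ⟨fun _ => D.law_absolutelyContinuous (measure_singleton _)⟩

instance isProbabilityMeasure_jointLaw : IsProbabilityMeasure D.jointLaw := by
  unfold jointLaw; infer_instance

theorem integral_law (g : ℝ → ℝ) : ∫ v, g v ∂D.law = ∫ v, D.f v * g v := by
  rw [law, integral_withDensity_eq_integral_toReal_smul D.measurable_f.ennreal_ofReal
    (ae_of_all _ fun _ => ENNReal.ofReal_lt_top)]
  simp [ENNReal.toReal_ofReal (D.f_nonneg _)]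

theorem integrable_law_iff {g : ℝ → ℝ} :
    Integrable g D.law ↔ Integrable fun v => D.f v * g v := by
  rw [law, integrable_withDensity_iff_integrable_smul' D.measurable_f.ennreal_ofReal
    (ae_of_all _ fun _ => ENNReal.ofReal_lt_top)]
  simp [ENNReal.toReal_ofReal (D.f_nonneg _)]

theorem ae_mem_Ioo : ∀ᵐ v ∂D.law, v ∈ Ioo 0 D.vbar := by
  have h1 : ∀ᵐ v ∂D.law, v ∈ Icc 0 D.vbar := by
    rw [law, ae_withDensity_iff D.measurable_f.ennreal_ofReal]
    refine ae_of_all _ fun v hv => ?_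
    by_contra hc
    exact hv (by rw [D.f_support v hc, ENNReal.ofReal_zero])
  have h2 : ∀ᵐ v ∂D.law, v ≠ 0 := by simp [ae_iff]
  have h3 : ∀ᵐ v ∂D.law, v ≠ D.vbar := by simp [ae_iff]
  filter_upwards [h1, h2, h3] with v a b c
  exact ⟨lt_of_le_of_ne a.1 (Ne.symm b), lt_of_le_of_ne a.2 c⟩

theorem ae_mem_Icc : ∀ᵐ v ∂D.law, v ∈ Icc 0 D.vbar :=
  D.ae_mem_Ioo.mono fun _ h => Ioo_subset_Icc_self h

theorem law_Ioo_pos {r s : ℝ} (hr : 0 ≤ r) (hrs : r < s) (hs : s ≤ D.vbar) :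
    0 < D.law (Ioo r s) := by
  rw [pos_iff_ne_zero, law, Ne, withDensity_apply_eq_zero D.measurable_f.ennreal_ofReal]
  have : {x | ENNReal.ofReal (D.f x) ≠ 0} ∩ Ioo r s = Ioo r s := by
    refine inter_eq_right.2 fun x hx => ?_
    have := D.f_pos x ⟨hr.trans_lt hx.1, hx.2.trans_le hs⟩
    simpa using this
  rw [this]
  simp [hrs]

theorem cdf_mono : Monotone D.cdf := fun _ _ h =>
  measureReal_mono (Iic_subset_Iic.2 h)

theorem measurable_cdf : Measurable D.cdf := D.cdf_mono.measurable

theorem cdf_nonneg (v : ℝ) : 0 ≤ D.cdf v := measureReal_nonneg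

theorem cdf_le_one (v : ℝ) : D.cdf v ≤ 1 := measureReal_le_one

theorem law_real_Iio (v : ℝ) : D.law.real (Iio v) = D.cdf v :=
  measureReal_congr Iio_ae_eq_Iic

theorem law_real_Ioi (v : ℝ) : D.law.real (Ioi v) = 1 - D.cdf v := by
  rw [cdf, ← compl_Iic, probReal_compl_eq_one_sub measurableSet_Iic]

theorem cdf_vbar : D.cdf D.vbar = 1 := by
  have : (Iic D.vbar : Set ℝ) =ᵐ[D.law] univ := by
    filter_upwards [D.ae_mem_Icc] with v hv
    exact propext ⟨fun _ => trivial, fun _ => hv.2⟩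
  rw [cdf, measureReal_congr this, probReal_univ]

theorem cdf_strictMonoOn : StrictMonoOn D.cdf (Icc 0 D.vbar) := by
  intro r hr s hs hrs
  have h : D.cdf s - D.cdf r = D.law.real (Ioc r s) := by
    have h0 : Ioc r s = Iic s \ Iic r := by ext x; simp [and_comm]
    rw [cdf, cdf, h0, measureReal_sdiff (Iic_subset_Iic.2 hrs.le) measurableSet_Iic]
  have h2 : 0 < D.law.real (Ioc r s) := by
    refine lt_of_lt_of_le ?_ (measureReal_mono Ioo_subset_Ioc_self)
    exact ENNReal.toReal_pos (D.law_Ioo_pos hr.1 hrs hs.2).ne' (measure_ne_top _ _)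
  linarith

theorem integrable_f : Integrable D.f := by
  simpa using (D.integrable_law_iff (g := fun _ => 1)).1 (integrable_const _)

theorem cdf_eq_integral (v : ℝ) : D.cdf v = ∫ x in Iic v, D.f x := by
  rw [cdf, measureReal_def, law, withDensity_apply _ measurableSet_Iic,
    integral_eq_lintegral_of_nonneg_ae (ae_of_all _ D.f_nonneg)
      D.measurable_f.aestronglyMeasurable]

theorem continuous_cdf : Continuous D.cdf := by
  have h : D.cdf = fun v => (∫ x in Iic 0, D.f x) + ∫ x in (0 : ℝ)..v, D.f x := by
    funext v
    rw [cdf_eq_integral, ← intervalIntegral.integral_Iic_sub_Iic D.integrable_f.integrableOn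
      D.integrable_f.integrableOn]
    ring
  rw [h]
  exact continuous_const.add
    (intervalIntegral.continuous_primitive (fun _ _ => D.integrable_f.intervalIntegrable) 0)

theorem measurable_virtualValue : Measurable D.virtualValue :=
  measurable_id.sub ((measurable_const.sub D.measurable_cdf).div D.measurable_f)

theorem integrable_hazard : Integrable (fun v => (1 - D.cdf v) / D.f v) D.law := by
  rw [integrable_law_iff]
  have : Integrable ((Icc 0 D.vbar).indicator fun _ => (1 : ℝ)) := by
    rw [integrable_indicator_iff measurableSet_Icc]
    simp
  refine this.mono ?_ (ae_of_all _ fun v => ?_)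
  · exact (D.measurable_f.mul ((measurable_const.sub D.measurable_cdf).div
      D.measurable_f)).aestronglyMeasurable
  · by_cases hv : v ∈ Icc 0 D.vbar
    · rw [indicator_of_mem hv]
      by_cases hf : D.f v = 0
      · simp [hf]
      · rw [mul_div_cancel₀ _ hf, Real.norm_eq_abs, abs_of_nonneg (by linarith [D.cdf_le_one v])]
        simp [D.cdf_nonneg v]
    · simp [D.f_support v hv]

theorem integrable_id_law : Integrable (fun v : ℝ => v) D.law :=
  Integrable.of_bound measurable_id.aestronglyMeasurable D.vbar (by
    filter_upwards [D.ae_mem_Icc] with v hv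
    rw [Real.norm_eq_abs, abs_of_nonneg hv.1]
    exact hv.2)

theorem integrable_virtualValue : Integrable D.virtualValue D.law :=
  D.integrable_id_law.sub D.integrable_hazard

/-- Exchanging the order of integration: information rents expressed through the inverse hazard
rate. -/
theorem integral_rent {q : ℝ → ℝ} (hq : Measurable q) (h01 : ∀ v, q v ∈ Icc (0 : ℝ) 1) :
    ∫ v, (∫ s in (0 : ℝ)..v, q s) ∂D.law = ∫ s, q s * ((1 - D.cdf s) / D.f s) ∂D.law := by
  have key : ∀ v ∈ Icc 0 D.vbar, (∫ s in (0 : ℝ)..v, q s)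
      = ∫ s in Ioo 0 D.vbar, (Iio v).indicator q s := by
    intro v hv
    rw [intervalIntegral.integral_of_le hv.1, setIntegral_indicator measurableSet_Iio,
      integral_Ioc_eq_integral_Ioo]
    congr 2
    ext s
    simp only [mem_Ioo, mem_inter_iff, mem_Iio]
    exact ⟨fun h => ⟨⟨h.1, h.2.trans_le hv.2⟩, h.2⟩, fun h => ⟨h.1.1, h.2⟩⟩
  have hmeas : Measurable (fun z : ℝ × ℝ => (Iio z.1).indicator q z.2) := by
    have : (fun z : ℝ × ℝ => (Iio z.1).indicator q z.2)
        = {z : ℝ × ℝ | z.2 < z.1}.indicator (fun z => q z.2) := by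
      ext z; simp [indicator_apply]
    rw [this]
    exact (hq.comp measurable_snd).indicator (measurableSet_lt measurable_snd measurable_fst)
  have hint : Integrable (fun z : ℝ × ℝ => (Iio z.1).indicator q z.2)
      (D.law.prod (volume.restrict (Ioo 0 D.vbar))) := by
    refine Integrable.of_bound hmeas.aestronglyMeasurable 1 (ae_of_all _ fun z => ?_)
    rw [indicator_apply]
    split_ifs
    · rw [Real.norm_eq_abs, abs_of_nonneg (h01 _).1]; exact (h01 _).2
    · simp
  calc ∫ v, (∫ s in (0 : ℝ)..v, q s) ∂D.law
      = ∫ v, (∫ s in Ioo 0 D.vbar, (Iio v).indicator q s) ∂D.law :=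
        integral_congr_ae (D.ae_mem_Icc.mono key)
    _ = ∫ s in Ioo 0 D.vbar, (∫ v, (Iio v).indicator q s ∂D.law) := integral_integral_swap hint
    _ = ∫ s in Ioo 0 D.vbar, D.f s * (q s * ((1 - D.cdf s) / D.f s)) := by
        refine setIntegral_congr_fun measurableSet_Ioo fun s hs => ?_
        have h1 : (fun v => (Iio v).indicator q s) = (Ioi s).indicator fun _ => q s := by
          ext v; simp [indicator_apply]
        have h2 := (D.f_pos s hs).ne'
        simp only [h1]
        rw [integral_indicator_const _ measurableSet_Ioi, law_real_Ioi, smul_eq_mul]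
        field_simp
    _ = ∫ s, q s * ((1 - D.cdf s) / D.f s) ∂D.law := by
        rw [integral_law, ← integral_Icc_eq_integral_Ioo]
        refine setIntegral_eq_integral_of_forall_compl_eq_zero fun s hs => ?_
        simp [D.f_support s hs]

end ValueDist

/-- The envelope formula: along an incentive compatible pair of interim allocation `q` and interim
transfer `t`, utility accrues at the rate `q`. Writing `H` for the difference of the two sides,
incentive compatibility bounds the increments of `H` by the length of a step times the increment
of the monotone function `q`, and these bounds telescope over a fine partition. -/
theorem envelope {V : ℝ} {q t : ℝ → ℝ}
    (hIC : ∀ v ∈ Icc 0 V, ∀ r ∈ Icc 0 V, v * q r - t r ≤ v * q v - t v)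
    {v : ℝ} (hv : v ∈ Icc 0 V) :
    v * q v - t v = (∫ s in (0 : ℝ)..v, q s) - t 0 := by
  have hmono : MonotoneOn q (Icc 0 V) := by
    intro r hr s hs hrs
    rcases hrs.eq_or_lt with rfl | h
    · exact le_rfl
    · have h1 := hIC r hr s hs
      have h2 := hIC s hs r hr
      nlinarith
  have hint : ∀ r ∈ Icc 0 V, ∀ s ∈ Icc 0 V, IntervalIntegrable q volume r s := by
    intro r hr s hs
    refine (hmono.mono ?_).intervalIntegrable
    exact (uIcc_subset_Icc hr hs)
  have hV0 : (0 : ℝ) ∈ Icc 0 V := ⟨le_rfl, hv.1.trans hv.2⟩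
  set H : ℝ → ℝ := fun v => v * q v - t v - ∫ s in (0 : ℝ)..v, q s with hH
  have hinc : ∀ r ∈ Icc 0 V, ∀ s ∈ Icc 0 V, r ≤ s →
      |H s - H r| ≤ (s - r) * (q s - q r) := by
    intro r hr s hs hrs
    have h1 := hIC r hr s hs
    have h2 := hIC s hs r hr
    have h3 : (∫ x in (0 : ℝ)..s, q x) - ∫ x in (0 : ℝ)..r, q x = ∫ x in r..s, q x :=
      intervalIntegral.integral_interval_sub_left (hint 0 hV0 s hs) (hint 0 hV0 r hr)
    have h4 : (s - r) * q r ≤ ∫ x in r..s, q x := by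
      have := intervalIntegral.integral_mono_on hrs
        (intervalIntegrable_const (μ := volume) (c := q r)) (hint r hr s hs)
        (fun x hx => hmono hr ⟨hr.1.trans hx.1, hx.2.trans hs.2⟩ hx.1)
      simpa using this
    have h5 : ∫ x in r..s, q x ≤ (s - r) * q s := by
      have := intervalIntegral.integral_mono_on hrs (hint r hr s hs)
        (intervalIntegrable_const (μ := volume) (c := q s))
        (fun x hx => hmono ⟨hr.1.trans hx.1, hx.2.trans hs.2⟩ hs hx.2)
      simpa using this
    rw [abs_le]
    simp only [hH]
    constructor <;> nlinarith
  have hbound : ∀ n : ℕ, |H v - H 0| ≤ v * (q v - q 0) / (n + 1 : ℝ) := by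
    intro n
    set x : ℕ → ℝ := fun k => v * k / (n + 1 : ℝ) with hx
    have hn : (0 : ℝ) < n + 1 := by positivity
    have hxmem : ∀ k ≤ n + 1, x k ∈ Icc 0 V := by
      intro k hk
      have hk' : (k : ℝ) ≤ n + 1 := by exact_mod_cast hk
      refine ⟨div_nonneg (mul_nonneg hv.1 k.cast_nonneg) hn.le, le_trans ?_ hv.2⟩
      rw [hx, div_le_iff₀ hn]
      exact mul_le_mul_of_nonneg_left hk' hv.1
    have hstep : ∀ k, x (k + 1) - x k = v / (n + 1 : ℝ) := by
      intro k; simp only [hx]; push_cast; ring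
    have hind : ∀ k ≤ n + 1, |H (x k) - H (x 0)| ≤ v / (n + 1 : ℝ) * (q (x k) - q (x 0)) := by
      intro k
      induction k with
      | zero => intro _; simp
      | succ k ih =>
        intro hk
        have h1 := ih (by omega)
        have h2 := hinc (x k) (hxmem k (by omega)) (x (k + 1)) (hxmem _ hk)
          (by linarith [hstep k, div_nonneg hv.1 hn.le])
        rw [hstep] at h2
        calc |H (x (k + 1)) - H (x 0)|
            = |(H (x (k + 1)) - H (x k)) + (H (x k) - H (x 0))| := by ring_nf
          _ ≤ _ := abs_add_le _ _
          _ ≤ _ := by linarith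
    have h0 : x 0 = 0 := by simp [hx]
    have h1 : x (n + 1) = v := by simp only [hx]; push_cast; field_simp
    have := hind (n + 1) le_rfl
    rw [h0, h1] at this
    calc _ ≤ _ := this
      _ = _ := by ring
  have hlim : Filter.Tendsto (fun n : ℕ => v * (q v - q 0) / (n + 1 : ℝ)) Filter.atTop (nhds 0) := by
    have := (tendsto_one_div_add_atTop_nhds_zero_nat (𝕜 := ℝ)).const_mul (v * (q v - q 0))
    simpa [div_eq_mul_inv] using this
  have h0 : |H v - H 0| ≤ 0 := ge_of_tendsto' hlim hbound
  have h1 : H v = H 0 := by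
    have := abs_nonpos_iff.1 h0
    linarith
  simp only [hH] at h1
  simp at h1
  linarith

/-- Interim payments are virtual values: the expected transfer in an incentive compatible
mechanism, given its interim allocation. -/
theorem ValueDist.integral_transfer (D : ValueDist) {q t : ℝ → ℝ} (hq : Measurable q)
    (h01 : ∀ v, q v ∈ Icc (0 : ℝ) 1)
    (hIC : ∀ v ∈ Icc 0 D.vbar, ∀ r ∈ Icc 0 D.vbar, v * q r - t r ≤ v * q v - t v) :
    ∫ v, t v ∂D.law = ∫ v, q v * D.virtualValue v ∂D.law + t 0 := by
  have hbd : ∀ v, ‖q v‖ ≤ 1 := fun v => by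
    rw [Real.norm_eq_abs, abs_of_nonneg (h01 v).1]; exact (h01 v).2
  have i1 : Integrable (fun v => q v * v) D.law :=
    D.integrable_id_law.bdd_mul hq.aestronglyMeasurable (ae_of_all _ hbd)
  have i2 : Integrable (fun v => q v * ((1 - D.cdf v) / D.f v)) D.law :=
    D.integrable_hazard.bdd_mul hq.aestronglyMeasurable (ae_of_all _ hbd)
  have hqi : ∀ a b, IntervalIntegrable q volume a b := fun a b =>
    (intervalIntegrable_const (c := (1 : ℝ))).mono_fun hq.aestronglyMeasurable
      (ae_of_all _ fun x => by simpa using hbd x)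
  have hcont : Continuous fun v => ∫ s in (0 : ℝ)..v, q s :=
    intervalIntegral.continuous_primitive hqi 0
  have i3 : Integrable (fun v => ∫ s in (0 : ℝ)..v, q s) D.law := by
    refine Integrable.of_bound hcont.aestronglyMeasurable D.vbar ?_
    filter_upwards [D.ae_mem_Icc] with v hv
    have := intervalIntegral.norm_integral_le_of_norm_le_const (a := (0 : ℝ)) (b := v)
      (f := q) (C := 1) fun x _ => hbd x
    rw [one_mul, sub_zero, abs_of_nonneg hv.1] at this
    exact this.trans hv.2
  have h1 : ∫ v, t v ∂D.law = ∫ v, (q v * v - (∫ s in (0 : ℝ)..v, q s) + t 0) ∂D.law := by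
    refine integral_congr_ae ?_
    filter_upwards [D.ae_mem_Icc] with v hv
    have := envelope hIC hv
    linarith
  have i4 : Integrable (fun v => q v * v - ∫ s in (0 : ℝ)..v, q s) D.law := i1.sub i3
  rw [h1, integral_add i4 (integrable_const _), integral_sub i1 i3, D.integral_rent hq h01,
    ← integral_sub i1 i2]
  simp only [integral_const, probReal_univ, one_smul, ValueDist.virtualValue]
  congr 2
  funext v
  ring

/-- The virtual value is centred: a mechanism that always allocates and never charges has no
revenue. -/
theorem ValueDist.integral_virtualValue (D : ValueDist) : ∫ v, D.virtualValue v ∂D.law = 0 := by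
  have := D.integral_transfer (q := fun _ => 1) (t := fun _ => 0) measurable_const
    (fun _ => ⟨zero_le_one, le_rfl⟩) (fun v _ r _ => le_refl (v * 1 - 0))
  simpa using this.symm

/-- Since the virtual value is centred and monotone, it changes sign somewhere in the interior of
the support. It may jump over zero there, because the density need not be continuous. -/
theorem ValueDist.exists_sign_change (D : ValueDist) (hD : D.Regular) :
    ∃ R ∈ Ioo 0 D.vbar, (∀ v ∈ Ioo 0 D.vbar, v < R → D.virtualValue v ≤ 0) ∧
      ∀ v ∈ Ioo 0 D.vbar, R < v → 0 ≤ D.virtualValue v := by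
  have hzero : (∀ᵐ v ∂D.law, D.virtualValue v = 0) →
      ∀ v ∈ Ioo 0 D.vbar, D.virtualValue v = 0 := by
    intro h v hv
    have hex : ∀ r s : ℝ, 0 ≤ r → r < s → s ≤ D.vbar → ∃ x ∈ Ioo r s, D.virtualValue x = 0 := by
      intro r s hr hrs hs
      by_contra! hc
      refine (D.law_Ioo_pos hr hrs hs).ne' (measure_mono_null ?_ h)
      exact fun x hx => hc x hx
    obtain ⟨x, hx, hx0⟩ := hex 0 v le_rfl hv.1 hv.2.le
    obtain ⟨y, hy, hy0⟩ := hex v D.vbar hv.1.le hv.2 le_rfl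
    have h1 := hD ⟨hx.1, hx.2.trans hv.2⟩ hv hx.2.le
    have h2 := hD hv ⟨hv.1.trans hy.1, hy.2⟩ hy.1.le
    linarith
  have hmid : D.vbar / 2 ∈ Ioo 0 D.vbar := ⟨by linarith [D.vbar_pos], by linarith [D.vbar_pos]⟩
  by_cases hA : ∃ v ∈ Ioo 0 D.vbar, D.virtualValue v < 0
  · by_cases hB : ∃ v ∈ Ioo 0 D.vbar, 0 < D.virtualValue v
    · obtain ⟨a, ha, ha'⟩ := hA
      obtain ⟨b, hb, hb'⟩ := hB
      set S := {v | v ∈ Ioo 0 D.vbar ∧ D.virtualValue v < 0} with hS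
      have hbdd : ∀ v ∈ S, v ≤ b := by
        rintro v ⟨hv, hv'⟩
        by_contra! hc
        linarith [hD hb hv hc.le]
      have hle : a ≤ sSup S := le_csSup ⟨b, hbdd⟩ ⟨ha, ha'⟩
      have hge : sSup S ≤ b := csSup_le ⟨a, ha, ha'⟩ hbdd
      refine ⟨sSup S, ⟨ha.1.trans_le hle, hge.trans_lt hb.2⟩, fun v hv hvR => ?_, fun v hv hvR => ?_⟩
      · obtain ⟨w, ⟨hw, hw'⟩, hvw⟩ := exists_lt_of_lt_csSup (⟨a, ha, ha'⟩ : S.Nonempty) hvR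
        linarith [hD hv hw hvw.le]
      · by_contra! hc
        exact hvR.not_ge (le_csSup ⟨b, hbdd⟩ ⟨hv, hc⟩)
    · push Not at hB
      have h0 := hzero (by
        have h1 : 0 ≤ᵐ[D.law] fun v => -D.virtualValue v := by
          filter_upwards [D.ae_mem_Ioo] with v hv
          simpa using hB v hv
        have h2 := (integral_eq_zero_iff_of_nonneg_ae h1 D.integrable_virtualValue.neg).1
          (by rw [integral_neg, D.integral_virtualValue, neg_zero])
        filter_upwards [h2] with v hv
        simpa using hv)
      exact ⟨_, hmid, fun v hv _ => (h0 v hv).le, fun v hv _ => (h0 v hv).ge⟩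
  · push Not at hA
    have h0 := hzero (by
      have h1 : 0 ≤ᵐ[D.law] D.virtualValue := by
        filter_upwards [D.ae_mem_Ioo] with v hv
        exact hA v hv
      exact (integral_eq_zero_iff_of_nonneg_ae h1 D.integrable_virtualValue).1
        D.integral_virtualValue)
    exact ⟨_, hmid, fun v hv _ => (h0 v hv).le, fun v hv _ => (h0 v hv).ge⟩

/-! ### Profiles and shares -/

theorem rev_ne (i : Fin 2) : i.rev ≠ i := by fin_cases i <;> decide

theorem eq_or_eq_rev (i j : Fin 2) : j = i ∨ j = i.rev := by
  fin_cases i <;> fin_cases j <;> decide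

theorem sum_eq_add_rev (i : Fin 2) (g : Fin 2 → ℝ) : ∑ j, g j = g i + g i.rev := by
  fin_cases i
  · exact Fin.sum_univ_two g
  · exact (Fin.sum_univ_two g).trans (add_comm _ _)

@[simp] theorem profile_self (i : Fin 2) (a c : ℝ) : profile i a c i = a := by simp [profile]

@[simp] theorem profile_rev (i : Fin 2) (a c : ℝ) : profile i a c i.rev = c := by
  simp [profile, rev_ne]

theorem map_profile (β : Fin 2 → ℝ → ℝ) (i : Fin 2) (r w : ℝ) :
    (fun j => β j (profile i r w j)) = profile i (β i r) (β i.rev w) := by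
  funext j
  rcases eq_or_eq_rev i j with rfl | rfl <;> simp

theorem measurable_profile (i : Fin 2) : Measurable fun z : ℝ × ℝ => profile i z.1 z.2 := by
  refine measurable_pi_lambda _ fun k => ?_
  rcases eq_or_eq_rev i k with rfl | rfl
  · simpa using measurable_fst
  · simpa using measurable_snd

theorem measurePreserving_profile (D : ValueDist) (i : Fin 2) :
    MeasurePreserving (fun z : ℝ × ℝ => profile i z.1 z.2) (D.law.prod D.law) D.jointLaw := by
  have h := (measurePreserving_finTwoArrow D.law).symm
  unfold ValueDist.jointLaw
  fin_cases i
  · convert h using 1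
    funext z
    funext k
    fin_cases k <;> rfl
  · convert h.comp Measure.measurePreserving_swap using 1
    funext z
    funext k
    fin_cases k <;> rfl

theorem integrable_jointLaw_iff {D : ValueDist} (i : Fin 2) {h : (Fin 2 → ℝ) → ℝ}
    (hm : Measurable h) : Integrable h D.jointLaw ↔
      Integrable (fun z : ℝ × ℝ => h (profile i z.1 z.2)) (D.law.prod D.law) :=
  ((measurePreserving_profile D i).integrable_comp hm.aestronglyMeasurable).symm

theorem integral_jointLaw {D : ValueDist} (i : Fin 2) {h : (Fin 2 → ℝ) → ℝ}
    (hi : Integrable h D.jointLaw) (hm : Measurable h) :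
    ∫ v, h v ∂D.jointLaw = ∫ x, ∫ w, h (profile i x w) ∂D.law ∂D.law := by
  rw [← (measurePreserving_profile D i).map_eq, integral_map (measurable_profile i).aemeasurable
    hm.aestronglyMeasurable]
  exact integral_prod _ ((integrable_jointLaw_iff i hm).1 hi)

theorem ae_jointLaw {D : ValueDist} (i : Fin 2) {s : (Fin 2 → ℝ) → Prop}
    (h : ∀ᵐ v ∂D.jointLaw, s v) : ∀ᵐ x ∂D.law, ∀ᵐ w ∂D.law, s (profile i x w) :=
  Measure.ae_ae_of_ae_prod ((measurePreserving_profile D i).quasiMeasurePreserving.ae h)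

theorem share_nonneg (R : ℝ) (m b : Fin 2 → ℝ) (i : Fin 2) : 0 ≤ share R m b i := by
  unfold share; split_ifs <;> norm_num

theorem share_le_one (R : ℝ) (m b : Fin 2 → ℝ) (i : Fin 2) : share R m b i ≤ 1 := by
  unfold share; split_ifs <;> norm_num

theorem share_sum_le_one (R : ℝ) (m b : Fin 2 → ℝ) : ∑ i, share R m b i ≤ 1 := by
  have h0 : Fin.rev (0 : Fin 2) = 1 := rfl
  have h1 : Fin.rev (1 : Fin 2) = 0 := rfl
  rw [Fin.sum_univ_two]
  unfold share
  rw [h0, h1]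
  split_ifs <;> grind

theorem share_eq_zero {R : ℝ} {m b : Fin 2 → ℝ} {i : Fin 2} (h : b i < R) :
    share R m b i = 0 := by
  simp [share, h]

theorem measurable_share (R : ℝ) (i : Fin 2) :
    Measurable fun z : (Fin 2 → ℝ) × (Fin 2 → ℝ) => share R z.1 z.2 i := by
  have hb : ∀ j : Fin 2, Measurable fun z : (Fin 2 → ℝ) × (Fin 2 → ℝ) => z.2 j := fun j =>
    (measurable_pi_apply j).comp measurable_snd
  have hm : ∀ j : Fin 2, Measurable fun z : (Fin 2 → ℝ) × (Fin 2 → ℝ) => z.1 j := fun j =>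
    (measurable_pi_apply j).comp measurable_fst
  have hbm : ∀ j : Fin 2, Measurable fun z : (Fin 2 → ℝ) × (Fin 2 → ℝ) => z.2 j * z.1 j :=
    fun j => (hb j).mul (hm j)
  unfold share
  refine Measurable.ite (measurableSet_lt (hb i) measurable_const) measurable_const
    (Measurable.ite ?_ measurable_const (Measurable.ite ?_ measurable_const measurable_const))
  · exact (measurableSet_lt (hb _) measurable_const).union (measurableSet_lt (hbm _) (hbm _))
  · exact measurableSet_eq_fun (hbm _) (hbm _)

theorem measurable_price (fmt : Format) (R : ℝ) (b : Fin 2 → ℝ) (i : Fin 2) :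
    Measurable fun m : Fin 2 → ℝ => price fmt R m b i := by
  cases fmt
  · exact measurable_const
  · unfold price
    simp only
    split_ifs
    · exact measurable_const
    · exact measurable_const.max
        ((measurable_const.mul (measurable_pi_apply _)).div (measurable_pi_apply _))

/-- A winner pays at least the reserve and at most his own bid, per click. -/
theorem share_mul_price_mem {fmt : Format} {R : ℝ} (hR : 0 ≤ R) {m b : Fin 2 → ℝ}
    (hm : ∀ j, 0 ≤ m j) (i : Fin 2) :
    share R m b i * R ≤ share R m b i * price fmt R m b i ∧
      share R m b i * price fmt R m b i ≤ share R m b i * b i := by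
  by_cases hb : b i < R
  · simp [share_eq_zero hb]
  push Not at hb
  by_cases hs : share R m b i = 0
  · simp [hs]
  suffices h : R ≤ price fmt R m b i ∧ price fmt R m b i ≤ b i from
    ⟨mul_le_mul_of_nonneg_left h.1 (share_nonneg ..),
      mul_le_mul_of_nonneg_left h.2 (share_nonneg ..)⟩
  cases fmt
  · exact ⟨hb, le_rfl⟩
  · unfold price
    simp only
    split_ifs with h1
    · exact ⟨le_rfl, hb⟩
    · refine ⟨le_max_left _ _, max_le hb ?_⟩
      have h2 : b i.rev * m i.rev ≤ b i * m i := by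
        by_contra! hc
        apply hs
        rw [share, if_neg hb.not_gt, if_neg, if_neg hc.ne']
        rintro (h | h)
        · exact h1 h
        · exact hc.not_gt h
      rcases (hm i).eq_or_lt with h | h
      · rw [← h, div_zero]
        exact hR.trans hb
      · rwa [div_le_iff₀ h]

section Game

variable {Ω : Type*} [mΩ : MeasurableSpace Ω] {p : ℝ}

/-! ### Beliefs, clicks and payments -/

instance isProbabilityMeasure_P (C : Conversation Ω p) : IsProbabilityMeasure C.P := C.isProb

namespace Conversation

variable (C : Conversation Ω p)

theorem θ_nonneg (i : Fin 2) (ω : Ω) : 0 ≤ C.θ i ω := by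
  rcases C.θ_zero_or_one i ω with h | h <;> simp [h]

theorem θ_le_one (i : Fin 2) (ω : Ω) : C.θ i ω ≤ 1 := by
  rcases C.θ_zero_or_one i ω with h | h <;> simp [h]

theorem integrable_of_mem_Icc {g : Ω → ℝ} (hg : Measurable g) (a : ℝ)
    (h : ∀ᵐ ω ∂C.P, g ω ∈ Icc 0 a) : Integrable g C.P :=
  Integrable.of_bound hg.aestronglyMeasurable a (by
    filter_upwards [h] with ω hω
    rw [Real.norm_eq_abs, abs_of_nonneg hω.1]
    exact hω.2)

theorem integrable_θ (i : Fin 2) : Integrable (C.θ i) C.P :=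
  C.integrable_of_mem_Icc (C.measurable_θ i) 1
    (ae_of_all _ fun ω => ⟨C.θ_nonneg i ω, C.θ_le_one i ω⟩)

theorem infoLimit_le : C.infoLimit ≤ mΩ := iSup_le fun t => C.filtration.le t

theorem stopped_le (τ : C.StoppingTime) : τ.2.measurableSpace ≤ mΩ := τ.2.measurableSpace_le

theorem measurable_belief (τ : C.StoppingTime) (i : Fin 2) : Measurable (C.belief τ i) :=
  stronglyMeasurable_condExp.measurable.mono (C.stopped_le τ) le_rfl

theorem measurable_beliefs (τ : C.StoppingTime) : Measurable fun ω j => C.belief τ j ω :=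
  measurable_pi_lambda _ fun j => C.measurable_belief τ j

theorem belief_nonneg (τ : C.StoppingTime) : ∀ᵐ ω ∂C.P, ∀ i, 0 ≤ C.belief τ i ω :=
  ae_all_iff.2 fun i => condExp_nonneg (ae_of_all _ (C.θ_nonneg i))

/-- Good ads never have zero belief. -/
theorem belief_pos (τ : C.StoppingTime) (i : Fin 2) :
    ∀ᵐ ω ∂C.P, C.θ i ω = 1 → 0 < C.belief τ i ω := by
  have hZ : MeasurableSet[τ.2.measurableSpace] {ω | C.belief τ i ω ≤ 0} :=
    (stronglyMeasurable_condExp (m := τ.2.measurableSpace) (μ := C.P) (f := C.θ i)).measurable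
      (measurableSet_Iic (a := (0 : ℝ)))
  have h1 : ∫ ω in {ω | C.belief τ i ω ≤ 0}, C.θ i ω ∂C.P ≤ 0 := by
    rw [← setIntegral_condExp (C.stopped_le τ) (C.integrable_θ i) hZ]
    exact setIntegral_nonpos (C.stopped_le τ _ hZ) fun ω hω => hω
  have h2 : 0 ≤ᵐ[C.P.restrict {ω | C.belief τ i ω ≤ 0}] C.θ i := ae_of_all _ (C.θ_nonneg i)
  have h3 := (setIntegral_eq_zero_iff_of_nonneg_ae h2 (C.integrable_θ i).integrableOn).1
    (le_antisymm h1 (integral_nonneg_of_ae h2))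
  have h4 := (ae_restrict_iff' (C.stopped_le τ _ hZ)).1 h3
  filter_upwards [h4] with ω hω hθ
  by_contra! hc
  simpa [hθ] using hω hc

end Conversation

variable {C : Conversation Ω p} {fmt : Format} {R : ℝ}

theorem measurable_allocation (τ : C.StoppingTime) (b : Fin 2 → ℝ) (i : Fin 2) :
    Measurable fun ω => allocation C R τ b ω i :=
  (measurable_share R i).comp ((C.measurable_beliefs τ).prodMk measurable_const)

theorem measurable_click (τ : C.StoppingTime) (b : Fin 2 → ℝ) (i : Fin 2) :
    Measurable fun ω => C.θ i ω * allocation C R τ b ω i :=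
  (C.measurable_θ i).mul (measurable_allocation τ b i)

theorem click_mem (τ : C.StoppingTime) (b : Fin 2 → ℝ) (i : Fin 2) (ω : Ω) :
    C.θ i ω * allocation C R τ b ω i ∈ Icc (0 : ℝ) 1 :=
  ⟨mul_nonneg (C.θ_nonneg i ω) (share_nonneg ..),
    mul_le_one₀ (C.θ_le_one i ω) (share_nonneg ..) (share_le_one ..)⟩

theorem integrable_click (τ : C.StoppingTime) (b : Fin 2 → ℝ) (i : Fin 2) :
    Integrable (fun ω => C.θ i ω * allocation C R τ b ω i) C.P :=
  C.integrable_of_mem_Icc (measurable_click τ b i) 1 (ae_of_all _ (click_mem τ b i))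

theorem expClicks_mem (τ : C.StoppingTime) (b : Fin 2 → ℝ) (i : Fin 2) :
    expClicks C R τ b i ∈ Icc (0 : ℝ) 1 := by
  refine ⟨integral_nonneg fun ω => (click_mem τ b i ω).1, ?_⟩
  have := integral_mono (integrable_click (R := R) τ b i) (integrable_const 1)
    fun ω => (click_mem τ b i ω).2
  simpa [expClicks] using this

theorem expClicks_eq_zero (τ : C.StoppingTime) {b : Fin 2 → ℝ} {i : Fin 2} (h : b i < R) :
    expClicks C R τ b i = 0 := by
  simp [expClicks, allocation, share_eq_zero h]

theorem measurable_collected (τ : C.StoppingTime) (b : Fin 2 → ℝ) (i : Fin 2) :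
    Measurable (collected C fmt R τ b i) :=
  (measurable_click τ b i).mul ((measurable_price fmt R b i).comp (C.measurable_beliefs τ))

theorem collected_bounds (hR : 0 ≤ R) (τ : C.StoppingTime) (b : Fin 2 → ℝ) (i : Fin 2) :
    ∀ᵐ ω ∂C.P, C.θ i ω * allocation C R τ b ω i * R ≤ collected C fmt R τ b i ω ∧
      collected C fmt R τ b i ω ≤ C.θ i ω * allocation C R τ b ω i * b i := by
  filter_upwards [C.belief_nonneg τ] with ω hω
  have := share_mul_price_mem (fmt := fmt) (b := b) hR hω i
  simp only [collected, allocation, mul_assoc]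
  exact ⟨mul_le_mul_of_nonneg_left this.1 (C.θ_nonneg i ω),
    mul_le_mul_of_nonneg_left this.2 (C.θ_nonneg i ω)⟩

theorem integrable_collected (hR : 0 ≤ R) (τ : C.StoppingTime) (b : Fin 2 → ℝ) (i : Fin 2) :
    Integrable (collected C fmt R τ b i) C.P := by
  refine C.integrable_of_mem_Icc (measurable_collected τ b i) |b i| ?_
  filter_upwards [collected_bounds (fmt := fmt) hR τ b i] with ω hω
  have h := click_mem (R := R) τ b i ω
  refine ⟨(mul_nonneg h.1 hR).trans hω.1, hω.2.trans ?_⟩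
  calc _ ≤ C.θ i ω * allocation C R τ b ω i * |b i| :=
        mul_le_mul_of_nonneg_left (le_abs_self _) h.1
    _ ≤ _ := mul_le_of_le_one_left (abs_nonneg _) h.2

theorem integrable_revenueAt (hR : 0 ≤ R) (τ : C.StoppingTime) (b : Fin 2 → ℝ) :
    Integrable (revenueAt C fmt R τ b) C.P :=
  integrable_finsetSum _ fun i _ => integrable_collected hR τ b i

theorem expPayment_bounds (hR : 0 ≤ R) (τ : C.StoppingTime) (b : Fin 2 → ℝ) (i : Fin 2) :
    expClicks C R τ b i * R ≤ expPayment C fmt R τ b i ∧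
      expPayment C fmt R τ b i ≤ expClicks C R τ b i * b i := by
  have hb := collected_bounds (fmt := fmt) hR τ b i
  have hi := integrable_collected (fmt := fmt) hR τ b i
  have hc := integrable_click (R := R) τ b i
  unfold expClicks expPayment
  rw [← integral_mul_const, ← integral_mul_const]
  exact ⟨integral_mono_ae (hc.mul_const _) hi (hb.mono fun _ h => h.1),
    integral_mono_ae hi (hc.mul_const _) (hb.mono fun _ h => h.2)⟩

theorem expPayment_nonneg (hR : 0 ≤ R) (τ : C.StoppingTime) (b : Fin 2 → ℝ) (i : Fin 2) :
    0 ≤ expPayment C fmt R τ b i :=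
  (mul_nonneg (expClicks_mem τ b i).1 hR).trans (expPayment_bounds hR τ b i).1

theorem expPayment_le (hR : 0 ≤ R) (τ : C.StoppingTime) (b : Fin 2 → ℝ) (i : Fin 2) :
    expPayment C fmt R τ b i ≤ |b i| := by
  have h := expClicks_mem (R := R) τ b i
  calc _ ≤ _ := (expPayment_bounds hR τ b i).2
    _ ≤ expClicks C R τ b i * |b i| := mul_le_mul_of_nonneg_left (le_abs_self _) h.1
    _ ≤ _ := mul_le_of_le_one_left (abs_nonneg _) h.2

/-! ### The optimal virtual surplus -/

/-- The largest quality-weighted virtual value that can be allocated at values `v` and type `θ`. -/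
def topVirtual (D : ValueDist) (v θ : Fin 2 → ℝ) : ℝ :=
  max 0 (max (θ 0 * D.virtualValue (v 0)) (θ 1 * D.virtualValue (v 1)))

theorem le_topVirtual (D : ValueDist) (v θ : Fin 2 → ℝ) (i : Fin 2) :
    θ i * D.virtualValue (v i) ≤ topVirtual D v θ := by
  fin_cases i
  · exact (le_max_left _ _).trans (le_max_right _ _)
  · exact (le_max_right _ _).trans (le_max_right _ _)

theorem topVirtual_nonneg (D : ValueDist) (v θ : Fin 2 → ℝ) : 0 ≤ topVirtual D v θ :=
  le_max_left _ _

theorem sum_le_topVirtual (D : ValueDist) (v θ : Fin 2 → ℝ) {x : Fin 2 → ℝ} (hx : ∀ i, 0 ≤ x i)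
    (hs : ∑ i, x i ≤ 1) : ∑ i, x i * (θ i * D.virtualValue (v i)) ≤ topVirtual D v θ :=
  calc ∑ i, x i * (θ i * D.virtualValue (v i)) ≤ ∑ i, x i * topVirtual D v θ :=
        Finset.sum_le_sum fun i _ => mul_le_mul_of_nonneg_left (le_topVirtual D v θ i) (hx i)
    _ = (∑ i, x i) * topVirtual D v θ := by rw [Finset.sum_mul]
    _ ≤ topVirtual D v θ := mul_le_of_le_one_left (topVirtual_nonneg _ _ _) hs

theorem exists_eq_topVirtual (D : ValueDist) (v θ : Fin 2 → ℝ) :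
    ∃ y : Fin 2 → ℝ, (∀ i, 0 ≤ y i) ∧ ∑ i, y i ≤ 1 ∧
      ∑ i, y i * (θ i * D.virtualValue (v i)) = topVirtual D v θ := by
  have h : topVirtual D v θ = 0 ∨ topVirtual D v θ = θ 0 * D.virtualValue (v 0) ∨
      topVirtual D v θ = θ 1 * D.virtualValue (v 1) := by
    unfold topVirtual; grind
  rcases h with h | h | h <;> rw [h]
  · exact ⟨fun _ => 0, by simp, by simp, by simp⟩
  · exact ⟨profile 0 1 0, fun i => by unfold profile; split_ifs <;> norm_num,
      by simp [profile], by simp [profile]⟩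
  · exact ⟨profile 1 1 0, fun i => by unfold profile; split_ifs <;> norm_num,
      by simp [profile], by simp [profile]⟩

theorem isOptimalAllocation_iff {D : ValueDist} {v θ x : Fin 2 → ℝ} (hx : ∀ i, 0 ≤ x i)
    (hs : ∑ i, x i ≤ 1) : IsOptimalAllocation D v θ x ↔
      ∑ i, x i * (θ i * D.virtualValue (v i)) = topVirtual D v θ := by
  constructor
  · rintro ⟨-, -, h⟩
    obtain ⟨y, hy0, hys, hy⟩ := exists_eq_topVirtual D v θ
    exact le_antisymm (sum_le_topVirtual D v θ hx hs) (hy ▸ h y hy0 hys)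
  · intro h
    exact ⟨hx, hs, fun y hy hys => h ▸ sum_le_topVirtual D v θ hy hys⟩

/-- The expected optimal virtual surplus at values `v`. -/
def optSurplus (D : ValueDist) (C : Conversation Ω p) (v : Fin 2 → ℝ) : ℝ :=
  ∫ ω, topVirtual D v (fun i => C.θ i ω) ∂C.P

theorem measurable_topVirtual (D : ValueDist) (C : Conversation Ω p) :
    Measurable fun z : (Fin 2 → ℝ) × Ω => topVirtual D z.1 (fun i => C.θ i z.2) := by
  have h : ∀ i : Fin 2, Measurable fun z : (Fin 2 → ℝ) × Ω =>
      C.θ i z.2 * D.virtualValue (z.1 i) := fun i =>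
    ((C.measurable_θ i).comp measurable_snd).mul
      (D.measurable_virtualValue.comp ((measurable_pi_apply i).comp measurable_fst))
  exact measurable_const.max ((h 0).max (h 1))

theorem topVirtual_le (D : ValueDist) (C : Conversation Ω p) (v : Fin 2 → ℝ) (ω : Ω) :
    topVirtual D v (fun i => C.θ i ω) ≤ ∑ i, |D.virtualValue (v i)| := by
  have h : ∀ i, C.θ i ω * D.virtualValue (v i) ≤ |D.virtualValue (v i)| := fun i => by
    rcases C.θ_zero_or_one i ω with h | h <;> simp [h, le_abs_self]
  rw [Fin.sum_univ_two]
  have := abs_nonneg (D.virtualValue (v 0))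
  have := abs_nonneg (D.virtualValue (v 1))
  refine max_le (by positivity) (max_le ?_ ?_)
  · linarith [h 0]
  · linarith [h 1]

theorem integrable_topVirtual (D : ValueDist) (C : Conversation Ω p) (v : Fin 2 → ℝ) :
    Integrable (fun ω => topVirtual D v (fun i => C.θ i ω)) C.P :=
  C.integrable_of_mem_Icc ((measurable_topVirtual D C).comp (measurable_const.prodMk measurable_id))
    _ (ae_of_all _ fun ω => ⟨topVirtual_nonneg _ _ _, topVirtual_le D C v ω⟩)

theorem measurable_optSurplus (D : ValueDist) (C : Conversation Ω p) :
    Measurable (optSurplus D C) :=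
  ((measurable_topVirtual D C).stronglyMeasurable.integral_prod_right).measurable

theorem integrable_virtualValue_apply (D : ValueDist) (i : Fin 2) :
    Integrable (fun v : Fin 2 → ℝ => D.virtualValue (v i)) D.jointLaw :=
  (measurePreserving_eval (fun _ : Fin 2 => D.law) i).integrable_comp_of_integrable
    D.integrable_virtualValue

theorem integrable_optSurplus (D : ValueDist) (C : Conversation Ω p) :
    Integrable (optSurplus D C) D.jointLaw := by
  have h : Integrable (fun v : Fin 2 → ℝ => ∑ i, |D.virtualValue (v i)|) D.jointLaw :=
    integrable_finsetSum _ fun i _ => (integrable_virtualValue_apply D i).abs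
  refine h.mono' (measurable_optSurplus D C).aestronglyMeasurable (ae_of_all _ fun v => ?_)
  have h0 : 0 ≤ optSurplus D C v := integral_nonneg fun ω => topVirtual_nonneg _ _ _
  rw [Real.norm_eq_abs, abs_of_nonneg h0]
  have := integral_mono (integrable_topVirtual D C v) (integrable_const _)
    fun ω => topVirtual_le D C v ω
  simpa [optSurplus] using this

theorem sum_virtual_integrable (D : ValueDist) (v : Fin 2 → ℝ) {x : Fin 2 → Ω → ℝ}
    (hm : ∀ i, Measurable (x i)) (h0 : ∀ i ω, 0 ≤ x i ω) (h1 : ∀ i ω, x i ω ≤ 1) :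
    Integrable (fun ω => ∑ i, x i ω * (C.θ i ω * D.virtualValue (v i))) C.P :=
  integrable_finsetSum _ fun i _ => ((C.integrable_θ i).mul_const _).bdd_mul (c := 1)
    (hm i).aestronglyMeasurable (ae_of_all _ fun ω => by
      rw [Real.norm_eq_abs, abs_of_nonneg (h0 i ω)]; exact h1 i ω)

theorem le_one_of_sum_le_one {x : Fin 2 → ℝ} (h0 : ∀ i, 0 ≤ x i) (hs : ∑ i, x i ≤ 1)
    (i : Fin 2) : x i ≤ 1 :=
  (Finset.single_le_sum (fun j _ => h0 j) (Finset.mem_univ i)).trans hs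

theorem sum_virtual_eq_integral (D : ValueDist) (v : Fin 2 → ℝ) {x : Fin 2 → Ω → ℝ}
    (hm : ∀ i, Measurable (x i)) (h0 : ∀ i ω, 0 ≤ x i ω) (h1 : ∀ i ω, x i ω ≤ 1) :
    ∑ i, (∫ ω, C.θ i ω * x i ω ∂C.P) * D.virtualValue (v i)
      = ∫ ω, ∑ i, x i ω * (C.θ i ω * D.virtualValue (v i)) ∂C.P := by
  rw [integral_finsetSum]
  · refine Finset.sum_congr rfl fun i _ => ?_
    rw [← integral_mul_const]
    exact integral_congr_ae (ae_of_all _ fun ω => by ring)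
  · intro i _
    exact ((C.integrable_θ i).mul_const _).bdd_mul (c := 1)
      (hm i).aestronglyMeasurable (ae_of_all _ fun ω => by
      rw [Real.norm_eq_abs, abs_of_nonneg (h0 i ω)]; exact h1 i ω)

theorem sum_virtual_le_optSurplus (D : ValueDist) (v : Fin 2 → ℝ) {x : Fin 2 → Ω → ℝ}
    (hm : ∀ i, Measurable (x i)) (h0 : ∀ i ω, 0 ≤ x i ω) (hs : ∀ ω, ∑ i, x i ω ≤ 1) :
    ∑ i, (∫ ω, C.θ i ω * x i ω ∂C.P) * D.virtualValue (v i) ≤ optSurplus D C v := by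
  have h1 : ∀ i ω, x i ω ≤ 1 := fun i ω => le_one_of_sum_le_one (fun j => h0 j ω) (hs ω) i
  rw [sum_virtual_eq_integral D v hm h0 h1]
  exact integral_mono (sum_virtual_integrable D v hm h0 h1) (integrable_topVirtual D C v)
    fun ω => sum_le_topVirtual D v _ (fun i => h0 i ω) (hs ω)

theorem sum_virtual_eq_optSurplus_iff (D : ValueDist) (v : Fin 2 → ℝ) {x : Fin 2 → Ω → ℝ}
    (hm : ∀ i, Measurable (x i)) (h0 : ∀ i ω, 0 ≤ x i ω) (hs : ∀ ω, ∑ i, x i ω ≤ 1) :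
    ∑ i, (∫ ω, C.θ i ω * x i ω ∂C.P) * D.virtualValue (v i) = optSurplus D C v ↔
      ∀ᵐ ω ∂C.P, IsOptimalAllocation D v (fun i => C.θ i ω) fun i => x i ω := by
  have h1 : ∀ i ω, x i ω ≤ 1 := fun i ω => le_one_of_sum_le_one (fun j => h0 j ω) (hs ω) i
  rw [sum_virtual_eq_integral D v hm h0 h1, optSurplus,
    integral_eq_iff_of_ae_le (sum_virtual_integrable D v hm h0 h1) (integrable_topVirtual D C v)
    (ae_of_all _ fun ω => sum_le_topVirtual D v _ (fun i => h0 i ω) (hs ω))]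
  exact Filter.eventually_congr (ae_of_all _ fun ω =>
    (isOptimalAllocation_iff (fun i => h0 i ω) (hs ω)).symm)

end Game

section Game

variable {Ω : Type*} [mΩ : MeasurableSpace Ω] {p : ℝ}
variable {D : ValueDist} {C : Conversation Ω p} {fmt : Format} {R : ℝ}

theorem measurable_integral_law {h : ℝ × ℝ → ℝ} (hh : Measurable h) :
    Measurable fun a => ∫ w, h (a, w) ∂D.law :=
  (StronglyMeasurable.integral_prod_right (f := fun a w => h (a, w)) hh.stronglyMeasurable).measurable

theorem integral_mem_Icc_zero_one {α : Type*} [MeasurableSpace α] {μ : Measure α}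
    [IsProbabilityMeasure μ] {g : α → ℝ} (hi : Integrable g μ) (h : ∀ x, g x ∈ Icc (0 : ℝ) 1) :
    ∫ x, g x ∂μ ∈ Icc (0 : ℝ) 1 := by
  refine ⟨integral_nonneg fun x => (h x).1, ?_⟩
  have := integral_mono hi (integrable_const 1) fun x => (h x).2
  simpa using this

/-! ### The revenue of an equilibrium -/

section Equilibrium

variable {T : (Fin 2 → ℝ) → C.StoppingTime} {β : Fin 2 → ℝ → ℝ}

/-- Expected clicks of bidder `i` with the bid `a`, before the opponent's value is known. -/
def interimClicks (D : ValueDist) (C : Conversation Ω p) (R : ℝ)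
    (T : (Fin 2 → ℝ) → C.StoppingTime) (β : Fin 2 → ℝ → ℝ) (i : Fin 2) (a : ℝ) : ℝ :=
  ∫ w, expClicks C R (T (profile i a (β i.rev w))) (profile i a (β i.rev w)) i ∂D.law

/-- Expected payment of bidder `i` with the bid `a`, before the opponent's value is known. -/
def interimPayment (D : ValueDist) (C : Conversation Ω p) (fmt : Format) (R : ℝ)
    (T : (Fin 2 → ℝ) → C.StoppingTime) (β : Fin 2 → ℝ → ℝ) (i : Fin 2) (a : ℝ) : ℝ :=
  ∫ w, expPayment C fmt R (T (profile i a (β i.rev w))) (profile i a (β i.rev w)) i ∂D.law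

theorem interimPayment_nonneg (hR : 0 ≤ R) (i : Fin 2) (a : ℝ) :
    0 ≤ interimPayment D C fmt R T β i a :=
  integral_nonneg fun _ => expPayment_nonneg hR _ _ _

namespace IsEquilibrium

variable (E : IsEquilibrium D C fmt R β T)
include E

theorem measurable_profile_bid (i : Fin 2) (a : ℝ) :
    Measurable fun w => profile i a (β i.rev w) :=
  (measurable_profile i).comp (measurable_const.prodMk (E.measurable_bid i.rev))

theorem integrable_clicks (i : Fin 2) (a : ℝ) : Integrable (fun w =>
    expClicks C R (T (profile i a (β i.rev w))) (profile i a (β i.rev w)) i) D.law :=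
  Integrable.of_bound
    ((E.measurable_clicks i).comp (E.measurable_profile_bid i a)).aestronglyMeasurable 1
    (ae_of_all _ fun w => by
      have := expClicks_mem (R := R) (T (profile i a (β i.rev w))) (profile i a (β i.rev w)) i
      rw [Real.norm_eq_abs, abs_of_nonneg this.1]
      exact this.2)

theorem integrable_payment (hR : 0 ≤ R) (i : Fin 2) (a : ℝ) : Integrable (fun w =>
    expPayment C fmt R (T (profile i a (β i.rev w))) (profile i a (β i.rev w)) i) D.law :=
  Integrable.of_bound
    ((E.measurable_payment i).comp (E.measurable_profile_bid i a)).aestronglyMeasurable |a|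
    (ae_of_all _ fun w => by
      rw [Real.norm_eq_abs, abs_of_nonneg (expPayment_nonneg hR _ _ _)]
      simpa using expPayment_le (fmt := fmt) hR (T (profile i a (β i.rev w)))
        (profile i a (β i.rev w)) i)

theorem interimProfit_eq (hR : 0 ≤ R) (i : Fin 2) (v a : ℝ) :
    interimProfit D C fmt R T β i v a
      = v * interimClicks D C R T β i a - interimPayment D C fmt R T β i a := by
  rw [interimProfit, integral_sub ((E.integrable_clicks i a).const_mul v)
    (E.integrable_payment hR i a), integral_const_mul, interimClicks, interimPayment]

theorem interimClicks_mem (i : Fin 2) (a : ℝ) : interimClicks D C R T β i a ∈ Icc (0 : ℝ) 1 :=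
  integral_mem_Icc_zero_one (E.integrable_clicks i a) fun _ => expClicks_mem _ _ _

theorem measurable_bids : Measurable fun v : Fin 2 → ℝ => fun j => β j (v j) :=
  measurable_pi_lambda _ fun j => (E.measurable_bid j).comp (measurable_pi_apply j)

theorem measurable_clicks_bids (i : Fin 2) : Measurable fun v : Fin 2 → ℝ =>
    expClicks C R (T fun j => β j (v j)) (fun j => β j (v j)) i :=
  (E.measurable_clicks i).comp E.measurable_bids

theorem measurable_payment_bids (i : Fin 2) : Measurable fun v : Fin 2 → ℝ =>
    expPayment C fmt R (T fun j => β j (v j)) (fun j => β j (v j)) i :=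
  (E.measurable_payment i).comp E.measurable_bids

theorem measurable_interimClicks (i : Fin 2) :
    Measurable fun v => interimClicks D C R T β i (β i v) := by
  have := measurable_integral_law (D := D)
    ((E.measurable_clicks_bids i).comp (measurable_profile i))
  simp only [Function.comp_def, map_profile] at this
  exact this

theorem measurable_interimPayment (i : Fin 2) :
    Measurable fun v => interimPayment D C fmt R T β i (β i v) := by
  have := measurable_integral_law (D := D)
    ((E.measurable_payment_bids i).comp (measurable_profile i))
  simp only [Function.comp_def, map_profile] at this
  exact this

theorem incentiveCompatible (hR : 0 ≤ R) (i : Fin 2) {v r : ℝ} (hv : v ∈ Icc 0 D.vbar)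
    (hr : r ∈ Icc 0 D.vbar) :
    v * interimClicks D C R T β i (β i r) - interimPayment D C fmt R T β i (β i r)
      ≤ v * interimClicks D C R T β i (β i v) - interimPayment D C fmt R T β i (β i v) := by
  rw [← E.interimProfit_eq hR, ← E.interimProfit_eq hR]
  exact E.best_reply i v hv _ (E.bid_nonneg i r hr)

/-- The bid zero costs nothing, so participation is voluntary. -/
theorem interimProfit_nonneg (hR : 0 ≤ R) (i : Fin 2) {v : ℝ} (hv : v ∈ Icc 0 D.vbar) :
    0 ≤ interimProfit D C fmt R T β i v (β i v) := by
  refine le_trans ?_ (E.best_reply i v hv 0 le_rfl)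
  rw [E.interimProfit_eq hR]
  have h : interimPayment D C fmt R T β i 0 ≤ 0 :=
    integral_nonpos fun w => by
      simpa using expPayment_le (fmt := fmt) hR (T (profile i 0 (β i.rev w)))
        (profile i 0 (β i.rev w)) i
  linarith [mul_nonneg hv.1 (E.interimClicks_mem i 0).1]

theorem interimPayment_zero (hR : 0 ≤ R) (i : Fin 2) :
    interimPayment D C fmt R T β i (β i 0) = 0 := by
  have h := E.interimProfit_nonneg hR i (v := 0) ⟨le_rfl, D.vbar_pos.le⟩
  rw [E.interimProfit_eq hR, zero_mul, zero_sub] at h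
  linarith [interimPayment_nonneg (D := D) (fmt := fmt) (T := T) (β := β) hR i (β i 0)]

theorem integrable_payment_bids (hR : 0 ≤ R) (i : Fin 2) : Integrable (fun v : Fin 2 → ℝ =>
    expPayment C fmt R (T fun j => β j (v j)) (fun j => β j (v j)) i) D.jointLaw := by
  have hm := (E.measurable_payment_bids i).comp (measurable_profile i)
  refine (integrable_jointLaw_iff i (E.measurable_payment_bids i)).2
    ((integrable_prod_iff (μ := D.law) (ν := D.law) hm.aestronglyMeasurable).2 ?_)
  simp only [Function.comp_def, map_profile]
  refine ⟨ae_of_all _ fun x => E.integrable_payment hR i (β i x), ?_⟩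
  have h : ∀ x, (∫ w, ‖expPayment C fmt R (T (profile i (β i x) (β i.rev w)))
      (profile i (β i x) (β i.rev w)) i‖ ∂D.law) = interimPayment D C fmt R T β i (β i x) :=
    fun x => integral_congr_ae (ae_of_all _ fun w => by
      simp only [Real.norm_eq_abs]
      exact abs_of_nonneg (expPayment_nonneg hR _ _ _))
  simp only [h]
  refine Integrable.of_bound (E.measurable_interimPayment i).aestronglyMeasurable D.vbar ?_
  filter_upwards [D.ae_mem_Icc] with v hv
  rw [Real.norm_eq_abs, abs_of_nonneg (interimPayment_nonneg hR i _)]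
  have h1 := E.interimProfit_nonneg hR i hv
  rw [E.interimProfit_eq hR] at h1
  have h2 := mul_le_of_le_one_right hv.1 (E.interimClicks_mem i (β i v)).2
  linarith [hv.2]

theorem integrable_clicks_virtual (i : Fin 2) : Integrable (fun v : Fin 2 → ℝ =>
    expClicks C R (T fun j => β j (v j)) (fun j => β j (v j)) i * D.virtualValue (v i))
    D.jointLaw :=
  (integrable_virtualValue_apply D i).bdd_mul (c := 1)
    (E.measurable_clicks_bids i).aestronglyMeasurable (ae_of_all _ fun v => by
      have := expClicks_mem (R := R) (T fun j => β j (v j)) (fun j => β j (v j)) i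
      rw [Real.norm_eq_abs, abs_of_nonneg this.1]
      exact this.2)

/-- Revenue equivalence: in every equilibrium of either auction the revenue is the expected virtual
value of the clicks, because the bid zero pins down the profit of the lowest type. -/
theorem auctionRevenue_eq (hR : 0 ≤ R) : auctionRevenue D C fmt R β T
    = ∫ v, ∑ i, expClicks C R (T fun j => β j (v j)) (fun j => β j (v j)) i
        * D.virtualValue (v i) ∂D.jointLaw := by
  rw [auctionRevenue, integral_finsetSum _ fun i _ => E.integrable_payment_bids hR i,
    integral_finsetSum _ fun i _ => E.integrable_clicks_virtual i]
  refine Finset.sum_congr rfl fun i _ => ?_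
  rw [integral_jointLaw i (E.integrable_payment_bids hR i) (E.measurable_payment_bids i),
    integral_jointLaw i (E.integrable_clicks_virtual i) ((E.measurable_clicks_bids i).mul
      (D.measurable_virtualValue.comp (measurable_pi_apply i)))]
  simp only [map_profile, profile_self, integral_mul_const]
  have := D.integral_transfer (E.measurable_interimClicks i)
    (fun v => E.interimClicks_mem i (β i v)) (t := fun v => interimPayment D C fmt R T β i (β i v))
    (fun v hv r hr => E.incentiveCompatible hR i hv hr)
  rw [E.interimPayment_zero hR, add_zero] at this
  exact this

theorem integrable_virtual : Integrable (fun v : Fin 2 → ℝ =>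
    ∑ i, expClicks C R (T fun j => β j (v j)) (fun j => β j (v j)) i * D.virtualValue (v i))
    D.jointLaw :=
  integrable_finsetSum _ fun i _ => E.integrable_clicks_virtual i

theorem auctionRevenue_le (hR : 0 ≤ R) :
    auctionRevenue D C fmt R β T ≤ ∫ v, optSurplus D C v ∂D.jointLaw := by
  rw [E.auctionRevenue_eq hR]
  exact integral_mono E.integrable_virtual (integrable_optSurplus D C) fun v =>
    sum_virtual_le_optSurplus D v (fun i => measurable_allocation _ _ i)
      (fun i ω => share_nonneg ..) fun ω => share_sum_le_one ..

/-- The revenue bound is attained exactly by the equilibria with an optimal allocation. -/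
theorem auctionRevenue_eq_iff (hR : 0 ≤ R) :
    auctionRevenue D C fmt R β T = ∫ v, optSurplus D C v ∂D.jointLaw ↔
      ∀ᵐ v ∂D.jointLaw, ∀ᵐ ω ∂C.P, IsOptimalAllocation D v (fun i => C.θ i ω)
        (allocation C R (T fun j => β j (v j)) (fun j => β j (v j)) ω) := by
  rw [E.auctionRevenue_eq hR, integral_eq_iff_of_ae_le E.integrable_virtual
    (integrable_optSurplus D C) (ae_of_all _ fun v =>
    sum_virtual_le_optSurplus D v (fun i => measurable_allocation _ _ i)
      (fun i ω => share_nonneg ..) fun ω => share_sum_le_one ..)]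
  exact Filter.eventually_congr (ae_of_all _ fun v =>
    sum_virtual_eq_optSurplus_iff D v (fun i => measurable_allocation _ _ i)
      (fun i ω => share_nonneg ..) fun ω => share_sum_le_one ..)

end IsEquilibrium

end Equilibrium

/-! ### The revenue of a mechanism -/

namespace Mechanism

variable (M : Mechanism D C)

theorem measurable_x' (i : Fin 2) : Measurable (Function.uncurry (M.x i)) :=
  (M.measurable_x i).mono (sup_le_sup le_rfl (MeasurableSpace.comap_mono C.infoLimit_le)) le_rfl

theorem x_le_one (i : Fin 2) (v : Fin 2 → ℝ) (ω : Ω) : M.x i v ω ≤ 1 :=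
  le_one_of_sum_le_one (fun j => M.x_nonneg j v ω) (M.x_sum_le v ω) i

theorem measurable_click (i : Fin 2) :
    Measurable fun z : (Fin 2 → ℝ) × Ω => C.θ i z.2 * M.x i z.1 z.2 :=
  ((C.measurable_θ i).comp measurable_snd).mul (M.measurable_x' i)

theorem click_mem (i : Fin 2) (v : Fin 2 → ℝ) (ω : Ω) :
    C.θ i ω * M.x i v ω ∈ Icc (0 : ℝ) 1 :=
  ⟨mul_nonneg (C.θ_nonneg i ω) (M.x_nonneg i v ω),
    mul_le_one₀ (C.θ_le_one i ω) (M.x_nonneg i v ω) (M.x_le_one i v ω)⟩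

/-- Expected clicks of bidder `i` at the reports `v`. -/
def clicks (i : Fin 2) (v : Fin 2 → ℝ) : ℝ := ∫ ω, C.θ i ω * M.x i v ω ∂C.P

theorem integrable_click (i : Fin 2) (v : Fin 2 → ℝ) :
    Integrable (fun ω => C.θ i ω * M.x i v ω) C.P :=
  C.integrable_of_mem_Icc ((M.measurable_click i).comp (measurable_const.prodMk measurable_id)) 1
    (ae_of_all _ (M.click_mem i v))

theorem measurable_clicks (i : Fin 2) : Measurable (M.clicks i) :=
  ((M.measurable_click i).stronglyMeasurable.integral_prod_right).measurable

theorem clicks_mem (i : Fin 2) (v : Fin 2 → ℝ) : M.clicks i v ∈ Icc (0 : ℝ) 1 :=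
  integral_mem_Icc_zero_one (M.integrable_click i v) (M.click_mem i v)

theorem integrable_clicks (i : Fin 2) (r : ℝ) :
    Integrable (fun w => M.clicks i (profile i r w)) D.law :=
  Integrable.of_bound ((M.measurable_clicks i).comp ((measurable_profile i).comp
    (measurable_const.prodMk measurable_id))).aestronglyMeasurable 1
    (ae_of_all _ fun w => by
      have := M.clicks_mem i (profile i r w)
      rw [Real.norm_eq_abs, abs_of_nonneg this.1]
      exact this.2)

theorem interimProfit_eq (i : Fin 2) (v : ℝ) {r : ℝ} (hr : r ∈ Icc 0 D.vbar) :
    M.interimProfit i v r = v * (∫ w, M.clicks i (profile i r w) ∂D.law)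
      - ∫ w, ∫ ω, M.transfer i (profile i r w) ω ∂C.P ∂D.law := by
  have hi := M.integrable_interim i r hr
  rw [interimProfit, ← integral_const_mul,
    ← integral_sub ((M.integrable_clicks i r).const_mul v) hi.integral_prod_left]
  refine integral_congr_ae ?_
  filter_upwards [hi.prod_right_ae] with w hw
  rw [integral_sub ((M.integrable_click i _).const_mul v) hw, integral_const_mul, clicks]

/-- No incentive compatible and individually rational mechanism extracts more than the optimal
virtual surplus. -/
theorem revenue_le (hIC : M.IncentiveCompatible) (hIR : M.IndividuallyRational) :
    M.revenue ≤ ∫ v, optSurplus D C v ∂D.jointLaw := by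
  set q : Fin 2 → ℝ → ℝ := fun i r => ∫ w, M.clicks i (profile i r w) ∂D.law with hq
  set t : Fin 2 → ℝ → ℝ := fun i r =>
    ∫ w, ∫ ω, M.transfer i (profile i r w) ω ∂C.P ∂D.law with ht
  have hqm : ∀ i, Measurable (q i) := fun i =>
    measurable_integral_law ((M.measurable_clicks i).comp (measurable_profile i))
  have hq1 : ∀ i r, q i r ∈ Icc (0 : ℝ) 1 := fun i r =>
    integral_mem_Icc_zero_one (M.integrable_clicks i r) fun w => M.clicks_mem i _
  have h0 : (0 : ℝ) ∈ Icc 0 D.vbar := ⟨le_rfl, D.vbar_pos.le⟩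
  have hbound : ∀ i, ∫ v, t i v ∂D.law ≤ ∫ v, q i v * D.virtualValue v ∂D.law := by
    intro i
    have h1 := D.integral_transfer (hqm i) (hq1 i) (t := t i) (fun v hv r hr => by
      have := hIC i v hv r hr
      rwa [M.interimProfit_eq i v hr, M.interimProfit_eq i v hv] at this)
    have h2 := hIR i 0 h0
    rw [M.interimProfit_eq i 0 h0, zero_mul, zero_sub] at h2
    have h3 : t i 0 ≤ 0 := by
      simp only [ht]
      linarith
    linarith
  have hint : ∀ i, Integrable (fun v => ∫ ω, M.transfer i v ω ∂C.P) D.jointLaw := fun i =>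
    (M.integrable_transfer i).integral_prod_left
  have hrev : M.revenue = ∑ i, ∫ v, t i v ∂D.law := by
    have h1 : M.revenue = ∫ v, ∑ i, ∫ ω, M.transfer i v ω ∂C.P ∂D.jointLaw := by
      refine integral_congr_ae ?_
      have h2 : ∀ᵐ v ∂D.jointLaw, ∀ i, Integrable (fun ω => M.transfer i v ω) C.P :=
        ae_all_iff.2 fun i => (M.integrable_transfer i).prod_right_ae
      filter_upwards [h2] with v hv
      exact integral_finsetSum _ fun i _ => hv i
    rw [h1, integral_finsetSum _ fun i _ => hint i]
    refine Finset.sum_congr rfl fun i _ => integral_jointLaw i (hint i) ?_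
    exact ((M.measurable_transfer i).stronglyMeasurable.integral_prod_right).measurable
  have hvi : ∀ i, Integrable (fun v : Fin 2 → ℝ => M.clicks i v * D.virtualValue (v i))
      D.jointLaw := fun i =>
    (integrable_virtualValue_apply D i).bdd_mul (c := 1)
      (M.measurable_clicks i).aestronglyMeasurable (ae_of_all _ fun v => by
        rw [Real.norm_eq_abs, abs_of_nonneg (M.clicks_mem i v).1]
        exact (M.clicks_mem i v).2)
  calc M.revenue = ∑ i, ∫ v, t i v ∂D.law := hrev
    _ ≤ ∑ i, ∫ v, q i v * D.virtualValue v ∂D.law := Finset.sum_le_sum fun i _ => hbound i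
    _ = ∫ v, ∑ i, M.clicks i v * D.virtualValue (v i) ∂D.jointLaw := by
        rw [integral_finsetSum _ fun i _ => hvi i]
        refine Finset.sum_congr rfl fun i _ => ?_
        rw [integral_jointLaw i (hvi i) ((M.measurable_clicks i).mul
          (D.measurable_virtualValue.comp (measurable_pi_apply i)))]
        simp only [profile_self, integral_mul_const, hq]
    _ ≤ ∫ v, optSurplus D C v ∂D.jointLaw := by
        refine integral_mono (integrable_finsetSum _ fun i _ => hvi i) (integrable_optSurplus D C)
          fun v => sum_virtual_le_optSurplus D v (fun i => ?_) (fun i ω => M.x_nonneg i v ω)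
            fun ω => M.x_sum_le v ω
        exact (M.measurable_x' i).comp (measurable_const.prodMk measurable_id)

end Mechanism

end Game

/-! ### Clicks and payments when the news about the ads is binary -/

theorem share_smul {R c : ℝ} (hc : 0 < c) (m b : Fin 2 → ℝ) (i : Fin 2) :
    share R (fun j => m j * c) b i = share R m b i := by
  simp only [share, ← mul_assoc, mul_lt_mul_iff_left₀ hc, mul_eq_mul_right_iff, hc.ne', or_false]

theorem price_smul {fmt : Format} {R c : ℝ} (hc : 0 < c) (m b : Fin 2 → ℝ) (i : Fin 2) :
    price fmt R (fun j => m j * c) b i = price fmt R m b i := by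
  cases fmt
  · rfl
  · simp only [price, ← mul_assoc, mul_div_mul_right _ _ hc.ne']

section Game

variable {Ω : Type*} [mΩ : MeasurableSpace Ω] {p : ℝ}
variable {D : ValueDist} {C : Conversation Ω p} {fmt : Format} {R : ℝ}

/-- At the stopping time `τ` the information about each ad is either bad news (`Y i = 0`), which
brings the belief down to zero, or its absence (`Y i = 1`); two ads without bad news are equally
likely to be good. The number `y` is the probability that an ad has no bad news at `τ`, given that
the other ad is good. -/
def BinaryNews (C : Conversation Ω p) (τ : C.StoppingTime) (y : ℝ) : Prop :=
  ∃ Y : Fin 2 → Ω → ℝ, (∀ i, Measurable (Y i)) ∧ (∀ i ω, Y i ω = 0 ∨ Y i ω = 1) ∧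
    (∀ i, ∫ ω, C.θ i ω * Y i.rev ω ∂C.P = p * y) ∧
    ∀ᵐ ω ∂C.P, ∀ i, C.θ i ω = 1 →
      0 < C.belief τ i ω ∧ C.belief τ i.rev ω = Y i.rev ω * C.belief τ i ω

theorem integral_θ (hp0 : 0 ≤ p) (C : Conversation Ω p) (i : Fin 2) : ∫ ω, C.θ i ω ∂C.P = p := by
  have h : C.θ i = {ω | C.θ i ω = 1}.indicator fun _ => (1 : ℝ) := by
    funext ω
    rcases C.θ_zero_or_one i ω with h | h <;> simp [h]
  have hs : MeasurableSet {ω | C.θ i ω = 1} := C.measurable_θ i (measurableSet_singleton 1)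
  rw [h, integral_indicator_const _ hs, measureReal_def, C.θ_good, ENNReal.toReal_ofReal hp0,
    smul_eq_mul, mul_one]

/-- Given that ad `i` is good, the outcome of the auction only depends on whether there is bad news
about the other ad. -/
theorem BinaryNews.integral_click_mul (hp0 : 0 ≤ p) {τ : C.StoppingTime} {y : ℝ}
    (h : BinaryNews C τ y) (i : Fin 2) (h' : (Fin 2 → ℝ) → ℝ)
    (hscale : ∀ m c, 0 < c → h' (fun j => m j * c) = h' m) :
    ∫ ω, C.θ i ω * h' (fun j => C.belief τ j ω) ∂C.P
      = p * y * h' (profile i 1 1) + p * (1 - y) * h' (profile i 1 0) := by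
  obtain ⟨Y, hYm, hY, hint, hb⟩ := h
  have hi : Integrable (fun ω => C.θ i ω * Y i.rev ω) C.P := by
    refine C.integrable_of_mem_Icc ((C.measurable_θ i).mul (hYm _)) 1 (ae_of_all _ fun ω => ?_)
    rcases C.θ_zero_or_one i ω with h1 | h1 <;> rcases hY i.rev ω with h2 | h2 <;> simp [h1, h2]
  have hae : ∀ᵐ ω ∂C.P, C.θ i ω * h' (fun j => C.belief τ j ω)
      = C.θ i ω * Y i.rev ω * (h' (profile i 1 1) - h' (profile i 1 0))
        + C.θ i ω * h' (profile i 1 0) := by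
    filter_upwards [hb] with ω hω
    rcases C.θ_zero_or_one i ω with h1 | h1
    · simp [h1]
    · obtain ⟨hpos, hrev⟩ := hω i h1
      have hm : (fun j => C.belief τ j ω)
          = fun j => profile i 1 (Y i.rev ω) j * C.belief τ i ω := by
        funext j
        rcases eq_or_eq_rev i j with rfl | rfl
        · simp
        · rw [profile_rev, hrev]
      rw [hm, hscale _ _ hpos]
      rcases hY i.rev ω with h2 | h2 <;> rw [h1, h2] <;> ring
  rw [integral_congr_ae hae, integral_add (hi.mul_const _) ((C.integrable_θ i).mul_const _),
    integral_mul_const, integral_mul_const, hint, integral_θ hp0]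
  ring

theorem BinaryNews.expClicks_eq (hp0 : 0 ≤ p) {τ : C.StoppingTime} {y : ℝ}
    (h : BinaryNews C τ y) (b : Fin 2 → ℝ) (i : Fin 2) :
    expClicks C R τ b i = p * y * share R (profile i 1 1) b i
      + p * (1 - y) * share R (profile i 1 0) b i :=
  h.integral_click_mul hp0 i (fun m => share R m b i) fun m _ hc => share_smul hc m b i

theorem BinaryNews.expPayment_eq (hp0 : 0 ≤ p) {τ : C.StoppingTime} {y : ℝ}
    (h : BinaryNews C τ y) (b : Fin 2 → ℝ) (i : Fin 2) :
    expPayment C fmt R τ b i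
      = p * y * (share R (profile i 1 1) b i * price fmt R (profile i 1 1) b i)
      + p * (1 - y) * (share R (profile i 1 0) b i * price fmt R (profile i 1 0) b i) := by
  rw [← h.integral_click_mul hp0 i (fun m => share R m b i * price fmt R m b i)
    fun m _ hc => by rw [share_smul hc m b i, price_smul hc m b i]]
  simp only [expPayment, collected, allocation, mul_assoc]

/-! ### Full information -/

theorem infoLimit_le_never (C : Conversation Ω p) : C.infoLimit ≤ C.never.2.measurableSpace := by
  intro s hs
  refine (IsStoppingTime.measurableSet _ s).2 ⟨hs, fun t => ?_⟩
  have : s ∩ {ω | C.never.1 ω ≤ (t : WithTop ℝ≥0)} = ∅ := by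
    ext ω
    simp only [Conversation.never, mem_inter_iff, mem_ofPred_eq, mem_empty_iff_false, iff_false]
    exact fun h => (WithTop.coe_lt_top t).not_ge h.2
  rw [this]
  exact @MeasurableSet.empty _ (C.filtration t)

theorem Conversation.belief_never (hC : C.Identifiable) :
    ∀ᵐ ω ∂C.P, ∀ i, C.belief C.never i ω = C.θ i ω := by
  obtain ⟨g, hg, hgθ⟩ := hC
  refine ae_all_iff.2 fun i => ?_
  have h1 : (fun ω => g ω i) =ᵐ[C.P] C.θ i := hgθ.mono fun ω hω => hω i
  have h2 : Measurable[C.never.2.measurableSpace] fun ω => g ω i :=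
    ((measurable_pi_apply i).comp hg).mono (infoLimit_le_never C) le_rfl
  have h3 : C.P[fun ω => g ω i | C.never.2.measurableSpace] = fun ω => g ω i :=
    condExp_of_stronglyMeasurable (C.stopped_le _) h2.stronglyMeasurable
      ((C.integrable_θ i).congr h1.symm)
  have h4 := (condExp_congr_ae (m := C.never.2.measurableSpace) h1)
  rw [h3] at h4
  filter_upwards [h1, h4] with ω a b
  rw [Conversation.belief, ← b, a]

theorem binaryNews_never (hp0 : 0 ≤ p) (hC : C.Identifiable) : BinaryNews C C.never p := by
  refine ⟨C.θ, C.measurable_θ, C.θ_zero_or_one, fun i => ?_, ?_⟩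
  · have h := (C.θ_indep.indepFun (rev_ne i).symm).integral_mul_eq_mul_integral
      (C.measurable_θ i).aestronglyMeasurable (C.measurable_θ i.rev).aestronglyMeasurable
    simp only [integral_θ hp0] at h
    exact h
  · filter_upwards [C.belief_never hC] with ω hω i hi
    rw [hω, hω, hi]
    simp

/-! ### Waiting for full information -/

/-- With bids that are paid in full, a state of full information is the best one to sell in. -/
theorem sum_click_mul_bid_le {R : ℝ} (hR : 0 < R) {θ : Fin 2 → ℝ} (hθ : ∀ i, θ i = 0 ∨ θ i = 1)
    (m : Fin 2 → ℝ) (b : Fin 2 → ℝ) :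
    ∑ i, θ i * share R m b i * b i ≤ ∑ i, θ i * share R θ b i * b i := by
  set M := ∑ i, θ i * share R θ b i * b i with hM
  have hθ0 : ∀ i, 0 ≤ θ i := fun i => by rcases hθ i with h | h <;> simp [h]
  have hterm : ∀ i, 0 ≤ θ i * share R θ b i * b i := fun i => by
    by_cases hb : b i < R
    · simp [share_eq_zero hb]
    · exact mul_nonneg (mul_nonneg (hθ0 i) (share_nonneg ..)) (hR.le.trans (not_lt.1 hb))
  have hM0 : 0 ≤ M := Finset.sum_nonneg fun i _ => hterm i
  have hle : ∀ i, R ≤ b i → θ i * b i ≤ M := by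
    intro i hb
    rcases hθ i with h | h
    · simpa [h] using hM0
    have hsum : M = θ i * share R θ b i * b i + θ i.rev * share R θ b i.rev * b i.rev :=
      sum_eq_add_rev i _
    have hrev := hterm i.rev
    by_cases hr : θ i.rev = 0 ∨ b i.rev < R
    · have hs : share R θ b i = 1 := by
        rw [share, if_neg hb.not_gt, if_pos]
        rcases hr with hr | hr
        · right
          rw [hr, h]
          linarith
        · exact Or.inl hr
      rw [hsum, hs, h]
      linarith
    · push Not at hr
      have h' : θ i.rev = 1 := (hθ i.rev).resolve_left hr.1
      rw [hsum]
      simp only [share, hb.not_gt, hr.2.not_gt, h, h', Fin.rev_rev, mul_one, one_mul, false_or,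
        if_false]
      rcases lt_trichotomy (b i.rev) (b i) with hlt | heq | hgt
      · simp [hlt, hlt.not_gt, hlt.ne']
      · simp [heq]
        linarith
      · simp [hgt, hgt.not_gt, hgt.ne']
        exact hgt.le
  calc ∑ i, θ i * share R m b i * b i ≤ ∑ i, share R m b i * M :=
        Finset.sum_le_sum fun i _ => by
          by_cases hb : b i < R
          · simp [share_eq_zero hb]
          · have := mul_le_mul_of_nonneg_left (hle i (not_lt.1 hb)) (share_nonneg R m b i)
            linarith
    _ = (∑ i, share R m b i) * M := by rw [Finset.sum_mul]
    _ ≤ M := mul_le_of_le_one_left hM0 (share_sum_le_one R m b)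

theorem sequentiallyRational_never (hC : C.Identifiable) (hR : 0 < R) (b : Fin 2 → ℝ) :
    SequentiallyRational C .firstPrice R b C.never := by
  intro t σ _
  have h : revenueAt C .firstPrice R σ b ≤ᵐ[C.P] revenueAt C .firstPrice R C.never b := by
    filter_upwards [C.belief_never hC] with ω hω
    simp only [revenueAt, collected, price, allocation, hω]
    exact sum_click_mul_bid_le hR (fun i => C.θ_zero_or_one i ω) _ b
  filter_upwards [condExp_mono (m := C.filtration t) (integrable_revenueAt hR.le σ b)
    (integrable_revenueAt hR.le C.never b) h] with ω hω _
  exact hω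

/-! ### Equilibrium bids of the first-price auction -/

/-- The probability of winning a click from a user who likes the ad, for the value `v`: the other
ad is bad, or it is good and its advertiser has a lower value. -/
def winProb (D : ValueDist) (p v : ℝ) : ℝ := 1 - p + p * D.cdf v

/-- The bid of the value `v` above the reserve. -/
def shadedBid (D : ValueDist) (p R v : ℝ) : ℝ :=
  v - (∫ s in R..v, winProb D p s) / winProb D p v

/-- The equilibrium bid when the set of participating values is `U`; all other values bid less than
the reserve. -/
def equilibriumBid (D : ValueDist) (p R : ℝ) (U : Set ℝ) [DecidablePred (· ∈ U)] (v : ℝ) : ℝ :=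
  if v ∈ U then shadedBid D p R v else v / 2

theorem continuous_winProb : Continuous (winProb D p) :=
  continuous_const.add (continuous_const.mul D.continuous_cdf)

theorem winProb_pos (hp0 : 0 < p) (hp1 : p < 1) (v : ℝ) : 0 < winProb D p v := by
  have := mul_nonneg hp0.le (D.cdf_nonneg v)
  unfold winProb
  linarith

theorem winProb_mono (hp0 : 0 < p) : Monotone (winProb D p) := fun _ _ h =>
  add_le_add_right (mul_le_mul_of_nonneg_left (D.cdf_mono h) hp0.le) _

theorem winProb_strictMonoOn (hp0 : 0 < p) : StrictMonoOn (winProb D p) (Icc 0 D.vbar) :=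
  fun _ hr _ hs h => add_lt_add_right (mul_lt_mul_of_pos_left (D.cdf_strictMonoOn hr hs h) hp0) _

theorem intervalIntegrable_winProb (a b : ℝ) : IntervalIntegrable (winProb D p) volume a b :=
  continuous_winProb.intervalIntegrable a b

theorem continuous_shadedBid (hp0 : 0 < p) (hp1 : p < 1) : Continuous (shadedBid D p R) :=
  continuous_id.sub ((intervalIntegral.continuous_primitive intervalIntegrable_winProb R).div
    continuous_winProb fun v => (winProb_pos hp0 hp1 v).ne')

theorem shadedBid_reserve : shadedBid D p R R = R := by simp [shadedBid]

/-- A tangent inequality for the convex function with derivative `winProb`. -/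
theorem mul_winProb_le_integral (hp0 : 0 < p) (r v : ℝ) :
    (v - r) * winProb D p r ≤ ∫ s in r..v, winProb D p s := by
  rcases le_total r v with h | h
  · have := intervalIntegral.integral_mono_on h
      (intervalIntegrable_const (μ := volume) (c := winProb D p r))
      (intervalIntegrable_winProb (D := D) (p := p) r v) (fun x hx => winProb_mono hp0 hx.1)
    simpa using this
  · have := intervalIntegral.integral_mono_on h (intervalIntegrable_winProb (D := D) (p := p) v r)
      (intervalIntegrable_const (μ := volume) (c := winProb D p r))
      (fun x hx => winProb_mono hp0 hx.2)
    rw [intervalIntegral.integral_symm]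
    simp only [intervalIntegral.integral_const, smul_eq_mul] at this
    linarith

theorem integral_winProb_nonneg (hp0 : 0 < p) (hp1 : p < 1) {r v : ℝ} (h : r ≤ v) :
    0 ≤ ∫ s in r..v, winProb D p s :=
  intervalIntegral.integral_nonneg h fun s _ => (winProb_pos hp0 hp1 s).le

theorem shadedBid_le (hp0 : 0 < p) (hp1 : p < 1) {v : ℝ} (h : R ≤ v) : shadedBid D p R v ≤ v := by
  have := div_nonneg (integral_winProb_nonneg (D := D) hp0 hp1 h) (winProb_pos (D := D) hp0 hp1 v).le
  unfold shadedBid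
  linarith

theorem sub_shadedBid_mul (hp0 : 0 < p) (hp1 : p < 1) (v r : ℝ) :
    (v - shadedBid D p R r) * winProb D p r
      = (v - r) * winProb D p r + ∫ s in R..r, winProb D p s := by
  have := (winProb_pos (D := D) hp0 hp1 r).ne'
  unfold shadedBid
  field_simp
  ring

theorem shadedBid_strictMonoOn (hp0 : 0 < p) (hp1 : p < 1) (hR : 0 < R) :
    StrictMonoOn (shadedBid D p R) (Icc R D.vbar) := by
  intro v hv w hw hvw
  have hGw := winProb_pos (D := D) hp0 hp1 w
  have hlt : ∫ s in v..w, winProb D p s < (w - v) * winProb D p w := by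
    have := intervalIntegral.integral_lt_integral_of_continuousOn_of_le_of_exists_lt hvw
      (continuous_winProb (D := D) (p := p)).continuousOn
      (continuousOn_const (c := winProb D p w)) (fun x hx => winProb_mono hp0 hx.2)
      ⟨v, ⟨le_rfl, hvw.le⟩, winProb_strictMonoOn hp0 ⟨hR.le.trans hv.1, hv.2⟩
        ⟨hR.le.trans hw.1, hw.2⟩ hvw⟩
    simpa using this
  have hI := integral_winProb_nonneg (D := D) hp0 hp1 hv.1
  have hle : (∫ s in R..v, winProb D p s) / winProb D p w
      ≤ (∫ s in R..v, winProb D p s) / winProb D p v :=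
    div_le_div_of_nonneg_left hI (winProb_pos hp0 hp1 v) (winProb_mono hp0 hvw.le)
  have hadd := intervalIntegral.integral_add_adjacent_intervals
    (intervalIntegrable_winProb (D := D) (p := p) R v)
    (intervalIntegrable_winProb (D := D) (p := p) v w)
  have hw' : (∫ s in R..w, winProb D p s) / winProb D p w
      < (∫ s in R..v, winProb D p s) / winProb D p w + (w - v) := by
    rw [← hadd, add_div]
    have : (∫ s in v..w, winProb D p s) / winProb D p w < w - v := by
      rwa [div_lt_iff₀ hGw]
    linarith
  unfold shadedBid
  linarith

/-- Bidding as if the value were `r` yields at most the information rent of the true value. -/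
theorem deviation_le (hp0 : 0 < p) (hp1 : p < 1) {v r : ℝ} :
    (v - shadedBid D p R r) * winProb D p r ≤ ∫ s in R..v, winProb D p s := by
  rw [sub_shadedBid_mul hp0 hp1]
  have := mul_winProb_le_integral (D := D) hp0 r v
  have hadd := intervalIntegral.integral_add_adjacent_intervals
    (intervalIntegrable_winProb (D := D) (p := p) R r)
    (intervalIntegrable_winProb (D := D) (p := p) r v)
  linarith

/-- A set of participating values at the reserve `R`: all values above the reserve, and possibly
the reserve itself. -/
structure IsParticipation (D : ValueDist) (R : ℝ) (U : Set ℝ) : Prop where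
  measurableSet : MeasurableSet U
  Ioi_subset : Ioi R ⊆ U
  subset_Ici : U ⊆ Ici R
  reserve_mem : R ∈ Ioo 0 D.vbar

theorem isParticipation_Ici (hR : R ∈ Ioo 0 D.vbar) : IsParticipation D R (Ici R) :=
  ⟨measurableSet_Ici, Ioi_subset_Ici_self, le_rfl, hR⟩

theorem isParticipation_Ioi (hR : R ∈ Ioo 0 D.vbar) : IsParticipation D R (Ioi R) :=
  ⟨measurableSet_Ioi, le_rfl, Ioi_subset_Ici_self, hR⟩

theorem reserve_le_shadedBid (hp0 : 0 < p) (hp1 : p < 1) {U : Set ℝ} (hU : IsParticipation D R U)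
    {v : ℝ} (hv : v ∈ Icc R D.vbar) : R ≤ shadedBid D p R v := by
  have := (shadedBid_strictMonoOn (D := D) hp0 hp1 hU.reserve_mem.1).monotoneOn
    ⟨le_rfl, hU.reserve_mem.2.le⟩ hv hv.1
  rwa [shadedBid_reserve] at this

section Bid

variable {U : Set ℝ} [DecidablePred (· ∈ U)]

theorem measurable_equilibriumBid (hp0 : 0 < p) (hp1 : p < 1) (hU : IsParticipation D R U) :
    Measurable (equilibriumBid D p R U) :=
  Measurable.ite hU.measurableSet (continuous_shadedBid hp0 hp1).measurable
    (measurable_id.div_const 2)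

theorem le_equilibriumBid (hp0 : 0 < p) (hp1 : p < 1) (hU : IsParticipation D R U)
    {v : ℝ} (hv : v ≤ D.vbar) (hvU : v ∈ U) : R ≤ equilibriumBid D p R U v := by
  rw [equilibriumBid, if_pos hvU]
  exact reserve_le_shadedBid hp0 hp1 hU ⟨hU.subset_Ici hvU, hv⟩

theorem equilibriumBid_lt (hU : IsParticipation D R U) {v : ℝ} (hvU : v ∉ U) :
    equilibriumBid D p R U v < R := by
  rw [equilibriumBid, if_neg hvU]
  have h1 : v ≤ R := by
    by_contra! h
    exact hvU (hU.Ioi_subset h)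
  linarith [hU.reserve_mem.1]

theorem equilibriumBid_strictMonoOn (hp0 : 0 < p) (hp1 : p < 1) (hU : IsParticipation D R U) :
    StrictMonoOn (equilibriumBid D p R U) (Icc 0 D.vbar) := by
  intro v hv w hw hvw
  by_cases hvU : v ∈ U
  · have hwU : w ∈ U := hU.Ioi_subset ((hU.subset_Ici hvU).trans_lt hvw)
    rw [equilibriumBid, equilibriumBid, if_pos hvU, if_pos hwU]
    exact shadedBid_strictMonoOn hp0 hp1 hU.reserve_mem.1 ⟨hU.subset_Ici hvU, hv.2⟩
      ⟨hU.subset_Ici hwU, hw.2⟩ hvw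
  · by_cases hwU : w ∈ U
    · exact (equilibriumBid_lt hU hvU).trans_le (le_equilibriumBid hp0 hp1 hU hw.2 hwU)
    · rw [equilibriumBid, equilibriumBid, if_neg hvU, if_neg hwU]
      linarith

theorem equilibriumBid_mem (hp0 : 0 < p) (hp1 : p < 1) (hU : IsParticipation D R U)
    {v : ℝ} (hv : v ∈ Icc 0 D.vbar) : equilibriumBid D p R U v ∈ Icc 0 D.vbar := by
  by_cases hvU : v ∈ U
  · refine ⟨hU.reserve_mem.1.le.trans (le_equilibriumBid hp0 hp1 hU hv.2 hvU), ?_⟩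
    rw [equilibriumBid, if_pos hvU]
    exact (shadedBid_le hp0 hp1 (hU.subset_Ici hvU)).trans hv.2
  · rw [equilibriumBid, if_neg hvU]
    constructor <;> linarith [hv.1, hv.2]

end Bid

end Game

/-! ### The first-price auction implements the optimal mechanism -/

section Game

variable {Ω : Type*} [mΩ : MeasurableSpace Ω] {p : ℝ}
variable {D : ValueDist} {C : Conversation Ω p} {R : ℝ} {U : Set ℝ} [DecidablePred (· ∈ U)]

theorem firstPrice_expPayment (τ : C.StoppingTime) (b : Fin 2 → ℝ) (i : Fin 2) :
    expPayment C .firstPrice R τ b i = expClicks C R τ b i * b i := by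
  simp only [expPayment, collected, price, integral_mul_const, expClicks]

theorem share_solo (hR : 0 < R) {b : Fin 2 → ℝ} {i : Fin 2} (hb : R ≤ b i) :
    share R (profile i 1 0) b i = 1 := by
  rw [share, if_neg hb.not_gt, if_pos]
  right
  simp
  linarith

/-- Expected clicks of an eligible bidder under full information. -/
theorem expClicks_never (hp0 : 0 < p) (hC : C.Identifiable) (hR : 0 < R) {i : Fin 2} {a : ℝ}
    (ha : R ≤ a) (c : ℝ) : expClicks C R C.never (profile i a c) i
      = p * (1 - p + p * share R (profile i 1 1) (profile i a c) i) := by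
  rw [(binaryNews_never hp0.le hC).expClicks_eq hp0.le, share_solo hR (by simpa using ha)]
  ring

theorem share_duel_eq_one {i : Fin 2} {a c : ℝ} (ha : R ≤ a) (h : c < R ∨ c < a) :
    share R (profile i 1 1) (profile i a c) i = 1 := by
  simp [share, ha.not_gt, h]

theorem share_duel_eq_zero {i : Fin 2} {a c : ℝ} (hc : R ≤ c) (h : a < c) :
    share R (profile i 1 1) (profile i a c) i = 0 := by
  simp [share, hc.not_gt, h.ne', h.not_gt]

theorem firstPrice_interimProfit (i : Fin 2) (T : (Fin 2 → ℝ) → C.StoppingTime)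
    (β : Fin 2 → ℝ → ℝ) (v a : ℝ) :
    interimProfit D C .firstPrice R T β i v a = (v - a) * interimClicks D C R T β i a := by
  rw [interimProfit, interimClicks, ← integral_const_mul]
  refine integral_congr_ae (ae_of_all _ fun w => ?_)
  simp only [firstPrice_expPayment, profile_self]
  ring

theorem interimClicks_of_lt (i : Fin 2) (T : (Fin 2 → ℝ) → C.StoppingTime)
    (β : Fin 2 → ℝ → ℝ) {a : ℝ} (ha : a < R) : interimClicks D C R T β i a = 0 := by
  rw [interimClicks]
  refine integral_eq_zero_of_ae (ae_of_all _ fun w => expClicks_eq_zero _ (by simpa using ha))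

/-- The bid of the value `r` wins exactly against the lower values. -/
theorem interimClicks_shadedBid (hp0 : 0 < p) (hp1 : p < 1) (hC : C.Identifiable)
    (hU : IsParticipation D R U) (i : Fin 2) {r : ℝ} (hr : r ∈ Icc R D.vbar) :
    interimClicks D C R (fun _ => C.never) (fun _ => equilibriumBid D p R U) i (shadedBid D p R r)
      = p * winProb D p r := by
  have hR := hU.reserve_mem.1
  have hmono := shadedBid_strictMonoOn (D := D) hp0 hp1 hR
  have hle := reserve_le_shadedBid hp0 hp1 hU hr
  have h : ∀ᵐ w ∂D.law, expClicks C R C.never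
      (profile i (shadedBid D p R r) (equilibriumBid D p R U w)) i
      = p * (1 - p) + p * p * (Iio r).indicator (fun _ => 1) w := by
    have hne : ∀ᵐ w ∂D.law, w ≠ r := by simp [ae_iff]
    filter_upwards [D.ae_mem_Icc, hne] with w hw hwr
    rw [expClicks_never hp0 hC hR hle]
    rcases lt_or_gt_of_ne hwr with hlt | hgt
    · rw [share_duel_eq_one hle, indicator_of_mem (mem_Iio.2 hlt)]
      · ring
      · by_cases hwU : w ∈ U
        · right
          rw [equilibriumBid, if_pos hwU]
          exact hmono ⟨hU.subset_Ici hwU, hw.2⟩ hr hlt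
        · exact Or.inl (equilibriumBid_lt hU hwU)
    · have hwU : w ∈ U := hU.Ioi_subset (hr.1.trans_lt hgt)
      rw [share_duel_eq_zero (le_equilibriumBid hp0 hp1 hU hw.2 hwU),
        indicator_of_notMem (show w ∉ Iio r from fun h => hgt.not_gt h)]
      · ring
      · rw [equilibriumBid, if_pos hwU]
        exact hmono hr ⟨hU.subset_Ici hwU, hw.2⟩ hgt
  rw [interimClicks, integral_congr_ae h, integral_add (integrable_const _)
    (((integrable_const _).indicator measurableSet_Iio).const_mul _), integral_const,
    integral_const_mul,
    integral_indicator_const _ measurableSet_Iio, D.law_real_Iio]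
  simp [winProb]
  ring

/-- The first-price auction with reserve `R` and full information has an equilibrium in which the
values in `U` bid `shadedBid` and the others stay below the reserve. -/
theorem isEquilibrium_firstPrice (hp0 : 0 < p) (hp1 : p < 1) (hC : C.Identifiable)
    (hU : IsParticipation D R U) : IsEquilibrium D C .firstPrice R
      (fun _ => equilibriumBid D p R U) (fun _ => C.never) := by
  have hR := hU.reserve_mem.1
  have hclicks : ∀ i, Measurable fun b : Fin 2 → ℝ => expClicks C R C.never b i := by
    intro i
    have h : ∀ y : ℝ, Measurable fun b : Fin 2 → ℝ => share R (profile i 1 y) b i := fun y =>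
      (measurable_share R i).comp (f := fun b => (profile i 1 y, b))
        (measurable_const.prodMk measurable_id)
    simp only [(binaryNews_never hp0.le hC).expClicks_eq hp0.le]
    exact ((h 1).const_mul _).add ((h 0).const_mul _)
  refine ⟨fun _ => measurable_equilibriumBid hp0 hp1 hU,
    fun _ v hv => (equilibriumBid_mem hp0 hp1 hU hv).1, hclicks, fun i => ?_,
    fun b _ => sequentiallyRational_never hC hR b, fun i v hv a ha => ?_⟩
  · simp only [firstPrice_expPayment]
    exact (hclicks i).mul (measurable_pi_apply i)
  -- The equilibrium profit is the information rent of the values that participate.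
  have hprofit : interimProfit D C .firstPrice R (fun _ => C.never)
      (fun _ => equilibriumBid D p R U) i v (equilibriumBid D p R U v)
      = if v ∈ U then p * ∫ s in R..v, winProb D p s else 0 := by
    rw [firstPrice_interimProfit]
    split_ifs with hvU
    · rw [equilibriumBid, if_pos hvU, interimClicks_shadedBid hp0 hp1 hC hU i
        ⟨hU.subset_Ici hvU, hv.2⟩, mul_left_comm, sub_shadedBid_mul hp0 hp1]
      ring
    · rw [interimClicks_of_lt i _ _ (equilibriumBid_lt hU hvU), mul_zero]
  have hge : ∀ c, c ≤ p * ∫ s in R..v, winProb D p s → (v ≤ R → c ≤ 0) →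
      c ≤ if v ∈ U then p * ∫ s in R..v, winProb D p s else 0 := by
    intro c h1 h2
    split_ifs with hvU
    · exact h1
    · exact h2 (not_lt.1 fun h => hvU (hU.Ioi_subset h))
  rw [hprofit, firstPrice_interimProfit]
  rcases lt_or_ge a R with haR | haR
  · rw [interimClicks_of_lt i _ _ haR, mul_zero]
    split_ifs with hvU
    · exact mul_nonneg hp0.le (integral_winProb_nonneg hp0 hp1 (hU.subset_Ici hvU))
    · exact le_rfl
  have hq := interimClicks_shadedBid (C := C) hp0 hp1 hC hU i ⟨hU.reserve_mem.2.le, le_rfl⟩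
  rcases le_or_gt a (shadedBid D p R D.vbar) with hab | hab
  · -- A bid in the range of the bidding function imitates another value.
    obtain ⟨r, hr, rfl⟩ := intermediate_value_Icc hU.reserve_mem.2.le
      (continuous_shadedBid (D := D) (R := R) hp0 hp1).continuousOn
      ⟨by rwa [shadedBid_reserve], hab⟩
    rw [interimClicks_shadedBid hp0 hp1 hC hU i hr, mul_left_comm]
    refine hge _ (mul_le_mul_of_nonneg_left (deviation_le hp0 hp1) hp0.le) fun hvR => ?_
    refine mul_nonpos_of_nonneg_of_nonpos hp0.le
      (mul_nonpos_of_nonpos_of_nonneg ?_ (winProb_pos hp0 hp1 r).le)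
    linarith
  · -- A higher bid wins for sure, as does the bid of the highest value.
    have hclick1 : interimClicks D C R (fun _ => C.never) (fun _ => equilibriumBid D p R U) i a
        = p := by
      rw [interimClicks]
      have h : ∀ᵐ w ∂D.law, expClicks C R C.never (profile i a (equilibriumBid D p R U w)) i
          = p := by
        filter_upwards [D.ae_mem_Icc] with w hw
        rw [expClicks_never hp0 hC hR haR, share_duel_eq_one haR]
        · ring
        · by_cases hwU : w ∈ U
          · right
            rw [equilibriumBid, if_pos hwU]
            exact ((shadedBid_strictMonoOn hp0 hp1 hR).monotoneOn ⟨hU.subset_Ici hwU, hw.2⟩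
              ⟨hU.reserve_mem.2.le, le_rfl⟩ hw.2).trans_lt hab
          · exact Or.inl (equilibriumBid_lt hU hwU)
      rw [integral_congr_ae h]
      simp
    have hG : winProb D p D.vbar = 1 := by simp [winProb, D.cdf_vbar]
    rw [hclick1]
    refine hge _ ?_ fun hvR => mul_nonpos_of_nonpos_of_nonneg (by linarith) hp0.le
    have := deviation_le (D := D) (R := R) (v := v) (r := D.vbar) hp0 hp1
    rw [hG, mul_one] at this
    rw [mul_comm]
    exact mul_le_mul_of_nonneg_left (by linarith) hp0.le

/-- The winner is the advertiser of a good ad with the highest nonnegative virtual value. -/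
theorem isOptimalAllocation_equilibriumBid (hp0 : 0 < p) (hp1 : p < 1) (hD : D.Regular)
    (hU : IsParticipation D R U) (hneg : ∀ v ∈ Ioo 0 D.vbar, v ∉ U → D.virtualValue v ≤ 0)
    (hpos : ∀ v ∈ Ioo 0 D.vbar, v ∈ U → 0 ≤ D.virtualValue v) {v θ : Fin 2 → ℝ}
    (hv : ∀ i, v i ∈ Ioo 0 D.vbar) (hθ : ∀ i, θ i = 0 ∨ θ i = 1) :
    IsOptimalAllocation D v θ (share R θ fun i => equilibriumBid D p R U (v i)) := by
  have hR := hU.reserve_mem.1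
  set b : Fin 2 → ℝ := fun i => equilibriumBid D p R U (v i) with hb
  have hbU : ∀ i, R ≤ b i ↔ v i ∈ U := fun i =>
    ⟨fun h => by_contra fun hc => (equilibriumBid_lt hU hc).not_ge h,
      le_equilibriumBid hp0 hp1 hU (hv i).2.le⟩
  have hmono : ∀ i j, b i ≤ b j → D.virtualValue (v i) ≤ D.virtualValue (v j) := fun i j h =>
    hD (hv i) (hv j) (((equilibriumBid_strictMonoOn hp0 hp1 hU).le_iff_le
      (Ioo_subset_Icc_self (hv i)) (Ioo_subset_Icc_self (hv j))).1 h)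
  refine (isOptimalAllocation_iff (fun i => share_nonneg ..) (share_sum_le_one ..)).2
    (le_antisymm (sum_le_topVirtual D v θ (fun i => share_nonneg ..) (share_sum_le_one ..)) ?_)
  set S := ∑ i, share R θ b i * (θ i * D.virtualValue (v i)) with hS
  have hθ0 : ∀ i, 0 ≤ θ i := fun i => by rcases hθ i with h | h <;> simp [h]
  have hterm : ∀ i, 0 ≤ share R θ b i * (θ i * D.virtualValue (v i)) := fun i => by
    by_cases h : b i < R
    · simp [share_eq_zero h]
    · exact mul_nonneg (share_nonneg ..)
        (mul_nonneg (hθ0 i) (hpos _ (hv i) ((hbU i).1 (not_lt.1 h))))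
  have hS0 : 0 ≤ S := Finset.sum_nonneg fun i _ => hterm i
  have hle : ∀ i, θ i * D.virtualValue (v i) ≤ S := by
    intro i
    rcases lt_or_ge (b i) R with hbi | hbi
    · have := hneg _ (hv i) fun h => hbi.not_ge ((hbU i).2 h)
      exact (mul_nonpos_of_nonneg_of_nonpos (hθ0 i) this).trans hS0
    rcases hθ i with h | h
    · simpa [h] using hS0
    have hsum : S = share R θ b i * (θ i * D.virtualValue (v i))
        + share R θ b i.rev * (θ i.rev * D.virtualValue (v i.rev)) := sum_eq_add_rev i _
    have hrev := hterm i.rev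
    by_cases hr : θ i.rev = 0 ∨ b i.rev < R
    · have hs : share R θ b i = 1 := by
        rw [share, if_neg hbi.not_gt, if_pos]
        rcases hr with hr | hr
        · right
          rw [hr, h]
          linarith
        · exact Or.inl hr
      rw [hsum, hs, h]
      linarith
    · push Not at hr
      have h' : θ i.rev = 1 := (hθ i.rev).resolve_left hr.1
      rw [hsum]
      simp only [share, hbi.not_gt, hr.2.not_gt, h, h', Fin.rev_rev, mul_one, one_mul, false_or,
        if_false]
      rcases lt_trichotomy (b i.rev) (b i) with hlt | heq | hgt
      · simp [hlt, hlt.not_gt, hlt.ne']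
      · have := hmono i i.rev heq.ge
        simp [heq]
        linarith
      · have := hmono i i.rev hgt.le
        simpa [hgt, hgt.not_gt, hgt.ne'] using this
  exact max_le hS0 (max_le (hle 0) (hle 1))

/-- The direct mechanism that reproduces the outcome of the first-price auction. The version `g` of
the type that is measurable with respect to the conversation stands in for the beliefs. -/
def auctionMechanism (D : ValueDist) (C : Conversation Ω p) (R : ℝ) {β : ℝ → ℝ}
    (hβ : Measurable β) (hβ1 : ∀ v ∈ Icc 0 D.vbar, β v ∈ Icc 0 D.vbar) {g : Ω → Fin 2 → ℝ}
    (hg : Measurable[C.infoLimit] g) : Mechanism D C :=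
  have hbid : Measurable fun v : Fin 2 → ℝ => fun j => β (v j) :=
    measurable_pi_lambda _ fun j => hβ.comp (measurable_pi_apply j)
  have hx : ∀ i, Measurable[MeasurableSpace.prod MeasurableSpace.pi C.infoLimit]
      (Function.uncurry fun (v : Fin 2 → ℝ) ω => share R (g ω) (fun j => β (v j)) i) := fun i => by
    let _ := C.infoLimit
    exact (measurable_share R i).comp
      ((hg.comp measurable_snd).prodMk (hbid.comp measurable_fst))
  have hx' : ∀ i, Measurable
      (Function.uncurry fun (v : Fin 2 → ℝ) ω => share R (g ω) (fun j => β (v j)) i) := fun i =>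
    (hx i).mono (sup_le_sup le_rfl (MeasurableSpace.comap_mono C.infoLimit_le)) le_rfl
  have ht : ∀ i, Measurable (Function.uncurry fun (v : Fin 2 → ℝ) ω =>
      C.θ i ω * share R (g ω) (fun j => β (v j)) i * β (v i)) := fun i =>
    (((C.measurable_θ i).comp measurable_snd).mul (hx' i)).mul
      (hβ.comp ((measurable_pi_apply i).comp measurable_fst))
  have hbd : ∀ i (v : Fin 2 → ℝ) ω,
      ‖C.θ i ω * share R (g ω) (fun j => β (v j)) i * β (v i)‖ ≤ |β (v i)| := fun i v ω => by
    rw [norm_mul, Real.norm_eq_abs, Real.norm_eq_abs,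
      abs_of_nonneg (mul_nonneg (C.θ_nonneg i ω) (share_nonneg ..))]
    exact mul_le_of_le_one_left (abs_nonneg _)
      (mul_le_one₀ (C.θ_le_one i ω) (share_nonneg ..) (share_le_one ..))
  { x := fun i v ω => share R (g ω) (fun j => β (v j)) i
    transfer := fun i v ω => C.θ i ω * share R (g ω) (fun j => β (v j)) i * β (v i)
    measurable_x := hx
    measurable_transfer := ht
    x_nonneg := fun i v ω => share_nonneg ..
    x_sum_le := fun v ω => share_sum_le_one ..
    integrable_transfer := fun i => by
      have h1 : ∀ᵐ v ∂D.jointLaw, v i ∈ Icc 0 D.vbar :=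
        (measurePreserving_eval (fun _ : Fin 2 => D.law) i).quasiMeasurePreserving.ae D.ae_mem_Icc
      refine Integrable.of_bound (ht i).aestronglyMeasurable D.vbar ?_
      filter_upwards [Measure.quasiMeasurePreserving_fst.ae h1] with z hz
      refine (hbd i z.1 z.2).trans ?_
      rw [abs_of_nonneg (hβ1 _ hz).1]
      exact (hβ1 _ hz).2
    integrable_interim := fun i r _ => by
      refine Integrable.of_bound ((ht i).comp (((measurable_profile i).comp
        (measurable_const.prodMk measurable_fst)).prodMk measurable_snd)).aestronglyMeasurable
        |β r| (ae_of_all _ fun z => ?_)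
      simpa using hbd i (profile i r z.1) z.2 }

theorem auctionMechanism_clicks {β : ℝ → ℝ} (hβ : Measurable β)
    (hβ1 : ∀ v ∈ Icc 0 D.vbar, β v ∈ Icc 0 D.vbar) {g : Ω → Fin 2 → ℝ}
    (hg : Measurable[C.infoLimit] g)
    (hgb : ∀ᵐ ω ∂C.P, ∀ i, g ω i = C.belief C.never i ω) (i : Fin 2) (v : Fin 2 → ℝ) :
    ∀ᵐ ω ∂C.P, (auctionMechanism D C R hβ hβ1 hg).x i v ω
      = allocation C R C.never (fun j => β (v j)) ω i ∧
      (auctionMechanism D C R hβ hβ1 hg).transfer i v ω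
        = collected C .firstPrice R C.never (fun j => β (v j)) i ω := by
  filter_upwards [hgb] with ω hω
  have h : g ω = fun j => C.belief C.never j ω := funext hω
  constructor
  · simp only [auctionMechanism, allocation, h]
  · simp only [auctionMechanism, collected, allocation, price, h]

/-- A first-price auction implements the optimal mechanism if its participating values are those
with a nonnegative virtual value, up to values with a virtual value of zero. Its revenue, which the
equivalent direct mechanism attains, is then the optimal virtual surplus. -/
theorem firstPriceImplements (hp0 : 0 < p) (hp1 : p < 1) (hC : C.Identifiable) (hD : D.Regular)
    (hU : IsParticipation D R U) (hneg : ∀ v ∈ Ioo 0 D.vbar, v ∉ U → D.virtualValue v ≤ 0)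
    (hpos : ∀ v ∈ Ioo 0 D.vbar, v ∈ U → 0 ≤ D.virtualValue v) :
    FirstPriceImplements D C R ∧
      (∫ v, optSurplus D C v ∂D.jointLaw) ∈ attainableRevenues D C := by
  have hR := hU.reserve_mem.1
  have E := isEquilibrium_firstPrice (C := C) hp0 hp1 hC hU
  have hopt : ∀ v : Fin 2 → ℝ, (∀ i, v i ∈ Ioo 0 D.vbar) → ∀ᵐ ω ∂C.P,
      IsOptimalAllocation D v (fun i => C.θ i ω)
        (allocation C R C.never (fun i => equilibriumBid D p R U (v i)) ω) := by
    intro v hv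
    filter_upwards [C.belief_never hC] with ω hω
    have h : allocation C R C.never (fun i => equilibriumBid D p R U (v i)) ω
        = share R (fun i => C.θ i ω) fun i => equilibriumBid D p R U (v i) := by
      funext i
      simp only [allocation, hω]
    rw [h]
    exact isOptimalAllocation_equilibriumBid hp0 hp1 hD hU hneg hpos hv
      fun i => C.θ_zero_or_one i ω
  have hrev : auctionRevenue D C .firstPrice R (fun _ => equilibriumBid D p R U)
      (fun _ => C.never) = ∫ v, optSurplus D C v ∂D.jointLaw := by
    refine (E.auctionRevenue_eq_iff hR.le).2 ?_
    have h1 : ∀ᵐ v ∂D.jointLaw, ∀ i, v i ∈ Ioo 0 D.vbar := ae_all_iff.2 fun i =>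
      (measurePreserving_eval (fun _ : Fin 2 => D.law) i).quasiMeasurePreserving.ae D.ae_mem_Ioo
    filter_upwards [h1] with v hv
    exact hopt v hv
  have hmem : auctionRevenue D C .firstPrice R (fun _ => equilibriumBid D p R U)
      (fun _ => C.never) ∈ attainableRevenues D C := by
    obtain ⟨g, hg, hgθ⟩ := hC
    have hgb : ∀ᵐ ω ∂C.P, ∀ i, g ω i = C.belief C.never i ω := by
      filter_upwards [hgθ, C.belief_never ⟨g, hg, hgθ⟩] with ω h1 h2 i
      rw [h1, h2]
    set M := auctionMechanism D C R (measurable_equilibriumBid hp0 hp1 hU)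
      (fun v hv => equilibriumBid_mem hp0 hp1 hU hv) hg with hM
    have hae := auctionMechanism_clicks (R := R) (measurable_equilibriumBid hp0 hp1 hU)
      (fun v hv => equilibriumBid_mem hp0 hp1 hU hv) hg hgb
    have hprofit : ∀ i v r, M.interimProfit i v r = interimProfit D C .firstPrice R
        (fun _ => C.never) (fun _ => equilibriumBid D p R U) i v (equilibriumBid D p R U r) := by
      intro i v r
      refine integral_congr_ae (ae_of_all _ fun w => ?_)
      simp only [expClicks, expPayment]
      rw [← integral_const_mul, ← integral_sub ((integrable_click _ _ _).const_mul v)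
        (integrable_collected hR.le _ _ _)]
      refine integral_congr_ae ?_
      filter_upwards [hae i (profile i r w)] with ω hω
      rw [hω.1, hω.2, map_profile fun _ => equilibriumBid D p R U]
    refine ⟨M, fun i v hv r hr => ?_, fun i v hv => ?_, ?_⟩
    · rw [hprofit, hprofit]
      exact E.best_reply i v hv _ (E.bid_nonneg i r hr)
    · rw [hprofit]
      exact E.interimProfit_nonneg hR.le i hv
    · refine integral_congr_ae (ae_of_all _ fun v => ?_)
      simp only [expPayment]
      rw [← integral_finsetSum _ fun i _ => integrable_collected hR.le _ _ i]
      refine integral_congr_ae ?_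
      filter_upwards [ae_all_iff.2 fun i => hae i v] with ω hω
      exact Finset.sum_congr rfl fun i _ => (hω i).2
  refine ⟨⟨equilibriumBid D p R U, equilibriumBid_strictMonoOn hp0 hp1 hU, E, hopt, hmem, ?_⟩,
    hrev ▸ hmem⟩
  rintro _ ⟨M, hIC, hIR, rfl⟩
  rw [hrev]
  exact M.revenue_le hIC hIR

theorem firstPriceImplements_of_virtualValue_eq_zero (hp0 : 0 < p) (hp1 : p < 1)
    (hC : C.Identifiable) (hD : D.Regular) (hR : R ∈ Ioo 0 D.vbar) (h0 : D.virtualValue R = 0) :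
    FirstPriceImplements D C R := by
  classical
  refine (firstPriceImplements hp0 hp1 hC hD (isParticipation_Ici hR) (fun v hv hvU => ?_)
    fun v hv hvU => ?_).1
  · rw [← h0]
    exact hD hv hR (not_le.1 hvU).le
  · rw [← h0]
    exact hD hR hv hvU

/-- Where the virtual value jumps over zero at the reserve, its sign at the reserve decides whether
that value participates. -/
theorem exists_firstPriceImplements (hp0 : 0 < p) (hp1 : p < 1)
    (hC : C.Identifiable) (hD : D.Regular) :
    (∃ R : ℝ, 0 ≤ R ∧ FirstPriceImplements D C R) ∧
      (∫ v, optSurplus D C v ∂D.jointLaw) ∈ attainableRevenues D C := by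
  classical
  obtain ⟨R, hR, hlow, hhigh⟩ := D.exists_sign_change hD
  have key : FirstPriceImplements D C R ∧
      (∫ v, optSurplus D C v ∂D.jointLaw) ∈ attainableRevenues D C := by
    rcases le_total (D.virtualValue R) 0 with h | h
    · refine firstPriceImplements hp0 hp1 hC hD (isParticipation_Ioi hR) (fun v hv hvU => ?_)
        fun v hv hvU => hhigh v hv hvU
      rcases (not_lt.1 fun hlt : R < v => hvU hlt).eq_or_lt with rfl | hlt
      · exact h
      · exact hlow v hv hlt
    · refine firstPriceImplements hp0 hp1 hC hD (isParticipation_Ici hR)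
        (fun v hv hvU => hlow v hv (not_le.1 hvU)) fun v hv hvU => ?_
      rcases (mem_Ici.1 hvU).eq_or_lt with rfl | hlt
      · exact h
      · exact hhigh v hv hlt
  exact ⟨⟨R, hR.1.le, key.1⟩, key.2⟩

end Game

/-! ### Events that do not separate two sample points -/

/-- The σ-algebra of the events that contain both or neither of two sample points. -/
@[reducible] def agreeSpace {Ω : Type*} (ω ω' : Ω) : MeasurableSpace Ω where
  MeasurableSet' s := ω ∈ s ↔ ω' ∈ s
  measurableSet_empty := Iff.rfl
  measurableSet_compl _ h := not_congr h
  measurableSet_iUnion f h := by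
    simp only [mem_iUnion]
    exact exists_congr h

section Path

variable {Ω : Type*} [mΩ : MeasurableSpace Ω] {p : ℝ} {C : Conversation Ω p}

theorem comap_le_agreeSpace {t : ℝ≥0} {ω ω' : Ω} (h : C.X t ω = C.X t ω') :
    MeasurableSpace.comap (C.X t) inferInstance ≤ agreeSpace ω ω' := by
  rintro _ ⟨s, -, rfl⟩
  change C.X t ω ∈ s ↔ C.X t ω' ∈ s
  rw [h]

/-- What is known at time `t` cannot separate two sample points with the same path up to `t`. -/
theorem mem_iff_of_path_eq {t : ℝ≥0} {ω ω' : Ω} (h : ∀ s ≤ t, C.X s ω = C.X s ω')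
    {B : Set Ω} (hB : MeasurableSet[C.filtration t] B) : ω ∈ B ↔ ω' ∈ B := by
  have hle : C.filtration t ≤ agreeSpace ω ω' :=
    iSup₂_le fun s hs => comap_le_agreeSpace (h s hs)
  exact hle B hB

theorem mem_iff_of_path_eq_top {ω ω' : Ω} (h : ∀ s, C.X s ω = C.X s ω')
    {B : Set Ω} (hB : MeasurableSet[C.infoLimit] B) : ω ∈ B ↔ ω' ∈ B := by
  have hle : C.infoLimit ≤ agreeSpace ω ω' :=
    iSup_le fun t => iSup₂_le fun s _ => comap_le_agreeSpace (h s)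
  exact hle B hB

theorem measurable_X_filtration (C : Conversation Ω p) (t : ℝ≥0) :
    Measurable[C.filtration t] (C.X t) :=
  (comap_measurable (C.X t)).mono (le_iSup₂_of_le t le_rfl le_rfl) le_rfl

/-- A stopping time either stops on both of two paths that have agreed so far, or on neither. -/
theorem stop_le_iff (τ : C.StoppingTime) {u : ℝ≥0} {ω ω' : Ω}
    (h : ∀ s ≤ u, C.X s ω = C.X s ω') : τ.1 ω ≤ u ↔ τ.1 ω' ≤ u :=
  mem_iff_of_path_eq h (τ.2 u)

/-- Two sample points with the same path until a stopping time stops cannot be separated by then. -/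
theorem mem_iff_of_stopped_path_eq (τ : C.StoppingTime) {ω ω' : Ω} (hτ : τ.1 ω = τ.1 ω')
    (h : ∀ s : ℝ≥0, (s : WithTop ℝ≥0) ≤ τ.1 ω' → C.X s ω = C.X s ω') {B : Set Ω}
    (hB : MeasurableSet[τ.2.measurableSpace] B) : ω ∈ B ↔ ω' ∈ B := by
  obtain ⟨hB1, hB2⟩ := (IsStoppingTime.measurableSet τ.2 B).1 hB
  cases ht : τ.1 ω' with
  | top => exact mem_iff_of_path_eq_top (fun s => h s (by rw [ht]; exact le_top)) hB1
  | coe t =>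
    have := mem_iff_of_path_eq (C := C) (t := t)
      (fun s hs => h s (by rw [ht]; exact_mod_cast hs)) (hB2 t)
    have e1 : τ.1 ω ≤ t := (hτ.trans ht).le
    exact ⟨fun h => (this.1 ⟨h, e1⟩).1, fun h => (this.2 ⟨h, ht.le⟩).1⟩

theorem belief_eq_of_stopped_path_eq (τ : C.StoppingTime) {ω ω' : Ω} (hτ : τ.1 ω = τ.1 ω')
    (h : ∀ s : ℝ≥0, (s : WithTop ℝ≥0) ≤ τ.1 ω' → C.X s ω = C.X s ω') (i : Fin 2) :
    C.belief τ i ω = C.belief τ i ω' := by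
  have hm : MeasurableSet[τ.2.measurableSpace] (C.belief τ i ⁻¹' {C.belief τ i ω'}) :=
    (stronglyMeasurable_condExp (m := τ.2.measurableSpace) (μ := C.P) (f := C.θ i)).measurable
      (measurableSet_singleton _)
  exact (mem_iff_of_stopped_path_eq τ hτ h hm).2 rfl

/-- Beliefs vanish on an observed event that rules out a good ad. -/
theorem belief_eq_zero_of_subset (τ : C.StoppingTime) (i : Fin 2) {N : Set Ω}
    (hN : MeasurableSet[τ.2.measurableSpace] N) (h : ∀ ω ∈ N, C.θ i ω = 0) :
    ∀ᵐ ω ∂C.P, ω ∈ N → C.belief τ i ω = 0 := by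
  have hN' := C.stopped_le τ N hN
  have h1 : ∫ ω in N, C.belief τ i ω ∂C.P = 0 := by
    rw [Conversation.belief, setIntegral_condExp (C.stopped_le τ) (C.integrable_θ i) hN]
    exact setIntegral_eq_zero_of_forall_eq_zero h
  have h2 : 0 ≤ᵐ[C.P.restrict N] C.belief τ i :=
    ae_restrict_of_ae ((C.belief_nonneg τ).mono fun ω hω => hω i)
  have h3 := (setIntegral_eq_zero_iff_of_nonneg_ae h2 integrable_condExp.integrableOn).1 h1
  exact (ae_restrict_iff' hN').1 h3

/-- Sequential rationality at time zero: no stopping time has a higher expected revenue. -/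
theorem SequentiallyRational.sum_expPayment_le {fmt : Format} {R : ℝ} (hR : 0 ≤ R)
    {b : Fin 2 → ℝ} {τ : C.StoppingTime} (h : SequentiallyRational C fmt R b τ)
    (σ : C.StoppingTime) :
    ∑ i, expPayment C fmt R σ b i ≤ ∑ i, expPayment C fmt R τ b i := by
  have h1 : ∀ τ : C.StoppingTime,
      ∑ i, expPayment C fmt R τ b i = ∫ ω, (C.P[revenueAt C fmt R τ b | C.filtration 0]) ω ∂C.P := by
    intro τ
    rw [integral_condExp (C.filtration.le 0)]
    exact (integral_finsetSum _ fun i _ => integrable_collected hR τ b i).symm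
  rw [h1, h1]
  refine integral_mono_ae integrable_condExp integrable_condExp ?_
  filter_upwards [h 0 σ fun ω => by simp] with ω hω
  exact hω (by simp)

end Path

/-! ### Beliefs in the bad-news model -/

/-- No bad news about an ad up to and including time `s`. -/
def Quiet (s : WithTop ℝ≥0) (z : Bool × ℝ) : Prop :=
  z.1 = true ∨ s < (z.2.toNNReal : WithTop ℝ≥0)

/-- The probability that there is no bad news about an ad up to time `s`. -/
def quietProb (p lam : ℝ) (s : WithTop ℝ≥0) : ℝ :=
  ((bernoulliLaw p).prod (expMeasure lam)).real {z | Quiet s z}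

theorem measurableSet_quiet (s : WithTop ℝ≥0) : MeasurableSet {z | Quiet s z} := by
  have h : MeasurableSet {z : Bool × ℝ | s < (z.2.toNNReal : WithTop ℝ≥0)} := by
    rcases eq_or_ne s ⊤ with rfl | hs
    · simp only [not_top_lt]
      exact MeasurableSet.const False
    obtain ⟨s, rfl⟩ := WithTop.ne_top_iff_exists.1 hs
    have : {z : Bool × ℝ | ((s : ℝ≥0) : WithTop ℝ≥0) < (z.2.toNNReal : WithTop ℝ≥0)}
        = {z | (s : ℝ) < z.2} := by
      ext z
      simp only [mem_ofPred_eq, WithTop.coe_lt_coe, Real.lt_toNNReal_iff_coe_lt]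
    rw [this]
    exact measurableSet_lt measurable_const measurable_snd
  exact (measurable_fst (measurableSet_singleton true)).union h

theorem badNewsProcess_eq_zero_iff {t : ℝ≥0} {ω : BadNewsSpace} {i : Fin 2} :
    badNewsProcess t ω i = 0 ↔ Quiet t (ω i) := by
  unfold badNewsProcess Quiet
  rw [WithTop.coe_lt_coe, Real.lt_toNNReal_iff_coe_lt]
  cases (ω i).1 <;> simp

theorem Quiet.mono {s t : WithTop ℝ≥0} (hst : s ≤ t) {z : Bool × ℝ} (h : Quiet t z) : Quiet s z :=
  h.imp id hst.trans_lt

theorem quiet_top_iff {z : Bool × ℝ} : Quiet ⊤ z ↔ z.1 = true :=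
  ⟨fun h => h.resolve_right not_top_lt, Or.inl⟩

theorem quiet_top_iff_forall {z : Bool × ℝ} :
    Quiet ⊤ z ↔ ∀ n : ℕ, Quiet ((n : ℝ≥0) : WithTop ℝ≥0) z := by
  refine ⟨fun h n => h.mono le_top, fun h => ?_⟩
  obtain ⟨n, hn⟩ := exists_nat_ge z.2.toNNReal
  exact Or.inl ((h n).resolve_right fun hlt => (WithTop.coe_lt_coe.1 hlt).not_ge hn)

section BadNews

variable {p lam : ℝ} {hp0 : 0 < p} {hp1 : p < 1} {hl : 0 < lam}

/-- A sample point at which no bad news ever arrives. -/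
def quietPoint : BadNewsSpace := fun _ => (true, 0)

theorem path_eq_quietPoint {s : WithTop ℝ≥0} {ω : BadNewsSpace} (h : ∀ i, Quiet s (ω i))
    {u : ℝ≥0} (hu : (u : WithTop ℝ≥0) ≤ s) :
    (badNews p lam hp0 hp1 hl).X u ω = (badNews p lam hp0 hp1 hl).X u quietPoint := by
  funext i
  exact (badNewsProcess_eq_zero_iff.2 ((h i).mono hu)).trans
    ((badNewsProcess_eq_zero_iff (t := u) (ω := quietPoint) (i := i)).2 (Or.inl rfl)).symm

variable (τ : (badNews p lam hp0 hp1 hl).StoppingTime)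

/-- Before any bad news a stopping time is deterministic. -/
theorem stop_eq_of_quiet {ω : BadNewsSpace} (h : ∀ i, Quiet (τ.1 quietPoint) (ω i)) :
    τ.1 ω = τ.1 quietPoint := by
  have key : ∀ u : ℝ≥0, (u : WithTop ℝ≥0) ≤ τ.1 quietPoint →
      (τ.1 ω ≤ u ↔ τ.1 quietPoint ≤ u) := fun u hu =>
    stop_le_iff τ fun s hs => path_eq_quietPoint h ((WithTop.coe_le_coe.2 hs).trans hu)
  rcases lt_trichotomy (τ.1 ω) (τ.1 quietPoint) with hlt | heq | hgt
  · obtain ⟨u, hu⟩ := WithTop.ne_top_iff_exists.1 hlt.ne_top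
    have := (key u (hu ▸ hlt.le)).1 hu.ge
    exact absurd (hu ▸ this) hlt.not_ge
  · exact heq
  · obtain ⟨u, hu⟩ := WithTop.ne_top_iff_exists.1 hgt.ne_top
    have := (key u hu.le).2 hu.ge
    exact absurd (hu ▸ this) hgt.not_ge

/-- Bad news that arrives before the deterministic time at which a quiet auction would be run
arrives before the auction is run. -/
theorem news_le_stop {ω : BadNewsSpace} {i : Fin 2} (hgood : (ω i).1 = true)
    (hnews : ¬ Quiet (τ.1 quietPoint) (ω i.rev)) :
    ((ω i.rev).2.toNNReal : WithTop ℝ≥0) ≤ τ.1 ω := by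
  by_contra! hc
  obtain ⟨u, hu⟩ := WithTop.ne_top_iff_exists.1 hc.ne_top
  have hq : ∀ j, Quiet u (ω j) := fun j => by
    rcases eq_or_eq_rev i j with rfl | rfl
    · exact Or.inl hgood
    · exact Or.inr (hu ▸ hc)
  have := (stop_le_iff τ fun s hs => path_eq_quietPoint hq (WithTop.coe_le_coe.2 hs)).1 hu.ge
  exact hnews (Or.inr (this.trans_lt (hu ▸ hc)))

/-- The event that there is no bad news until the auction is run. -/
def quietEvent : Set BadNewsSpace := {ω | ∀ i, Quiet (τ.1 quietPoint) (ω i)}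

theorem measurableSet_quiet_filtration (t : ℝ≥0) (i : Fin 2) :
    MeasurableSet[(badNews p lam hp0 hp1 hl).filtration t] {ω : BadNewsSpace | Quiet t (ω i)} := by
  have h : {ω : BadNewsSpace | Quiet t (ω i)}
      = (badNews p lam hp0 hp1 hl).X t ⁻¹' {x : Fin 2 → ℝ | x i = 0} := by
    ext ω
    exact badNewsProcess_eq_zero_iff.symm
  rw [h]
  exact measurable_X_filtration (badNews p lam hp0 hp1 hl) t
    (measurable_pi_apply (X := fun _ : Fin 2 => ℝ) i (measurableSet_singleton 0))

theorem measurableSet_good_infoLimit (i : Fin 2) :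
    MeasurableSet[(badNews p lam hp0 hp1 hl).infoLimit] {ω : BadNewsSpace | (ω i).1 = true} := by
  have h : {ω : BadNewsSpace | (ω i).1 = true}
      = ⋂ n : ℕ, {ω : BadNewsSpace | Quiet ((n : ℝ≥0) : WithTop ℝ≥0) (ω i)} := by
    ext ω
    simp only [mem_ofPred_eq, mem_iInter, ← quiet_top_iff_forall, quiet_top_iff]
  rw [h]
  exact MeasurableSet.iInter fun n => le_iSup (badNews p lam hp0 hp1 hl).filtration (n : ℝ≥0) _
    (measurableSet_quiet_filtration _ i)

theorem badNews_identifiable : (badNews p lam hp0 hp1 hl).Identifiable := by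
  refine ⟨fun ω i => badNewsType i ω, ?_, ae_of_all _ fun ω i => rfl⟩
  refine @measurable_pi_lambda _ _ _ (_) _ _ fun i => ?_
  exact @Measurable.ite _ _ (_) _ _ _ _ _ (measurableSet_good_infoLimit i)
    (@measurable_const _ _ _ (_) _) (@measurable_const _ _ _ (_) _)

theorem measurableSet_quietEvent : MeasurableSet[τ.2.measurableSpace] (quietEvent τ) := by
  have hA : ∀ u : ℝ≥0, τ.1 quietPoint = u →
      MeasurableSet[(badNews p lam hp0 hp1 hl).filtration u] (quietEvent τ) := by
    intro u hu
    have : quietEvent τ = ⋂ i, {ω : BadNewsSpace | Quiet u (ω i)} := by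
      ext ω
      simp only [quietEvent, hu, mem_ofPred_eq, mem_iInter]
    rw [this]
    exact MeasurableSet.iInter fun i => measurableSet_quiet_filtration u i
  refine (IsStoppingTime.measurableSet τ.2 _).2 ⟨?_, fun u => ?_⟩
  · cases ht : τ.1 quietPoint with
    | top =>
      have : quietEvent τ = ⋂ i, {ω : BadNewsSpace | (ω i).1 = true} := by
        ext ω
        simp only [quietEvent, ht, mem_ofPred_eq, mem_iInter, quiet_top_iff]
      rw [this]
      exact MeasurableSet.iInter fun i => measurableSet_good_infoLimit i
    | coe u => exact le_iSup (badNews p lam hp0 hp1 hl).filtration u _ (hA u ht)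
  · by_cases hu : τ.1 quietPoint ≤ u
    · obtain ⟨s, hs⟩ := WithTop.ne_top_iff_exists.1 (hu.trans_lt (WithTop.coe_lt_top u)).ne
      have h1 : quietEvent τ ∩ {ω | τ.1 ω ≤ u} = quietEvent τ :=
        inter_eq_left.2 fun ω hω => (stop_eq_of_quiet τ hω).trans_le hu
      rw [h1]
      exact (badNews p lam hp0 hp1 hl).filtration.mono (WithTop.coe_le_coe.1 (hs ▸ hu)) _
        (hA s hs.symm)
    · have h1 : quietEvent τ ∩ {ω | τ.1 ω ≤ u} = ∅ := by
        ext ω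
        simp only [mem_inter_iff, mem_ofPred_eq, mem_empty_iff_false, iff_false, not_and]
        exact fun hω h => hu ((stop_eq_of_quiet τ hω).symm.trans_le h)
      rw [h1]
      exact @MeasurableSet.empty _ ((badNews p lam hp0 hp1 hl).filtration u)

/-- The time at which bad news about ad `i` arrives. -/
def newsTime (i : Fin 2) (ω : BadNewsSpace) : WithTop ℝ≥0 :=
  if (ω i).1 = true then ⊤ else ((ω i).2.toNNReal : WithTop ℝ≥0)

theorem isStoppingTime_newsTime (i : Fin 2) :
    IsStoppingTime (badNews p lam hp0 hp1 hl).filtration (newsTime i) := by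
  intro t
  have h : {ω | newsTime i ω ≤ t} = {ω : BadNewsSpace | Quiet t (ω i)}ᶜ := by
    ext ω
    simp only [newsTime, Quiet, mem_ofPred_eq, mem_compl_iff, not_or, not_lt]
    split_ifs with h
    · simpa [h] using (WithTop.coe_lt_top t).not_ge
    · simp [h]
  rw [h]
  exact (measurableSet_quiet_filtration t i).compl

/-- Bad news about an ad brings the belief down to zero. -/
theorem belief_eq_zero_of_news (i : Fin 2) : ∀ᵐ ω ∂(badNews p lam hp0 hp1 hl).P,
    (ω i).1 = false → ((ω i).2.toNNReal : WithTop ℝ≥0) ≤ τ.1 ω →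
      (badNews p lam hp0 hp1 hl).belief τ i ω = 0 := by
  -- Truncating at `n` excludes the good ads, whose news never arrives, also where `τ = ∞`.
  have h : ∀ n : ℕ, ∀ᵐ ω ∂(badNews p lam hp0 hp1 hl).P,
      newsTime i ω ≤ min (τ.1 ω) ((n : ℝ≥0) : WithTop ℝ≥0) →
        (badNews p lam hp0 hp1 hl).belief τ i ω = 0 := by
    intro n
    have hmin := τ.2.min_const (n : ℝ≥0)
    have hle : hmin.measurableSpace ≤ τ.2.measurableSpace :=
      IsStoppingTime.measurableSpace_mono _ _ fun ω => min_le_left _ _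
    refine belief_eq_zero_of_subset τ i (hle _
      (IsStoppingTime.measurableSet_stopping_time_le (isStoppingTime_newsTime i) hmin)) ?_
    intro ω hω
    have h1 : newsTime i ω ≤ ((n : ℝ≥0) : WithTop ℝ≥0) := le_trans hω (min_le_right _ _)
    change badNewsType i ω = 0
    unfold newsTime at h1
    unfold badNewsType
    split_ifs at h1 ⊢ with h2
    · exact absurd h1 (WithTop.coe_lt_top _).not_ge
    · rfl
  filter_upwards [ae_all_iff.2 h] with ω hω hbad hnews
  obtain ⟨n, hn⟩ := exists_nat_ge (ω i).2.toNNReal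
  have h1 : newsTime i ω = ((ω i).2.toNNReal : WithTop ℝ≥0) :=
    if_neg (by simp [hbad])
  exact hω n (le_min (h1.trans_le hnews) (h1.trans_le (WithTop.coe_le_coe.2 hn)))

/-- The indicator of the absence of bad news about ad `i` until a quiet auction is run. -/
def quietInd (i : Fin 2) (ω : BadNewsSpace) : ℝ :=
  {z | Quiet (τ.1 quietPoint) z}.indicator (fun _ => (1 : ℝ)) (ω i)

theorem integral_type_mul_quiet (i : Fin 2) :
    ∫ ω, badNewsType i ω * quietInd τ i.rev ω ∂badNewsLaw p lam
      = p * quietProb p lam (τ.1 quietPoint) := by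
  have := isProb_bernoulliLaw hp0 hp1
  have := isProbabilityMeasure_expMeasure hl
  set F : Fin 2 → Bool × ℝ → ℝ := fun j => if j = i then fun z => if z.1 then 1 else 0
    else {z | Quiet (τ.1 quietPoint) z}.indicator (fun _ => (1 : ℝ)) with hF
  have hprod : ∀ g : Fin 2 → ℝ, ∏ j, g j = g i * g i.rev := fun g => by
    fin_cases i
    · exact Fin.prod_univ_two g
    · exact (Fin.prod_univ_two g).trans (mul_comm _ _)
  have h1 := integral_fintype_prod_eq_prod (𝕜 := ℝ) (ι := Fin 2) F
    (μ := fun _ => (bernoulliLaw p).prod (expMeasure lam))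
  simp only [hprod] at h1
  have hFi : F i = fun z => if z.1 then 1 else 0 := by simp [hF]
  have hFr : F i.rev = {z | Quiet (τ.1 quietPoint) z}.indicator (fun _ => (1 : ℝ)) := by
    simp [hF, rev_ne]
  rw [hFi, hFr, integral_indicator_const _ (measurableSet_quiet _)] at h1
  have h2 : ∫ z, (if z.1 then (1 : ℝ) else 0) ∂(bernoulliLaw p).prod (expMeasure lam) = p := by
    have h3 := integral_θ hp0.le (badNews p lam hp0 hp1 hl) i
    refine Eq.trans ?_ h3
    rw [← (measurePreserving_eval (fun _ : Fin 2 => (bernoulliLaw p).prod (expMeasure lam))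
      i).map_eq]
    exact integral_map (measurable_pi_apply i).aemeasurable
      measurable_boolIndicator.aestronglyMeasurable
  rw [h2, smul_eq_mul, mul_one] at h1
  exact h1

/-- In the bad-news model every stopping time has binary news: on the event without news the
beliefs in the two ads are equal by symmetry, since that event is an atom of the information at the
stopping time. -/
theorem binaryNews_badNews : BinaryNews (badNews p lam hp0 hp1 hl) τ
    (quietProb p lam (τ.1 quietPoint)) := by
  have hQ01 : ∀ i ω, quietInd τ i ω = 0 ∨ quietInd τ i ω = 1 := fun i ω => by
    unfold quietInd
    by_cases h : ω i ∈ {z | Quiet (τ.1 quietPoint) z}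
    · exact Or.inr (indicator_of_mem h _)
    · exact Or.inl (indicator_of_notMem h _)
  have hint := fun i => integral_type_mul_quiet (hp0 := hp0) (hp1 := hp1) (hl := hl) τ i
  refine ⟨quietInd τ, fun i => ?_, hQ01, hint, ?_⟩
  · exact (measurable_const.indicator (measurableSet_quiet _)).comp (measurable_pi_apply i)
  have hAm : MeasurableSet (quietEvent τ) :=
    (badNews p lam hp0 hp1 hl).stopped_le τ _ (measurableSet_quietEvent τ)
  have hconst : ∀ i, ∀ ω ∈ quietEvent τ,
      (badNews p lam hp0 hp1 hl).belief τ i ω =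
        (badNews p lam hp0 hp1 hl).belief τ i quietPoint :=
    fun i ω hω => belief_eq_of_stopped_path_eq τ (stop_eq_of_quiet τ hω)
      (fun s hs => path_eq_quietPoint hω hs) i
  have hmass : ∀ i, (badNews p lam hp0 hp1 hl).P.real (quietEvent τ) *
      (badNews p lam hp0 hp1 hl).belief τ i quietPoint
      = p * quietProb p lam (τ.1 quietPoint) := by
    intro i
    have h1 : ∫ ω in quietEvent τ, (badNews p lam hp0 hp1 hl).belief τ i ω
          ∂(badNews p lam hp0 hp1 hl).P
        = (badNews p lam hp0 hp1 hl).P.real (quietEvent τ) *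
          (badNews p lam hp0 hp1 hl).belief τ i quietPoint := by
      rw [setIntegral_congr_fun hAm (hconst i), setIntegral_const, smul_eq_mul]
    have h2 : ∫ ω in quietEvent τ, (badNews p lam hp0 hp1 hl).belief τ i ω
          ∂(badNews p lam hp0 hp1 hl).P =
        ∫ ω in quietEvent τ, (badNews p lam hp0 hp1 hl).θ i ω
          ∂(badNews p lam hp0 hp1 hl).P := by
      rw [Conversation.belief, setIntegral_condExp ((badNews p lam hp0 hp1 hl).stopped_le τ)
        ((badNews p lam hp0 hp1 hl).integrable_θ i)
        (measurableSet_quietEvent τ)]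
    rw [← h1, h2, ← integral_indicator hAm, ← hint i]
    refine integral_congr_ae (ae_of_all _ fun ω => ?_)
    change (quietEvent τ).indicator (badNewsType i) ω = badNewsType i ω * quietInd τ i.rev ω
    by_cases hg : (ω i).1 = true
    · have h3 : badNewsType i ω = 1 := by simp [badNewsType, hg]
      by_cases hr : Quiet (τ.1 quietPoint) (ω i.rev)
      · have hω : ω ∈ quietEvent τ := fun j => by
          rcases eq_or_eq_rev i j with rfl | rfl
          · exact Or.inl hg
          · exact hr
        rw [indicator_of_mem hω, quietInd,
          indicator_of_mem (show ω i.rev ∈ {z | Quiet (τ.1 quietPoint) z} from hr), mul_one]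
      · have hω : ω ∉ quietEvent τ := fun h => hr (h _)
        rw [indicator_of_notMem hω, quietInd,
          indicator_of_notMem (show ω i.rev ∉ {z | Quiet (τ.1 quietPoint) z} from hr), mul_zero]
    · have h3 : badNewsType i ω = 0 := by simp [badNewsType, hg]
      simp [h3]
  have heq : ∀ᵐ ω ∂(badNews p lam hp0 hp1 hl).P,
      ω ∈ quietEvent τ → ∀ i j, (badNews p lam hp0 hp1 hl).belief τ i ω =
        (badNews p lam hp0 hp1 hl).belief τ j ω := by
    by_cases h0 : (badNews p lam hp0 hp1 hl).P.real (quietEvent τ) = 0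
    · have h1 : ∀ᵐ ω ∂(badNews p lam hp0 hp1 hl).P, ω ∉ quietEvent τ :=
        measure_eq_zero_iff_ae_notMem.1 ((measureReal_eq_zero_iff).1 h0)
      exact h1.mono fun ω h h' => absurd h' h
    · refine ae_of_all _ fun ω hω i j => ?_
      rw [hconst i ω hω, hconst j ω hω]
      exact mul_left_cancel₀ h0 ((hmass i).trans (hmass j).symm)
  filter_upwards [ae_all_iff.2 fun i => (badNews p lam hp0 hp1 hl).belief_pos τ i, heq,
    ae_all_iff.2 fun i => belief_eq_zero_of_news τ i] with ω hpos hω hnews i hi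
  refine ⟨hpos i hi, ?_⟩
  have hgood : (ω i).1 = true := by
    by_contra hc
    have : badNewsType i ω = 1 := hi
    simp [badNewsType, hc] at this
  by_cases hr : Quiet (τ.1 quietPoint) (ω i.rev)
  · have hA : ω ∈ quietEvent τ := fun j => by
      rcases eq_or_eq_rev i j with rfl | rfl
      · exact Or.inl hgood
      · exact hr
    rw [quietInd, indicator_of_mem (show ω i.rev ∈ {z | Quiet (τ.1 quietPoint) z} from hr),
      one_mul]
    exact hω hA _ _
  · rw [quietInd, indicator_of_notMem (show ω i.rev ∉ {z | Quiet (τ.1 quietPoint) z} from hr),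
      zero_mul]
    exact hnews i.rev (by simpa using fun h => hr (Or.inl h)) (news_le_stop τ hgood hr)

end BadNews

section QuietProb

variable {p lam : ℝ}

theorem isProbabilityMeasure_adLaw (hp0 : 0 < p) (hp1 : p < 1) (hl : 0 < lam) :
    IsProbabilityMeasure ((bernoulliLaw p).prod (expMeasure lam)) := by
  have := isProb_bernoulliLaw hp0 hp1
  have := isProbabilityMeasure_expMeasure hl
  infer_instance

theorem quietProb_le_one (hp0 : 0 < p) (hp1 : p < 1) (hl : 0 < lam) (s : WithTop ℝ≥0) :
    quietProb p lam s ≤ 1 := by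
  have := isProbabilityMeasure_adLaw hp0 hp1 hl
  exact measureReal_le_one

theorem quietProb_top (hp0 : 0 < p) (hl : 0 < lam) : quietProb p lam ⊤ = p := by
  have := isProbabilityMeasure_expMeasure hl
  have h : {z : Bool × ℝ | Quiet ⊤ z} = {true} ×ˢ univ := by
    ext z
    simp [quiet_top_iff]
  rw [quietProb, h, measureReal_def, Measure.prod_prod]
  simp [bernoulliLaw, hp0.le]

theorem le_quietProb (hp0 : 0 < p) (hp1 : p < 1) (hl : 0 < lam) (s : WithTop ℝ≥0) :
    p ≤ quietProb p lam s := by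
  have := isProbabilityMeasure_adLaw hp0 hp1 hl
  calc p = quietProb p lam ⊤ := (quietProb_top hp0 hl).symm
    _ ≤ _ := measureReal_mono fun z hz => Quiet.mono le_top hz

theorem quietProb_zero (hp0 : 0 < p) (hp1 : p < 1) (hl : 0 < lam) :
    quietProb p lam ((0 : ℝ≥0) : WithTop ℝ≥0) = 1 := by
  have := isProb_bernoulliLaw hp0 hp1
  have := isProbabilityMeasure_expMeasure hl
  have h1 : ∀ᵐ c ∂expMeasure lam, 0 < c := by
    have h2 : expMeasure lam (Iic 0) = 0 := by
      have h3 := cdf_expMeasure_eq hl 0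
      rw [if_pos le_rfl, mul_zero, neg_zero, Real.exp_zero, sub_self, cdf_eq_real] at h3
      exact (measureReal_eq_zero_iff).1 h3
    rw [ae_iff]
    simpa [Iic] using h2
  have h2 : ∀ᵐ z ∂(bernoulliLaw p).prod (expMeasure lam), 0 < z.2 :=
    Measure.quasiMeasurePreserving_snd.ae h1
  have h3 : {z | Quiet ((0 : ℝ≥0) : WithTop ℝ≥0) z} =ᵐ[(bernoulliLaw p).prod (expMeasure lam)]
      univ := by
    filter_upwards [h2] with z hz
    refine propext ⟨fun _ => trivial, fun _ => Or.inr ?_⟩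
    exact WithTop.coe_lt_coe.2 (Real.toNNReal_pos.2 hz)
  rw [quietProb, measureReal_congr h3]
  have := isProbabilityMeasure_adLaw hp0 hp1 hl
  exact probReal_univ

end QuietProb

/-! ### Clicks under an optimal allocation -/

section Optimal

variable {Ω : Type*} [mΩ : MeasurableSpace Ω] {p : ℝ} {C : Conversation Ω p}

/-- If the virtual value of `i` is positive and the higher one, an optimal allocation gives `i` all
clicks of users who like ad `i`, and its opponent, if the virtual value there is positive too, those
of users who like the other ad only. -/
theorem optimal_click {D : ValueDist} {v θ x : Fin 2 → ℝ} (hθ : ∀ i, θ i = 0 ∨ θ i = 1)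
    (hopt : IsOptimalAllocation D v θ x) {i : Fin 2} (h0 : 0 < D.virtualValue (v i))
    (h1 : D.virtualValue (v i.rev) < D.virtualValue (v i)) :
    θ i * x i = θ i ∧ (0 < D.virtualValue (v i.rev) →
      θ i.rev * x i.rev = θ i.rev - θ i * θ i.rev) := by
  have htop := (isOptimalAllocation_iff hopt.1 hopt.2.1).1 hopt
  have hi := le_topVirtual D v θ i
  have hr := le_topVirtual D v θ i.rev
  rw [← htop, sum_eq_add_rev i] at hi hr
  have hs := hopt.2.1
  rw [sum_eq_add_rev i] at hs
  have hxi := hopt.1 i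
  have hxr := hopt.1 i.rev
  set a := D.virtualValue (v i)
  set c := D.virtualValue (v i.rev)
  rcases hθ i with hti | hti <;> rcases hθ i.rev with htr | htr <;>
    simp only [hti, htr, zero_mul, mul_zero, one_mul, zero_add, add_zero, sub_zero, true_and,
      sub_self, implies_true, and_true] at hi hr ⊢
  · intro hc
    nlinarith
  · nlinarith
  · have hxi1 : x i = 1 := by
      rcases hxr.eq_or_lt with h | h <;> nlinarith
    exact ⟨hxi1, fun _ => by linarith⟩

theorem optimal_expClicks (hp0 : 0 ≤ p) {D : ValueDist} {v : Fin 2 → ℝ} {R : ℝ}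
    {τ : C.StoppingTime} {b : Fin 2 → ℝ}
    (hopt : ∀ᵐ ω ∂C.P, IsOptimalAllocation D v (fun i => C.θ i ω) (allocation C R τ b ω))
    {i : Fin 2} (h0 : 0 < D.virtualValue (v i))
    (h1 : D.virtualValue (v i.rev) < D.virtualValue (v i)) :
    expClicks C R τ b i = p ∧
      (0 < D.virtualValue (v i.rev) → expClicks C R τ b i.rev = p * (1 - p)) := by
  have key := hopt.mono fun ω hω => optimal_click (fun i => C.θ_zero_or_one i ω) hω h0 h1
  constructor
  · rw [expClicks, integral_congr_ae (key.mono fun ω h => h.1), integral_θ hp0]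
  · intro h2
    have hind := (C.θ_indep.indepFun (rev_ne i).symm).integral_mul_eq_mul_integral
      (C.measurable_θ i).aestronglyMeasurable (C.measurable_θ i.rev).aestronglyMeasurable
    rw [integral_θ hp0, integral_θ hp0] at hind
    have hi : Integrable (C.θ i * C.θ i.rev) C.P :=
      (C.integrable_θ i.rev).bdd_mul (c := 1) (C.measurable_θ i).aestronglyMeasurable
        (ae_of_all _ fun ω => by
          rw [Real.norm_eq_abs, abs_of_nonneg (C.θ_nonneg i ω)]; exact C.θ_le_one i ω)
    have h3 : expClicks C R τ b i.rev = ∫ ω, C.θ i.rev ω - (C.θ i * C.θ i.rev) ω ∂C.P :=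
      integral_congr_ae (key.mono fun ω h => h.2 h2)
    rw [h3, integral_sub (C.integrable_θ _) hi, hind, integral_θ hp0]
    ring

/-! ### The second-price auction with binary news -/

section SecondPrice

variable {R y : ℝ} {τ : C.StoppingTime} {b : Fin 2 → ℝ} {i : Fin 2}

theorem BinaryNews.secondPrice_high (hp0 : 0 ≤ p) (h : BinaryNews C τ y) (hR : 0 ≤ R)
    (hlo : R ≤ b i.rev) (hhi : b i.rev < b i) :
    expClicks C R τ b i = p ∧
      expPayment C .secondPrice R τ b i = p * (y * b i.rev + (1 - y) * R) := by
  have hi : ¬ b i < R := (hlo.trans hhi.le).not_gt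
  have hpos : 0 < b i := (hR.trans hlo).trans_lt hhi
  have h1 : share R (profile i 1 1) b i = 1 := by simp [share, hi, hhi]
  have h2 : share R (profile i 1 0) b i = 1 := by simp [share, hi, hpos]
  rw [h.expClicks_eq hp0, h.expPayment_eq hp0, h1, h2]
  simp only [price, hlo.not_gt, if_false, profile_self, profile_rev, mul_one, div_one, mul_zero,
    max_eq_right hlo, max_eq_left hR, one_mul]
  constructor <;> ring

theorem BinaryNews.secondPrice_low (hp0 : 0 ≤ p) (h : BinaryNews C τ y) (hR : 0 ≤ R)
    (hlo : R ≤ b i.rev) (hhi : b i.rev < b i) (hpos : 0 < b i.rev) :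
    expClicks C R τ b i.rev = p * (1 - y) ∧
      expPayment C .secondPrice R τ b i.rev = p * (1 - y) * R := by
  have hi : ¬ b i < R := (hlo.trans hhi.le).not_gt
  have h1 : share R (profile i.rev 1 1) b i.rev = 0 := by
    have hp : ∀ j, profile i.rev 1 1 j = 1 := fun j => by simp [profile]
    simp [share, hlo.not_gt, hp, hi, hhi.not_gt, hhi.ne']
  have hp2 : profile i.rev 1 0 i = 0 := by simp [profile, (rev_ne i).symm]
  have h2 : share R (profile i.rev 1 0) b i.rev = 1 := by
    simp [share, hlo.not_gt, hp2, hpos]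
  rw [h.expClicks_eq hp0, h.expPayment_eq hp0, h1, h2]
  simp only [price, Fin.rev_rev, hi, if_false, hp2, mul_zero, zero_div, max_eq_left hR]
  constructor <;> ring

theorem BinaryNews.secondPrice_solo (hp0 : 0 ≤ p) (h : BinaryNews C τ y)
    (hlo : b i.rev < R) (hhi : R ≤ b i) :
    expClicks C R τ b i = p ∧ expPayment C .secondPrice R τ b i = p * R := by
  have h1 : ∀ m, share R m b i = 1 := fun m => by simp [share, hhi.not_gt, hlo]
  rw [h.expClicks_eq hp0, h.expPayment_eq hp0, h1, h1]
  simp only [price, hlo, if_true]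
  constructor <;> ring

/-- Winning all clicks requires the higher bid. -/
theorem BinaryNews.lt_of_expClicks_eq (hp0 : 0 < p) (hy : 0 < y) (hy1 : y ≤ 1)
    (h : BinaryNews C τ y) (hK : expClicks C R τ b i = p) : R ≤ b i ∧ b i.rev < b i := by
  have hRi : R ≤ b i := by
    by_contra! hc
    rw [expClicks_eq_zero τ hc] at hK
    exact hp0.ne hK
  refine ⟨hRi, ?_⟩
  by_contra! hc
  have hs : share R (profile i 1 1) b i ≤ 1 / 2 := by
    simp only [share, profile_self, profile_rev, mul_one, hRi.not_gt, (hRi.trans hc).not_gt,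
      hc.not_gt, if_false, or_self]
    split_ifs <;> norm_num
  rw [h.expClicks_eq hp0.le] at hK
  have h2 := share_le_one R (profile i 1 0) b i
  have h3 : p * y * share R (profile i 1 1) b i ≤ p * y * (1 / 2) :=
    mul_le_mul_of_nonneg_left hs (by positivity)
  have h4 : p * (1 - y) * share R (profile i 1 0) b i ≤ p * (1 - y) * 1 :=
    mul_le_mul_of_nonneg_left h2 (mul_nonneg hp0.le (by linarith))
  have h5 : 0 < p * y := by positivity
  linarith

/-- If the lower bid gets all the clicks that an optimal allocation assigns to it, it is positive
and the auctioneer waits for all the news. -/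
theorem BinaryNews.eq_of_expClicks_low (hp0 : 0 < p) (hp1 : p < 1) (hR : 0 ≤ R) (hy : p ≤ y)
    (h : BinaryNews C τ y) (hhi : b i.rev < b i)
    (hK : expClicks C R τ b i.rev = p * (1 - p)) : R ≤ b i.rev ∧ 0 < b i.rev ∧ y = p := by
  have hpp : 0 < p * (1 - p) := mul_pos hp0 (by linarith)
  have hlo : R ≤ b i.rev := by
    by_contra! hc
    rw [expClicks_eq_zero τ hc] at hK
    exact hpp.ne hK
  have hpos : 0 < b i.rev := by
    refine lt_of_le_of_ne (hR.trans hlo) fun h0 => ?_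
    have hi : ¬ b i < R := (hlo.trans hhi.le).not_gt
    have h1 : share R (profile i.rev 1 1) b i.rev = 0 := by
      have hp : ∀ j, profile i.rev 1 1 j = 1 := fun j => by simp [profile]
      simp [share, hlo.not_gt, hp, hi, hhi.not_gt, hhi.ne']
    have hp2 : profile i.rev 1 0 i = 0 := by simp [profile, (rev_ne i).symm]
    -- The bid zero ties with an ad of quality zero.
    have h2 : share R (profile i.rev 1 0) b i.rev = 1 / 2 := by
      simp [share, hp2, ← h0, hi]
      grind
    rw [h.expClicks_eq hp0.le, h1, h2] at hK
    nlinarith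
  refine ⟨hlo, hpos, ?_⟩
  rw [(h.secondPrice_low hp0.le hR hlo hhi hpos).1] at hK
  have := mul_left_cancel₀ hp0.ne' hK
  linarith

end SecondPrice

end Optimal

/-! ### The timing of the second-price auction in the bad-news model -/

section BadNews

variable {p lam : ℝ} {hp0 : 0 < p} {hp1 : p < 1} {hl : 0 < lam}

/-- The stopping time that runs the auction at once. -/
def atOnce (p lam : ℝ) (hp0 : 0 < p) (hp1 : p < 1) (hl : 0 < lam) :
    (badNews p lam hp0 hp1 hl).StoppingTime :=
  ⟨fun _ => ((0 : ℝ≥0) : WithTop ℝ≥0), isStoppingTime_const _ 0⟩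

/-- The auctioneer waits for all news if the lower bid is less than twice the reserve, and sells at
once if it is higher: without bad news a sale now yields the lower bid, while waiting trades it
against the reserve in the two states in which exactly one ad turns out to be bad. -/
theorem quietProb_of_sequentiallyRational {R : ℝ} {b : Fin 2 → ℝ} {i : Fin 2} (hR : 0 ≤ R)
    (hlo : R ≤ b i.rev) (hhi : b i.rev < b i) (hpos : 0 < b i.rev)
    {τ : (badNews p lam hp0 hp1 hl).StoppingTime}
    (h : SequentiallyRational (badNews p lam hp0 hp1 hl) .secondPrice R b τ) :
    (b i.rev < 2 * R → quietProb p lam (τ.1 quietPoint) = p) ∧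
      (2 * R < b i.rev → quietProb p lam (τ.1 quietPoint) = 1) := by
  have hrev : ∀ σ : (badNews p lam hp0 hp1 hl).StoppingTime,
      ∑ j, expPayment (badNews p lam hp0 hp1 hl) .secondPrice R σ b j
        = p * (2 * R + quietProb p lam (σ.1 quietPoint) * (b i.rev - 2 * R)) := by
    intro σ
    have hσ := binaryNews_badNews σ
    rw [sum_eq_add_rev i, (hσ.secondPrice_high hp0.le hR hlo hhi).2,
      (hσ.secondPrice_low hp0.le hR hlo hhi hpos).2]
    ring
  have h1 := h.sum_expPayment_le hR (badNews p lam hp0 hp1 hl).never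
  have h2 := h.sum_expPayment_le hR (atOnce p lam hp0 hp1 hl)
  have e1 : quietProb p lam ((badNews p lam hp0 hp1 hl).never.1 quietPoint) = p :=
    quietProb_top hp0 hl
  have e2 : quietProb p lam ((atOnce p lam hp0 hp1 hl).1 quietPoint) = 1 :=
    quietProb_zero hp0 hp1 hl
  rw [hrev, hrev, e1, mul_le_mul_iff_right₀ hp0] at h1
  rw [hrev, hrev, e2, mul_le_mul_iff_right₀ hp0] at h2
  have hy := le_quietProb hp0 hp1 hl (τ.1 quietPoint)
  have hy1 := quietProb_le_one hp0 hp1 hl (τ.1 quietPoint)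
  constructor
  · intro hlt
    refine le_antisymm ?_ hy
    by_contra! hc
    nlinarith
  · intro hgt
    refine le_antisymm hy1 ?_
    by_contra! hc
    nlinarith

/-! ### No equilibrium of the second-price auction is optimal -/

variable {D : ValueDist} {R : ℝ} {β : Fin 2 → ℝ → ℝ}
  {T : (Fin 2 → ℝ) → (badNews p lam hp0 hp1 hl).StoppingTime}

/-- The profit of the higher bidder when the lower bid is less than twice the reserve. -/
theorem high_profit (E : IsEquilibrium D (badNews p lam hp0 hp1 hl) .secondPrice R β T)
    (hR : 0 < R) {b : Fin 2 → ℝ} {i : Fin 2} (hi : R ≤ b i) (hhi : b i.rev < b i)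
    (hlow : b i.rev < 2 * R) (x : ℝ) :
    x * expClicks (badNews p lam hp0 hp1 hl) R (T b) b i
      - expPayment (badNews p lam hp0 hp1 hl) .secondPrice R (T b) b i
      = x * p - p * (if b i.rev < R then R else p * b i.rev + (1 - p) * R) := by
  have hσ := binaryNews_badNews (T b)
  split_ifs with hlo
  · rw [(hσ.secondPrice_solo hp0.le hlo hi).1, (hσ.secondPrice_solo hp0.le hlo hi).2]
  · push Not at hlo
    have hpos := hR.trans_le hlo
    have hsr := E.rational b fun j => by
      rcases eq_or_eq_rev i j with rfl | rfl
      · exact hR.le.trans hi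
      · exact hpos.le
    have hy := (quietProb_of_sequentiallyRational hR.le hlo hhi hpos hsr).1 hlow
    rw [(hσ.secondPrice_high hp0.le hR.le hlo hhi).1, (hσ.secondPrice_high hp0.le hR.le hlo hhi).2,
      hy]

/-- The bids of an equilibrium with an optimal allocation: they are ordered like the values, and the
lower one is at most twice the reserve, since otherwise the auctioneer would sell at once and
misallocate the clicks. -/
theorem bids_of_optimal (hφ : StrictMonoOn D.virtualValue (Ioo 0 D.vbar)) {r : ℝ}
    (hr : r ∈ Ioo 0 D.vbar) (hφr : D.virtualValue r = 0)
    (E : IsEquilibrium D (badNews p lam hp0 hp1 hl) .secondPrice R β T) (hR : 0 ≤ R)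
    {v : Fin 2 → ℝ} (hv : ∀ i, v i ∈ Ioo 0 D.vbar)
    (hopt : ∀ᵐ ω ∂(badNews p lam hp0 hp1 hl).P,
      IsOptimalAllocation D v (fun i => (badNews p lam hp0 hp1 hl).θ i ω)
        (allocation (badNews p lam hp0 hp1 hl) R (T fun j => β j (v j)) (fun j => β j (v j)) ω))
    {i : Fin 2} (hri : r < v i) (hlt : v i.rev < v i) :
    expClicks (badNews p lam hp0 hp1 hl) R (T fun j => β j (v j)) (fun j => β j (v j)) i = p ∧
      R ≤ β i (v i) ∧ β i.rev (v i.rev) < β i (v i) ∧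
      (r < v i.rev → R ≤ β i.rev (v i.rev) ∧ 0 < β i.rev (v i.rev) ∧
        β i.rev (v i.rev) ≤ 2 * R) := by
  have h0 : 0 < D.virtualValue (v i) := hφr ▸ hφ hr (hv i) hri
  obtain ⟨hK, hK'⟩ := optimal_expClicks hp0.le hopt h0 (hφ (hv _) (hv _) hlt)
  have hσ := binaryNews_badNews (T fun j => β j (v j))
  have hy := le_quietProb hp0 hp1 hl ((T fun j => β j (v j)).1 quietPoint)
  have hy1 := quietProb_le_one hp0 hp1 hl ((T fun j => β j (v j)).1 quietPoint)
  obtain ⟨hRi, hhi⟩ := hσ.lt_of_expClicks_eq hp0 (hp0.trans_le hy) hy1 hK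
  refine ⟨hK, hRi, hhi, fun hrr => ?_⟩
  obtain ⟨hlo, hpos, hyp⟩ := hσ.eq_of_expClicks_low hp0 hp1 hR hy hhi
    (hK' (hφr ▸ hφ hr (hv _) hrr))
  refine ⟨hlo, hpos, ?_⟩
  by_contra! hc
  have hsr := E.rational (fun j => β j (v j)) fun j =>
    E.bid_nonneg j _ (Ioo_subset_Icc_self (hv j))
  have := (quietProb_of_sequentiallyRational hR hlo hhi hpos hsr).2 hc
  linarith

theorem exists_of_ae {s : ℝ → Prop} (h : ∀ᵐ x ∂D.law, s x) {a c : ℝ} (ha : 0 ≤ a) (hac : a < c)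
    (hc : c ≤ D.vbar) : ∃ x ∈ Ioo a c, s x := by
  by_contra! hn
  exact (D.law_Ioo_pos ha hac hc).ne' (measure_mono_null (fun x hx => hn x hx) h)

/-- With a strictly increasing virtual value that vanishes at `r`, and values beyond `2 * r`, the
second-price auction has no equilibrium with an optimal allocation. -/
theorem not_optimal_secondPrice (hφ : StrictMonoOn D.virtualValue (Ioo 0 D.vbar)) {r : ℝ}
    (hr : r ∈ Ioo 0 D.vbar) (hφr : D.virtualValue r = 0) (h2r : 2 * r < D.vbar)
    (E : IsEquilibrium D (badNews p lam hp0 hp1 hl) .secondPrice R β T) (hR : 0 ≤ R)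
    (hopt : ∀ᵐ v ∂D.jointLaw, ∀ᵐ ω ∂(badNews p lam hp0 hp1 hl).P,
      IsOptimalAllocation D v (fun i => (badNews p lam hp0 hp1 hl).θ i ω)
        (allocation (badNews p lam hp0 hp1 hl) R (T fun j => β j (v j)) (fun j => β j (v j)) ω)) :
    False := by
  have hmem : ∀ᵐ v ∂D.jointLaw, ∀ i, v i ∈ Ioo 0 D.vbar := ae_all_iff.2 fun i =>
    (measurePreserving_eval (fun _ : Fin 2 => D.law) i).quasiMeasurePreserving.ae D.ae_mem_Ioo
  have hgood := hmem.and (hopt.and hmem) |>.mono fun v hv (i : Fin 2) (hri : r < v i)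
    (hlt : v i.rev < v i) => bids_of_optimal hφ hr hφr E hR hv.1 hv.2.1 hri hlt
  -- Bidder `i` with the value `x` faces bidder `i.rev` with the value `w`.
  have hfub : ∀ i, ∀ᵐ x ∂D.law, ∀ᵐ w ∂D.law,
      (r < x → w < x → expClicks (badNews p lam hp0 hp1 hl) R (T (profile i (β i x) (β i.rev w)))
          (profile i (β i x) (β i.rev w)) i = p ∧ R ≤ β i x ∧ β i.rev w < β i x ∧
          (r < w → R ≤ β i.rev w ∧ 0 < β i.rev w ∧ β i.rev w ≤ 2 * R)) ∧
      (r < x → x < w → β i x < β i.rev w ∧ R ≤ β i x ∧ 0 < β i x ∧ β i x ≤ 2 * R) := by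
    intro i
    filter_upwards [ae_jointLaw i hgood] with x hx
    filter_upwards [hx] with w hw
    refine ⟨fun hrx hlt => ?_, fun hrx hlt => ?_⟩
    · have := hw i (by simpa using hrx) (by simpa using hlt)
      simpa only [map_profile, profile_self, profile_rev] using this
    · have := hw i.rev (by simpa using hrx.trans hlt) (by simpa using hlt)
      simp only [Fin.rev_rev, profile_self, profile_rev] at this
      obtain ⟨h1, h2, h3⟩ := this.2.2.2 hrx
      exact ⟨this.2.2.1, h1, h2, h3⟩
  -- Almost every type above `r` is the lower one with positive probability.
  have hlow : ∀ i, ∀ᵐ x ∂D.law, r < x → R ≤ β i x ∧ 0 < β i x ∧ β i x ≤ 2 * R := by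
    intro i
    filter_upwards [hfub i, D.ae_mem_Ioo] with x hx hxm hrx
    obtain ⟨w, hw, hw'⟩ := exists_of_ae hx hxm.1.le hxm.2 le_rfl
    exact (hw'.2 hrx hw.1).2
  have hlow1 : ∀ᵐ w ∂D.law, r < w → β 1 w < 2 * R := by
    filter_upwards [hfub 1, D.ae_mem_Ioo] with w hw hwm hrw
    obtain ⟨x, hx, hx1, hx2⟩ := exists_of_ae (hw.and (hlow 0)) hwm.1.le hwm.2 le_rfl
    exact ((hx1.2 hrw hx.1).1).trans_le (hx2 (hrw.trans hx.1)).2.2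
  have hRpos : 0 < R := by
    obtain ⟨x, hx, hx1⟩ := exists_of_ae (hlow 0) hr.1.le hr.2 le_rfl
    have := hx1 hx.1
    linarith
  -- Individual rationality of types slightly above `r` bounds the reserve.
  have h2R : 2 * R < D.vbar := by
    obtain ⟨x, hx, hx1, hx2⟩ := exists_of_ae ((hfub 0).and D.ae_mem_Icc) hr.1.le
      (show r < D.vbar / 2 by linarith) (by linarith [D.vbar_pos])
    have hprofit := E.interimProfit_nonneg hR 0 hx2
    rw [E.interimProfit_eq hR] at hprofit
    have hpay : interimClicks D (badNews p lam hp0 hp1 hl) R T β 0 (β 0 x) * R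
        ≤ interimPayment D (badNews p lam hp0 hp1 hl) .secondPrice R T β 0 (β 0 x) := by
      rw [interimClicks, interimPayment, ← integral_mul_const]
      exact integral_mono ((E.integrable_clicks 0 _).mul_const _) (E.integrable_payment hR 0 _)
        fun w => (expPayment_bounds hR _ _ _).1
    have hq : 0 < interimClicks D (badNews p lam hp0 hp1 hl) R T β 0 (β 0 x) := by
      refine lt_of_le_of_ne (E.interimClicks_mem 0 _).1 fun h0 => ?_
      have h1 := (integral_eq_zero_iff_of_nonneg (fun w => (expClicks_mem _ _ _).1)
        (E.integrable_clicks 0 (β 0 x))).1 h0.symm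
      obtain ⟨w, hw, hw1, hw2⟩ := exists_of_ae (hx1.and h1) le_rfl (hr.1.trans hx.1) hx2.2
      have h2 := (hw1.1 hx.1 hw.2).1
      exact hp0.ne (hw2.symm.trans h2)
    have : R ≤ x := by
      by_contra! hc
      nlinarith
    linarith [hx.2]
  -- A high type of bidder `0` gains by outbidding all types of bidder `1`.
  obtain ⟨x, hx, ⟨hx1, hx2⟩, hx3⟩ := exists_of_ae (((hfub 0).and (hlow 0)).and D.ae_mem_Ioo)
    (show 0 ≤ max (2 * R) r from le_max_of_le_right hr.1.le) (max_lt h2R hr.2) le_rfl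
  have hRx : 2 * R < x := (le_max_left _ _).trans_lt hx.1
  have hrx : r < x := (le_max_right _ _).trans_lt hx.1
  obtain ⟨hb1, hb2, hb3⟩ := hx2 hrx
  have hx1' : ∀ᵐ w ∂D.law, w ≠ x := by simp [ae_iff]
  set f : ℝ → ℝ → ℝ := fun a w =>
    x * expClicks (badNews p lam hp0 hp1 hl) R (T (profile 0 a (β 1 w))) (profile 0 a (β 1 w)) 0
      - expPayment (badNews p lam hp0 hp1 hl) .secondPrice R (T (profile 0 a (β 1 w)))
        (profile 0 a (β 1 w)) 0 with hf
  have hfint : ∀ a, Integrable (f a) D.law := fun a =>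
    ((E.integrable_clicks 0 a).const_mul x).sub (E.integrable_payment hR 0 a)
  have hcmp : ∀ᵐ w ∂D.law, f (β 0 x) w ≤ f (2 * R) w ∧ (x < w → f (β 0 x) w < f (2 * R) w) := by
    filter_upwards [hx1, hlow1, hx1'] with w hw1 hw2 hwx
    have hw3 : β 1 w < 2 * R := by
      rcases lt_or_ge r w with h | h
      · exact hw2 h
      · exact ((hw1.1 hrx (h.trans_lt hrx)).2.2.1).trans_le hb3
    have hdev : f (2 * R) w = x * p - p * (if β 1 w < R then R else p * β 1 w + (1 - p) * R) :=
      high_profit E hRpos (b := profile 0 (2 * R) (β 1 w)) (i := 0)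
        (show R ≤ 2 * R by linarith) hw3 hw3 x
    rcases lt_or_gt_of_ne hwx with hlt | hgt
    · have heq : f (β 0 x) w = x * p - p * (if β 1 w < R then R else p * β 1 w + (1 - p) * R) :=
        high_profit E hRpos (b := profile 0 (β 0 x) (β 1 w)) (i := 0) hb1
          (hw1.1 hrx hlt).2.2.1 hw3 x
      exact ⟨(heq.trans hdev.symm).le, fun h => absurd h hlt.not_gt⟩
    · have hhi := (hw1.2 hrx hgt).1
      have hσ := binaryNews_badNews (T (profile 0 (β 0 x) (β 1 w)))
      have hlo := hσ.secondPrice_low (R := R) (b := profile 0 (β 0 x) (β 1 w)) (i := 1) hp0.le hR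
        hb1 hhi hb2
      have heq : f (β 0 x) w = x * (p * (1 - quietProb p lam
            ((T (profile 0 (β 0 x) (β 1 w))).1 quietPoint)))
          - p * (1 - quietProb p lam ((T (profile 0 (β 0 x) (β 1 w))).1 quietPoint)) * R := by
        rw [← hlo.2, ← hlo.1]
        rfl
      have hy := le_quietProb hp0 hp1 hl ((T (profile 0 (β 0 x) (β 1 w))).1 quietPoint)
      have hcR : ¬ β 1 w < R := (hb1.trans hhi.le).not_gt
      rw [if_neg hcR] at hdev
      have hstrict : f (β 0 x) w < f (2 * R) w := by
        rw [heq, hdev]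
        have h1 : 0 < p * p * (x - β 1 w) := mul_pos (mul_pos hp0 hp0) (by linarith)
        have h2 : 0 ≤ p * (quietProb p lam ((T (profile 0 (β 0 x) (β 1 w))).1 quietPoint) - p)
            * (x - R) :=
          mul_nonneg (mul_nonneg hp0.le (by linarith)) (by linarith)
        nlinarith
      exact ⟨hstrict.le, fun _ => hstrict⟩
  have hbest : ∫ w, f (2 * R) w ∂D.law ≤ ∫ w, f (β 0 x) w ∂D.law :=
    E.best_reply 0 x (Ioo_subset_Icc_self hx3) (2 * R) (by linarith)
  have hle : f (β 0 x) ≤ᵐ[D.law] f (2 * R) := hcmp.mono fun w h => h.1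
  have heq := (integral_eq_iff_of_ae_le (hfint _) (hfint _) hle).1
    (le_antisymm (integral_mono_ae (hfint _) (hfint _) hle) hbest)
  obtain ⟨w, hw, hw1, hw2⟩ := exists_of_ae (hcmp.and heq) hx3.1.le hx3.2 le_rfl
  exact (hw1.2 hw.1).ne hw2

end BadNews

/-! ### A distribution with a low reserve -/

/-- The triangular distribution on `[0, 1]` with density `2 * (1 - v)`. -/
def triangular : ValueDist where
  vbar := 1
  f := (Icc (0 : ℝ) 1).indicator fun v => 2 * (1 - v)
  vbar_pos := one_pos
  measurable_f := (measurable_const.mul (measurable_const.sub measurable_id)).indicator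
    measurableSet_Icc
  f_nonneg v := indicator_nonneg (fun v hv => by linarith [hv.2]) v
  f_pos v hv := by
    rw [indicator_of_mem (Ioo_subset_Icc_self hv)]
    linarith [hv.2]
  f_support v hv := indicator_of_notMem hv _
  lintegral_f := by
    have h0 : ∀ v, 0 ≤ (Icc (0 : ℝ) 1).indicator (fun v => 2 * (1 - v)) v := fun v =>
      indicator_nonneg (fun v hv => by linarith [hv.2]) v
    have hi : Integrable ((Icc (0 : ℝ) 1).indicator fun v => 2 * (1 - v)) :=
      (integrable_indicator_iff measurableSet_Icc).2
        (Continuous.integrableOn_Icc (by fun_prop))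
    have h1 : ∫ v, (Icc (0 : ℝ) 1).indicator (fun v => 2 * (1 - v)) v = 1 := by
      rw [integral_indicator measurableSet_Icc, integral_Icc_eq_integral_Ioc,
        ← intervalIntegral.integral_of_le zero_le_one, intervalIntegral.integral_const_mul,
        intervalIntegral.integral_sub (by simp) (by simp)]
      norm_num
    rw [← ofReal_integral_eq_lintegral_ofReal hi (ae_of_all _ h0), h1, ENNReal.ofReal_one]

theorem triangular_virtualValue {v : ℝ} (hv : v ∈ Ioo (0 : ℝ) 1) :
    triangular.virtualValue v = (3 * v - 1) / 2 := by
  have hcdf : triangular.cdf v = 2 * v - v ^ 2 := by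
    rw [triangular.cdf_eq_integral]
    change ∫ x in Iic v, (Icc (0 : ℝ) 1).indicator (fun v => 2 * (1 - v)) x = _
    have hset : Iic v ∩ Icc 0 1 = Icc 0 v := by
      ext x
      simp only [mem_inter_iff, mem_Iic, mem_Icc]
      exact ⟨fun h => ⟨h.2.1, h.1⟩, fun h => ⟨h.2, h.1, h.2.trans hv.2.le⟩⟩
    rw [setIntegral_indicator measurableSet_Icc, hset, integral_Icc_eq_integral_Ioc,
      ← intervalIntegral.integral_of_le hv.1.le, intervalIntegral.integral_const_mul,
      intervalIntegral.integral_sub (by simp) (by simp)]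
    simp
    ring
  have hf : triangular.f v = 2 * (1 - v) :=
    indicator_of_mem (Ioo_subset_Icc_self hv) fun v => 2 * (1 - v)
  have h1 : 1 - v ≠ 0 := by linarith [hv.2]
  rw [ValueDist.virtualValue, hcdf, hf]
  field_simp
  ring

theorem triangular_strictMonoOn :
    StrictMonoOn triangular.virtualValue (Ioo 0 triangular.vbar) := by
  intro v hv w hw hvw
  rw [triangular_virtualValue hv, triangular_virtualValue hw]
  linarith

end AdAuction
end

theorem mainTheorem2 :
    -- The first-price auction, for every identifiable conversation and every regular distribution.
    (∀ (p : ℝ), 0 < p → p < 1 →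
      ∀ (Ω : Type*) [MeasurableSpace Ω] (C : Conversation Ω p), C.Identifiable →
      ∀ D : ValueDist, D.Regular →
        (∃ R : ℝ, 0 ≤ R ∧ FirstPriceImplements D C R) ∧
        (∀ R ∈ Set.Ioo 0 D.vbar, D.virtualValue R = 0 → FirstPriceImplements D C R)) ∧
    -- The second-price auction, in the Poisson bad-news model, for some regular distribution:
    -- no equilibrium has the optimal allocation, nor the optimal revenue.
    (∃ D : ValueDist, D.Regular ∧
      ∀ (p lam : ℝ) (hp0 : 0 < p) (hp1 : p < 1) (hl : 0 < lam) (R : ℝ), 0 ≤ R →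
      ∀ (β : Fin 2 → ℝ → ℝ) (T : (Fin 2 → ℝ) → (badNews p lam hp0 hp1 hl).StoppingTime),
        IsEquilibrium D (badNews p lam hp0 hp1 hl) .secondPrice R β T →
        ¬ (∀ᵐ v ∂D.jointLaw, ∀ᵐ ω ∂(badNews p lam hp0 hp1 hl).P,
            IsOptimalAllocation D v (fun i => (badNews p lam hp0 hp1 hl).θ i ω)
              (allocation (badNews p lam hp0 hp1 hl) R (T fun j => β j (v j))
                (fun j => β j (v j)) ω)) ∧
        ∃ r ∈ attainableRevenues D (badNews p lam hp0 hp1 hl),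
          auctionRevenue D (badNews p lam hp0 hp1 hl) .secondPrice R β T < r) := by
  refine ⟨fun p hp0 hp1 Ω _ C hC D hD => ⟨(exists_firstPriceImplements hp0 hp1 hC hD).1,
    fun R hR h0 => firstPriceImplements_of_virtualValue_eq_zero hp0 hp1 hC hD hR h0⟩,
    triangular, triangular_strictMonoOn.monotoneOn, fun p lam hp0 hp1 hl R hR β T E => ?_⟩
  have hthird : (1 / 3 : ℝ) ∈ Ioo 0 triangular.vbar := by
    change (1 / 3 : ℝ) ∈ Ioo 0 1
    constructor <;> norm_num
  have hnot := not_optimal_secondPrice triangular_strictMonoOn hthird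
    (by rw [triangular_virtualValue hthird]; norm_num)
    (show 2 * (1 / 3 : ℝ) < 1 by norm_num) E hR
  refine ⟨hnot, _, (exists_firstPriceImplements (D := triangular) hp0 hp1
    (badNews_identifiable (hp0 := hp0) (hp1 := hp1) (hl := hl))
    triangular_strictMonoOn.monotoneOn).2, lt_of_le_of_ne (E.auctionRevenue_le hR) fun h => ?_⟩
  exact hnot ((E.auctionRevenue_eq_iff hR).1 h)
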